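/- Setting. Let $U,V$ be infinite-dimensional real separable Hilbert spaces, let $Q_1,Q_2$ be injective symmetric non-negative trace class operators on $U$ and $V$ with orthonormal bases of eigenvectors $(d_k)_{k}$, $(e_k)_{k}$ and positive eigenvalues $(\lambda_{1,k})_k$, $(\lambda_{2,k})_k$ decreasing to zero, and let $\mu_1=N(0,Q_1)$ be the centred Gaussian measure on $U$ with covariance $Q_1$. Powers $Q_i^s$, $s\in\mathbb R$, are defined by the spectral calculus. Put $U_n=\mathrm{span}\{d_1,\dots,d_n\}$, $V_n=\mathrm{span}\{e_1,\dots,e_n\}$. For $k\in\mathbb N\cup\{\infty\}$, $\mathcal FC_b^k(B_U)$ is the set of functions $u\mapsto\varphi((u,d_1)_U,\dots,(u,d_n)_U)$ with $n\in\mathbb N$, $\varphi\in C^k(\mathbb R^n)$, and $\varphi$ and all its derivatives up to order $k$ bounded. For $\theta\ge0$, $W^{1,2}_{Q_1^\theta}(U;\mu_1)$ is the domain of the closure in $L^2(U;\mu_1)$ of $Q_1^\theta D:\mathcal FC_b^1(B_U)\to L^2(U;\mu_1;U)$; the closure is again denoted by $Q_1^\theta D$. Let $K_{12}\in\mathcal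 L(U;V)$ and $K_{21}=K_{12}^*$ be such that $K_{21}K_{12}$ is positive, i.e. $(K_{21}K_{12}u,u)_U>0$ for $u\ne0$, and such that for some strictly increasing sequence $(m_k)_k$ in $\mathbb N$ we have $K_{12}(U_{m_k})\subseteq V_{m_k}$ and $K_{21}(V_{m_k})\subseteq U_{m_k}$ for all $k$. Set $C=K_{21}Q_2^{-1}K_{12}$ with $D(C)=\{u\in U: K_{12}u\in D(Q_2^{-1})\}$. Let $\theta\ge 0$ and let $\Phi:U\to(-\infty,\infty]$ be measurable, bounded from below and in $W^{1,2}_{Q_1^\theta}(U;\mu_1)$. Set $\mu_1^\Phi=\big(\int_U e^{-\Phi}\,d\mu_1\big)^{-1}e^{-\Phi}\mu_1$, and for $f\in\mathcal FC_b^\infty(B_U)$ $$N^\Phi f=\mathrm{tr}[CD^2f]-(u,Q_1^{-1}CDf)_U-(Q_1^\theta D\Phi,\,Q_1^{-\theta}CDf)_U .$$ Assume that $\Phi=\Phi_1+\Phi_2$ with $\Phi_1:U\to(-\infty,\infty]$, $\Phi_2:U\to\mathbb R$, where: (1) $\inf_U\Phi_1>-\infty$, $\Phi_1\in W^{1,2}_{Q_1^\theta}(U;\mu_1)$,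 and there are convex functions $\Phi_{1,n,m}:U\to\mathbb R$, $n,m\in\mathbb N$, which are differentiable with Lipschitz continuous derivative, such that for $\mu_1$-almost every $u$ we have $\inf_U\Phi_1\le\Phi_{1,n,m}(u)$ for all $n,m$ and $\lim_{n\to\infty}\lim_{m\to\infty}\Phi_{1,n,m}(u)=\Phi_1(u)$, and such that $\lim_{n\to\infty}\lim_{m\to\infty}\|(Q_1^\theta D\Phi_{1,n,m}-Q_1^\theta D\Phi_1,d_k)_U\|_{L^2(\mu_1)}=0$ for all $k$; (2) $\Phi_2$ is bounded and twice continuously Fréchet differentiable with bounded first derivative and with second derivative in $L^1(U;\mu_1^\Phi)$, and there is a constant $c_{\Phi_2}\in[0,\infty)$ such that for all $n\in\mathbb N$, $\tilde u\in U$ and $u\in U_n$ $$(D^2\Phi_2(\tilde u)Cu,Cu)_U\ge -c_{\Phi_2}(Cu,u)_U .$$ Claim. For every $f\in\mathcal FC_b^\infty(B_U)$ and $g=f-N^\Phi f$ we have $g\in L^2(U;\mu_1^\Phi)$, the integrand on the left below is $\mu_1^\Phi$-integrable, and $$\int_U \mathrm{tr}\big[(CD^2f)^2\big]+\big\|Q_1^{-\frac12}CDf\big\|_U^2\,d\mu_1^\Phi\le\Big(4+\frac{c_{\Phi_2}}4\Big)\int_U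 g^2\,d\mu_1^\Phi .$$ -/

import Mathlib

open MeasureTheory Filter Topology
open scoped ENNReal InnerProductSpace NNReal

noncomputable section

/-- Value of a partially defined linear operator, extended by `0` outside its domain. -/
def LinearPMap.ev {E F : Type*} [AddCommGroup E] [Module ℝ E] [AddCommGroup F] [Module ℝ F]
    (T : E →ₗ.[ℝ] F) (x : E) : F :=
  open Classical in if h : x ∈ T.domain then T ⟨x, h⟩ else 0

section Hilbert

variable {E : Type*} [NormedAddCommGroup E] [InnerProductSpace ℝ E]

/-- `Q` is an injective covariance operator: it is diagonal in the orthonormal basis `d`, with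
positive eigenvalues `lam` which are summable (trace class) and decrease to zero. -/
structure IsCovarianceOp (Q : E →L[ℝ] E) (d : HilbertBasis ℕ ℝ E) (lam : ℕ → ℝ) : Prop where
  eigen : ∀ k, Q (d k) = lam k • d k
  pos : ∀ k, 0 < lam k
  antitone : Antitone lam
  summable : Summable lam

/-- `μ` is the centred Gaussian measure `N(0, Q)`: its characteristic function is
`x ↦ exp (-(Q x, x) / 2)`. -/
def IsCenteredGaussian [MeasurableSpace E] (μ : Measure E) (Q : E →L[ℝ] E) : Prop :=
  IsProbabilityMeasure μ ∧
    ∀ x : E, charFun μ x = Complex.exp (-(1 / 2 : ℂ) * ((⟪Q x, x⟫_ℝ : ℝ) : ℂ))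

/-- The domain `{x | ∑ k, (lam k ^ s * (x, d k)) ^ 2 < ∞}` of the operator below. -/
def covPowDomain (d : HilbertBasis ℕ ℝ E) (lam : ℕ → ℝ) (s : ℝ) : Submodule ℝ E where
  carrier := {x | Memℓp (fun k => lam k ^ s * d.repr x k) 2}
  zero_mem' := by
    have h : Memℓp (0 : ℕ → ℝ) 2 := zero_memℓp
    have h0 : (fun k => lam k ^ s * d.repr (0 : E) k) = (0 : ℕ → ℝ) := by
      funext k
      simp
    rw [Set.mem_ofPred_eq, h0]
    exact h
  add_mem' := by
    intro a b ha hb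
    have h0 : (fun k => lam k ^ s * d.repr (a + b) k) =
        (fun k => lam k ^ s * d.repr a k) + fun k => lam k ^ s * d.repr b k := by
      funext k
      simp [mul_add]
    rw [Set.mem_ofPred_eq, h0]
    exact Memℓp.add ha hb
  smul_mem' := by
    intro c x hx
    have h0 : (fun k => lam k ^ s * d.repr (c • x) k) =
        c • fun k => lam k ^ s * d.repr x k := by
      funext k
      simp only [map_smul, lp.coeFn_smul, Pi.smul_apply, smul_eq_mul]
      ring
    rw [Set.mem_ofPred_eq, h0]
    exact Memℓp.const_smul hx c

/-- The power `Q ^ s`, `s ∈ ℝ`, of the operator with eigenbasis `d` and eigenvalues `lam`, as a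
(possibly unbounded) operator with its maximal domain:
`Q ^ s x = ∑ k, lam k ^ s * (x, d k) • d k`. -/
def covPow (d : HilbertBasis ℕ ℝ E) (lam : ℕ → ℝ) (s : ℝ) : E →ₗ.[ℝ] E where
  domain := covPowDomain d lam s
  toFun :=
    { toFun := fun x => d.repr.symm
        (⟨fun k => lam k ^ s * d.repr (x : E) k, x.2⟩ : lp (fun _ : ℕ => ℝ) 2)
      map_add' := by
        intro x y
        rw [← map_add]
        refine congrArg d.repr.symm (lp.ext (funext fun k => ?_))
        change lam k ^ s * d.repr ((x : E) + (y : E)) k =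
          lam k ^ s * d.repr (x : E) k + lam k ^ s * d.repr (y : E) k
        rw [map_add, lp.coeFn_add, Pi.add_apply, mul_add]
      map_smul' := by
        intro c x
        rw [RingHom.id_apply, ← map_smul]
        refine congrArg d.repr.symm (lp.ext (funext fun k => ?_))
        change lam k ^ s * d.repr (c • (x : E)) k = c * (lam k ^ s * d.repr (x : E) k)
        rw [map_smul, lp.coeFn_smul, Pi.smul_apply, smul_eq_mul]
        ring }

/-- The span of the first `n` basis vectors. -/
def finSpan (d : HilbertBasis ℕ ℝ E) (n : ℕ) : Submodule ℝ E :=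
  Submodule.span ℝ (Set.range fun i : Fin n => d i)

theorem repr_eq_zero_of_mem_finSpan (d : HilbertBasis ℕ ℝ E) (n : ℕ) {x : E}
    (hx : x ∈ finSpan d n) {k : ℕ} (hk : n ≤ k) : d.repr x k = 0 := by
  rw [d.repr_apply_apply]
  induction hx using Submodule.span_induction with
  | mem y hy =>
    obtain ⟨i, rfl⟩ := hy
    exact d.orthonormal.2 (by have := i.2; omega)
  | zero => simp
  | add y z _ _ hy hz => rw [inner_add_right, hy, hz, add_zero]
  | smul c y _ hy => rw [inner_smul_right, hy, mul_zero]

/-- Finitely based vectors belong to the domain of all powers. -/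
theorem finSpan_le_covPow_domain (d : HilbertBasis ℕ ℝ E) (lam : ℕ → ℝ) (s : ℝ) (n : ℕ) :
    finSpan d n ≤ (covPow d lam s).domain := by
  intro x hx
  change Memℓp (fun k => lam k ^ s * d.repr x k) 2
  refine memℓp_gen (summable_of_ne_finset_zero (s := Finset.range n) ?_)
  intro k hk
  rw [repr_eq_zero_of_mem_finSpan d n hx (by simpa using hk)]
  simp

theorem covPow_mem_finSpan (d : HilbertBasis ℕ ℝ E) (lam : ℕ → ℝ) (s : ℝ) (n : ℕ)
    (x : (covPow d lam s).domain) (hx : (x : E) ∈ finSpan d n) :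
    covPow d lam s x ∈ finSpan d n := by
  have h := d.hasSum_repr (covPow d lam s x)
  have h0 : ∀ k, d.repr (covPow d lam s x) k = lam k ^ s * d.repr (x : E) k := by
    intro k
    change d.repr (d.repr.symm _) k = _
    rw [LinearIsometryEquiv.apply_symm_apply]
  rw [← h.tsum_eq, tsum_eq_sum (s := Finset.range n)]
  · refine Submodule.sum_mem _ fun k hk => Submodule.smul_mem _ _ (Submodule.subset_span ?_)
    exact ⟨⟨k, by simpa using hk⟩, rfl⟩
  · intro k hk
    rw [h0, repr_eq_zero_of_mem_finSpan d n hx (by simpa using hk)]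
    simp

/-- The coordinate map `u ↦ ((u, d 0), …, (u, d (n - 1)))`. -/
def coordMap (d : HilbertBasis ℕ ℝ E) (n : ℕ) (u : E) : EuclideanSpace ℝ (Fin n) :=
  WithLp.toLp 2 fun i => ⟪u, d i⟫_ℝ

/-- Cylinder functions `φ ∘ coordMap d n`, where `φ` is of class `C ^ k` and is bounded together
with all its derivatives up to order `k`. -/
def IsCylinder (d : HilbertBasis ℕ ℝ E) (k : ℕ∞) (f : E → ℝ) : Prop :=
  ∃ (n : ℕ) (φ : EuclideanSpace ℝ (Fin n) → ℝ), ContDiff ℝ k φ ∧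
    (∀ j : ℕ, (j : ℕ∞) ≤ k → ∃ B : ℝ, ∀ x, ‖iteratedFDeriv ℝ j φ x‖ ≤ B) ∧
    f = fun u => φ (coordMap d n u)

/-- Trace of an operator, computed in the basis `d`; for the operators below all but finitely many
terms vanish. -/
def traceIn (d : HilbertBasis ℕ ℝ E) (T : E → E) : ℝ :=
  ∑' k, ⟪T (d k), d k⟫_ℝ

/-- The Gibbs probability measure with potential `Φ`, that is, `exp (-Φ) μ` divided by the
constant `∫ exp (-Φ) dμ`. -/
def gibbsMeasure [MeasurableSpace E] (μ : Measure E) (Φ : E → EReal) : Measure E :=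
  (∫⁻ u, (-Φ u).exp ∂μ)⁻¹ • μ.withDensity fun u => (-Φ u).exp

/-- `lim_{n → ∞} lim_{m → ∞} a n m = x`. -/
def IteratedLim {X : Type*} [TopologicalSpace X] (a : ℕ → ℕ → X) (x : X) : Prop :=
  ∃ b : ℕ → X, (∀ n, Tendsto (fun m => a n m) atTop (𝓝 (b n))) ∧ Tendsto b atTop (𝓝 x)

end Hilbert

section Sobolev

variable {U : Type*} [NormedAddCommGroup U] [InnerProductSpace ℝ U] [CompleteSpace U]

/-- The Hessian operator of `f` at `u`, i.e. the derivative of the gradient. -/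
def hess (f : U → ℝ) (u : U) : U →L[ℝ] U := fderiv ℝ (gradient f) u

/-- The gradient of a function of finitely many coordinates is finitely based. -/
theorem gradient_mem_finSpan (d : HilbertBasis ℕ ℝ U) (n : ℕ)
    (φ : EuclideanSpace ℝ (Fin n) → ℝ) (hφ : ContDiff ℝ 1 φ) (u : U) :
    gradient (fun v => φ (coordMap d n v)) u ∈ finSpan d n := by
  let p : U →L[ℝ] EuclideanSpace ℝ (Fin n) :=
    (EuclideanSpace.equiv (Fin n) ℝ).symm.toContinuousLinearMap.comp
      (ContinuousLinearMap.pi fun i : Fin n => innerSL ℝ (d i))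
  have hp : coordMap d n = p := by
    funext v; ext i
    simp [coordMap, p, real_inner_comm]
  have : FiniteDimensional ℝ (finSpan d n) :=
    FiniteDimensional.span_of_finite ℝ (Set.finite_range _)
  rw [← Submodule.orthogonal_orthogonal (finSpan d n)]
  intro x hx
  have hpx : p x = 0 := by
    rw [← hp]; ext i
    exact (Submodule.mem_orthogonal' _ _).1 hx _ (Submodule.subset_span ⟨i, rfl⟩)
  have hd : DifferentiableAt ℝ φ (p u) := hφ.differentiable one_ne_zero _
  have : HasFDerivAt (fun v => φ (coordMap d n v)) ((fderiv ℝ φ (p u)).comp p) u := by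
    rw [hp]
    exact hd.hasFDerivAt.comp u p.hasFDerivAt
  rw [real_inner_comm, gradient, InnerProductSpace.toDual_symm_apply, this.fderiv]
  simp [hpx]

/-- The Hessian of a function of finitely many coordinates has finitely based values. -/
theorem hess_mem_finSpan (d : HilbertBasis ℕ ℝ U) (n : ℕ)
    (φ : EuclideanSpace ℝ (Fin n) → ℝ) (hφ : ContDiff ℝ 1 φ) (u v : U) :
    hess (fun v => φ (coordMap d n v)) u v ∈ finSpan d n := by
  have : FiniteDimensional ℝ (finSpan d n) :=
    FiniteDimensional.span_of_finite ℝ (Set.finite_range _)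
  rw [← Submodule.orthogonal_orthogonal (finSpan d n)]
  intro x hx
  by_cases h : DifferentiableAt ℝ (gradient (fun v => φ (coordMap d n v))) u
  · have h1 := ((innerSL ℝ x).hasFDerivAt (x := _)).comp u h.hasFDerivAt
    have h2 : (innerSL ℝ x) ∘ (gradient (fun v => φ (coordMap d n v))) = fun _ => 0 := by
      funext w
      exact (Submodule.mem_orthogonal' _ _).1 hx _ (gradient_mem_finSpan d n φ hφ w)
    rw [h2] at h1
    have h3 := h1.unique (hasFDerivAt_const (0 : ℝ) u)
    exact DFunLike.congr_fun h3 v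
  · simp [hess, fderiv_zero_of_not_differentiableAt h]

/-- `Φ` belongs to the domain of the closure of `Q ^ θ D : FC_b^1 → L²(μ; U)` in `L²(μ)`, and the
closure maps `Φ` to `G`, i.e. `G = Q ^ θ D Φ`. Extended real valued functions are
identified with their almost everywhere finite representatives. -/
def HasSobolevGrad [MeasurableSpace U] (d : HilbertBasis ℕ ℝ U) (lam : ℕ → ℝ) (θ : ℝ)
    (μ : Measure U) (Φ : U → EReal) (G : U → U) : Prop :=
  (∀ᵐ u ∂μ, Φ u ≠ ⊤ ∧ Φ u ≠ ⊥) ∧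
  MemLp (fun u => (Φ u).toReal) 2 μ ∧ MemLp G 2 μ ∧
  ∃ f : ℕ → U → ℝ, (∀ j, IsCylinder d 1 (f j)) ∧
    Tendsto (fun j => eLpNorm (fun u => f j u - (Φ u).toReal) 2 μ) atTop (𝓝 0) ∧
    Tendsto (fun j => eLpNorm (fun u => (covPow d lam θ).ev (gradient (f j) u) - G u) 2 μ)
      atTop (𝓝 0)

/-- Approximability of `Φ₁` by convex functions with Lipschitz continuous derivative. -/
def ConvexApprox [MeasurableSpace U] (d : HilbertBasis ℕ ℝ U) (lam : ℕ → ℝ) (θ : ℝ)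
    (μ : Measure U) (Φ₁ : U → EReal) : Prop :=
  (⊥ < ⨅ v, Φ₁ v) ∧
  ∃ (G₁ : U → U) (Ψ : ℕ → ℕ → U → ℝ),
    HasSobolevGrad d lam θ μ Φ₁ G₁ ∧
    (∀ n m, ConvexOn ℝ Set.univ (Ψ n m)) ∧
    (∀ᵐ u ∂μ, ∀ n m, (⨅ v, Φ₁ v) ≤ ((Ψ n m u : ℝ) : EReal)) ∧
    (∀ᵐ u ∂μ, IteratedLim (fun n m => ((Ψ n m u : ℝ) : EReal)) (Φ₁ u)) ∧
    (∀ n m, Differentiable ℝ (Ψ n m) ∧ ∃ L : ℝ≥0, LipschitzWith L (fderiv ℝ (Ψ n m))) ∧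
    ∀ k, IteratedLim
      (fun n m => eLpNorm
        (fun u => ⟪(covPow d lam θ).ev (gradient (Ψ n m) u) - G₁ u, d k⟫_ℝ) 2 μ) 0

variable {V : Type*} [NormedAddCommGroup V] [InnerProductSpace ℝ V] [CompleteSpace V]

/-- The coefficient operator has a block structure: there is a strictly increasing sequence `m`
such that `K₁₂` maps `U_{m k}` into `V_{m k}` and its adjoint `K₂₁` maps `V_{m k}` into
`U_{m k}`. -/
def BlockInvariant (d : HilbertBasis ℕ ℝ U) (e : HilbertBasis ℕ ℝ V) (K₁₂ : U →L[ℝ] V) : Prop :=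
  ∃ m : ℕ → ℕ, StrictMono m ∧ ∀ k,
    (∀ u ∈ finSpan d (m k), K₁₂ u ∈ finSpan e (m k)) ∧
    (∀ v ∈ finSpan e (m k), K₁₂.adjoint v ∈ finSpan d (m k))

/-- The operator `C = K₂₁ Q₂⁻¹ K₁₂` with domain `{u | K₁₂ u ∈ D(Q₂⁻¹)}`, where `Q₂` has
eigenbasis `e` and eigenvalues `lam₂`. -/
def opC (e : HilbertBasis ℕ ℝ V) (lam₂ : ℕ → ℝ) (K₁₂ : U →L[ℝ] V) : U →ₗ.[ℝ] U where
  domain := (covPow e lam₂ (-1)).domain.comap (K₁₂ : U →ₗ[ℝ] V)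
  toFun :=
    { toFun := fun u => K₁₂.adjoint (covPow e lam₂ (-1) ⟨K₁₂ u, u.2⟩)
      map_add' := by
        intro x y
        rw [← map_add, ← LinearPMap.map_add]
        congr 2
        exact Subtype.ext (map_add K₁₂ _ _)
      map_smul' := by
        intro c x
        rw [RingHom.id_apply, ← map_smul, ← LinearPMap.map_smul]
        congr 2
        exact Subtype.ext (map_smul K₁₂ _ _) }

/-- `C` is defined on finitely based vectors, and maps them to finitely based vectors. -/
theorem opC_finSpan {d : HilbertBasis ℕ ℝ U} {e : HilbertBasis ℕ ℝ V} {K₁₂ : U →L[ℝ] V}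
    (hK : BlockInvariant d e K₁₂) (lam₂ : ℕ → ℝ) (n : ℕ) :
    ∃ N, ∀ u ∈ finSpan d n, ∃ h : u ∈ (opC e lam₂ K₁₂).domain,
      opC e lam₂ K₁₂ ⟨u, h⟩ ∈ finSpan d N := by
  obtain ⟨m, hm, h⟩ := hK
  refine ⟨m n, fun u hu => ?_⟩
  have hu' : u ∈ finSpan d (m n) := by
    refine Submodule.span_mono ?_ hu
    rintro _ ⟨i, rfl⟩
    exact ⟨⟨i, i.2.trans_le (hm.id_le n)⟩, rfl⟩
  have h1 := (h n).1 u hu'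
  have h2 : K₁₂ u ∈ (covPow e lam₂ (-1)).domain := finSpan_le_covPow_domain e lam₂ _ _ h1
  exact ⟨h2, (h n).2 _ (covPow_mem_finSpan e lam₂ _ _ ⟨K₁₂ u, h2⟩ h1)⟩

/-- `Φ₂` is bounded, twice continuously Fréchet differentiable with bounded first derivative and
with second derivative in `L¹(ν)`, and it is semi-convex along `C` with constant `c`. -/
def SemiConvexAlong [MeasurableSpace U] (d : HilbertBasis ℕ ℝ U) (C : U →ₗ.[ℝ] U)
    (ν : Measure U) (Φ₂ : U → ℝ) (c : ℝ) : Prop :=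
  (∃ B : ℝ, ∀ u, |Φ₂ u| ≤ B) ∧ ContDiff ℝ 2 Φ₂ ∧ (∃ B : ℝ, ∀ u, ‖fderiv ℝ Φ₂ u‖ ≤ B) ∧
  Integrable (fun u => ‖hess Φ₂ u‖) ν ∧ 0 ≤ c ∧
  ∀ (n : ℕ) (w : U), ∀ u ∈ finSpan d n,
    ⟪hess Φ₂ w (C.ev u), C.ev u⟫_ℝ ≥ -c * ⟪C.ev u, u⟫_ℝ

/-- The perturbed Ornstein-Uhlenbeck operator
`N f = tr[C D² f] - (u, Q₁⁻¹ C D f) - (D Φ, C D f)` on cylinder functions. Here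
`G = Q₁ ^ θ D Φ`, and the last term is interpreted as `(Q₁ ^ θ D Φ, Q₁ ^ (-θ) C D f)`. -/
def opN (d : HilbertBasis ℕ ℝ U) (lam₁ : ℕ → ℝ) (C : U →ₗ.[ℝ] U) (θ : ℝ) (G : U → U)
    (f : U → ℝ) (u : U) : ℝ :=
  traceIn d (fun v => C.ev (hess f u v))
    - ⟪u, (covPow d lam₁ (-1)).ev (C.ev (gradient f u))⟫_ℝ
    - ⟪G u, (covPow d lam₁ (-θ)).ev (C.ev (gradient f u))⟫_ℝ

/-- The integrand `tr[(C D² f)²] + ‖Q₁ ^ (-1/2) C D f‖²`. -/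
def secondOrderTerm (d : HilbertBasis ℕ ℝ U) (lam₁ : ℕ → ℝ) (C : U →ₗ.[ℝ] U)
    (f : U → ℝ) (u : U) : ℝ :=
  traceIn d (fun v => C.ev (hess f u (C.ev (hess f u v))))
    + ‖(covPow d lam₁ (-(1 / 2))).ev (C.ev (gradient f u))‖ ^ 2

end Sobolev

end

/-! The estimate is an integrated Bochner inequality. A cylinder function depends on finitely many
coordinates, and their number N can be taken from the block sequence, so that C acts on the span of
the first N basis vectors as a matrix. If f is φ of these coordinates and h = C∇φ, then CD²f becomes
Dh, and `opN` becomes the divergence δh of the field h with respect to the weight e^{-W}, where W is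
the Gaussian quadratic form plus the potential. For smooth W, two integrations by parts give ∫ (δh)²
= ∫ tr[(Dh)²] + ⟨D²W h, h⟩. The Gaussian part of W contributes ‖Q₁^{-1/2}h‖², a convex potential
contributes a nonnegative term, and Φ₂ contributes at least -c q(h), where q(v) = ⟨v, C⁻¹v⟩ and
hence q(h) = ⟨C∇φ, ∇φ⟩.

The resolvent equation controls what remains. Since ∫ φ δh = -∫ q(h), one has ∫ g² = ∫ φ² + 2∫ q(h)
+ ∫ (δh)² for g = φ - δh. This yields ∫ (δh)² ≤ ∫ g², and together with ∫ (φ + δh)² ≥ 0 it yields 4∫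
q(h) ≤ ∫ g². The constant obtained is 1 + c/4, which is better than the one claimed.

The convex approximations are only C¹, so D²W is unavailable. The lower bound on the Hessian is
replaced by a lower bound on ⟨∇W(x+v) - ∇W(x), v⟩, and ∇W is mollified inside the proof
(`exists_contDiff_approx_of_monotone`, `integral_bochner_le_of_hasCompactSupport`). Cutoffs remove
the compact support (`integral_bochner_le`), and `integral_resolvent_le` adds the algebra above.

The passage to infinite dimensions is by disintegration: under μ₁ the first N coordinates are
independent of the others (`measurePreserving_fiberPt`), so the finite-dimensional estimate is
applied on almost every fibre and integrated. This settles potentials Ψ + Φ₂ with Ψ convex and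
regular.

For Φ itself the iterated limit is taken. The weights converge boundedly, thanks to the common lower
bound. Replacing DΨ by the Sobolev gradient changes g by an error tending to zero in L²(μ₁), because
only finitely many components enter. Identifying the limit requires G = G₁ + Q₁^θ DΦ₂ componentwise
almost everywhere (`HasSobolevGrad.inner_eq_add`); this follows from Gaussian integration by parts
against trigonometric test functions and uniqueness of Fourier transforms. -/

theorem continuous_gradient {E : Type*} [NormedAddCommGroup E] [InnerProductSpace ℝ E]
    [CompleteSpace E] {W : E → ℝ} (hW : ContDiff ℝ 1 W) : Continuous (gradient W) :=
  (InnerProductSpace.toDual ℝ E).symm.continuous.comp (hW.continuous_fderiv one_ne_zero)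

/-! ### Trace, weighted divergence and integration by parts in finite dimension -/

section FiniteDimensional

variable {E : Type*} [NormedAddCommGroup E] [InnerProductSpace ℝ E] [FiniteDimensional ℝ E]

/-- The trace, as a continuous linear functional on operators. -/
noncomputable def opTrace (E : Type*) [NormedAddCommGroup E] [InnerProductSpace ℝ E]
    [FiniteDimensional ℝ E] : (E →L[ℝ] E) →L[ℝ] ℝ :=
  LinearMap.toContinuousLinearMap
    ((LinearMap.trace ℝ E) ∘ₗ (ContinuousLinearMap.coeLM ℝ : (E →L[ℝ] E) →ₗ[ℝ] E →ₗ[ℝ] E))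

theorem opTrace_apply (T : E →L[ℝ] E) : opTrace E T = LinearMap.trace ℝ E (T : E →ₗ[ℝ] E) := rfl

theorem opTrace_eq_sum {ι : Type*} [Fintype ι] (b : OrthonormalBasis ι ℝ E) (T : E →L[ℝ] E) :
    opTrace E T = ∑ i, ⟪b i, T (b i)⟫_ℝ := by
  rw [opTrace_apply, LinearMap.trace_eq_sum_inner _ b]; rfl

theorem opTrace_smulRight (l : E →L[ℝ] ℝ) (v : E) : opTrace E (l.smulRight v) = l v := by
  rw [opTrace_eq_sum (stdOrthonormalBasis ℝ E)]
  conv_rhs => rw [← (stdOrthonormalBasis ℝ E).sum_repr v]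
  simp only [ContinuousLinearMap.smulRight_apply, inner_smul_right, map_sum, map_smul,
    smul_eq_mul, OrthonormalBasis.repr_apply_apply]
  exact Finset.sum_congr rfl fun i _ => mul_comm _ _

/-- The divergence of the vector field `h` with respect to a measure with density `exp (-W)`,
where `B = ∇ W`. -/
noncomputable def wdiv (B h : E → E) (x : E) : ℝ :=
  opTrace E (fderiv ℝ h x) - ⟪B x, h x⟫_ℝ

theorem wdiv_smul {B h : E → E} {a : E → ℝ} {x : E} (ha : DifferentiableAt ℝ a x)
    (hh : DifferentiableAt ℝ h x) :
    wdiv B (fun y => a y • h y) x = a x * wdiv B h x + fderiv ℝ a x (h x) := by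
  rw [wdiv, fderiv_fun_smul ha hh, map_add, map_smul, opTrace_smulRight, wdiv, inner_smul_right,
    smul_eq_mul]
  ring

/-- Divergence of `D h (h)`. -/
theorem opTrace_fderiv_fderiv_apply_self {h : E → E} (hh : ContDiff ℝ 2 h) (x : E) :
    opTrace E (fderiv ℝ (fun y => fderiv ℝ h y (h y)) x) =
      fderiv ℝ (fun y => opTrace E (fderiv ℝ h y)) x (h x)
        + opTrace E (fderiv ℝ h x ∘L fderiv ℝ h x) := by
  have hd : Differentiable ℝ h := hh.differentiable two_ne_zero
  have hdd : Differentiable ℝ (fderiv ℝ h) :=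
    (hh.fderiv_right (m := 1) (by norm_num)).differentiable one_ne_zero
  have h1 : fderiv ℝ (fun y => fderiv ℝ h y (h y)) x =
      fderiv ℝ h x ∘L fderiv ℝ h x + (fderiv ℝ (fderiv ℝ h) x).flip (h x) :=
    ((hdd x).hasFDerivAt.clm_apply (hd x).hasFDerivAt).fderiv
  -- Symmetry of D²h turns v ↦ D²h(v, h) into v ↦ D²h(h, v), whose trace is the derivative of tr Dh
  -- along h. This is where h must be C².
  have hsym : (fderiv ℝ (fderiv ℝ h) x).flip (h x) = fderiv ℝ (fderiv ℝ h) x (h x) := by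
    ext v
    exact (hh.contDiffAt.isSymmSndFDerivAt (by simp)).eq v (h x)
  have h2 : fderiv ℝ (fun y => opTrace E (fderiv ℝ h y)) x =
      (opTrace E) ∘L (fderiv ℝ (fderiv ℝ h) x) :=
    ((opTrace E).hasFDerivAt.comp x (hdd x).hasFDerivAt).fderiv
  rw [h1, h2, hsym, map_add, ContinuousLinearMap.comp_apply, add_comm]

variable [MeasurableSpace E] [BorelSpace E]

theorem integral_fderiv_sub_mul_exp_neg {W a : E → ℝ} (v : E) (hW : ContDiff ℝ 1 W)
    (ha : Differentiable ℝ a)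
    (h1 : Integrable fun x => a x * Real.exp (-W x))
    (h2 : Integrable fun x => fderiv ℝ a x v * Real.exp (-W x))
    (h3 : Integrable fun x => a x * fderiv ℝ W x v * Real.exp (-W x)) :
    ∫ x, (fderiv ℝ a x v - a x * fderiv ℝ W x v) * Real.exp (-W x) = 0 := by
  have hWd : Differentiable ℝ W := hW.differentiable one_ne_zero
  have hd : ∀ x, fderiv ℝ (fun x => Real.exp (-W x)) x v
      = -(fderiv ℝ W x v * Real.exp (-W x)) := by
    intro x
    have := ((hWd x).hasFDerivAt.neg).exp
    rw [show fderiv ℝ (fun x => Real.exp (-W x)) x = _ from this.fderiv]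
    simp [mul_comm]
  have key := integral_mul_fderiv_eq_neg_fderiv_mul_of_integrable (μ := (volume : Measure E))
    (f := a) (g := fun x => Real.exp (-W x)) (v := v) h2
    (by simp_rw [hd]; refine h3.neg.congr (Eventually.of_forall fun x => ?_); simp; ring)
    h1 (fun x _ => ha x) (fun x _ => (hWd x).neg.exp)
  simp_rw [hd] at key
  have e : ∀ x, (fderiv ℝ a x v - a x * fderiv ℝ W x v) * Real.exp (-W x)
    = fderiv ℝ a x v * Real.exp (-W x) + a x * -(fderiv ℝ W x v * Real.exp (-W x)) := by
    intro x; ring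
  simp_rw [e]
  rw [integral_add h2, key, add_neg_cancel]
  refine h3.neg.congr (Eventually.of_forall fun x => ?_); simp; ring

/-- Divergence theorem without boundary term: integrate by parts each component of F in an
orthonormal basis and add. Integrability hypotheses take the place of compact support, because the
estimate later uses the field φh, which need not vanish at infinity. -/
theorem integral_wdiv_eq_zero {W : E → ℝ} {F : E → E} (hW : ContDiff ℝ 1 W)
    (hF : ContDiff ℝ 1 F)
    (h1 : Integrable fun x => ‖F x‖ * Real.exp (-W x))
    (h2 : Integrable fun x => ‖fderiv ℝ F x‖ * Real.exp (-W x))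
    (h3 : Integrable fun x => ‖gradient W x‖ * ‖F x‖ * Real.exp (-W x)) :
    Integrable (fun x => wdiv (gradient W) F x * Real.exp (-W x)) ∧
    ∫ x, wdiv (gradient W) F x * Real.exp (-W x) = 0 := by
  set b := stdOrthonormalBasis ℝ E
  have hFd : Differentiable ℝ F := hF.differentiable one_ne_zero
  have hgW : ∀ x v, fderiv ℝ W x v = ⟪gradient W x, v⟫_ℝ := by
    intro x v; rw [inner_gradient_left]
  have hfd : ∀ i x v, fderiv ℝ (fun x => ⟪b i, F x⟫_ℝ) x v = ⟪b i, fderiv ℝ F x v⟫_ℝ := by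
    intro i x v
    have := ((innerSL ℝ (b i)).hasFDerivAt.comp x (hFd x).hasFDerivAt)
    exact congrArg (fun L => L v) this.fderiv
  have cF := hF.continuous
  have cdF := hF.continuous_fderiv one_ne_zero
  have cdW := hW.continuous_fderiv one_ne_zero
  have cW := hW.continuous
  have I1 : ∀ i, Integrable fun x => ⟪b i, F x⟫_ℝ * Real.exp (-W x) := by
    intro i
    refine h1.mono' (by fun_prop) (Eventually.of_forall fun x => ?_)
    rw [norm_mul, Real.norm_of_nonneg (Real.exp_pos _).le]
    gcongr
    exact (norm_inner_le_norm _ _).trans (by simp [b.norm_eq_one])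
  have I2 : ∀ i, Integrable fun x => fderiv ℝ (fun x => ⟪b i, F x⟫_ℝ) x (b i)
      * Real.exp (-W x) := by
    intro i
    simp_rw [hfd]
    refine h2.mono' (by fun_prop) (Eventually.of_forall fun x => ?_)
    rw [norm_mul, Real.norm_of_nonneg (Real.exp_pos _).le]
    gcongr
    refine (norm_inner_le_norm _ _).trans ?_
    have := (fderiv ℝ F x).le_opNorm (b i)
    simpa [b.norm_eq_one] using this
  have I3 : ∀ i, Integrable fun x => ⟪b i, F x⟫_ℝ * fderiv ℝ W x (b i) * Real.exp (-W x) := by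
    intro i
    refine h3.mono' (by fun_prop) (Eventually.of_forall fun x => ?_)
    rw [norm_mul, norm_mul, Real.norm_of_nonneg (Real.exp_pos _).le, mul_comm ‖gradient W x‖, hgW]
    gcongr
    · exact (norm_inner_le_norm _ _).trans (by simp [b.norm_eq_one])
    · exact (norm_inner_le_norm _ _).trans (by simp [b.norm_eq_one])
  have e : ∀ x, wdiv (gradient W) F x * Real.exp (-W x) =
      ∑ i, (fderiv ℝ (fun x => ⟪b i, F x⟫_ℝ) x (b i) - ⟪b i, F x⟫_ℝ * fderiv ℝ W x (b i))
        * Real.exp (-W x) := by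
    intro x
    rw [wdiv, opTrace_eq_sum b, ← Finset.sum_mul, Finset.sum_sub_distrib,
      ← OrthonormalBasis.sum_inner_mul_inner b (gradient W x)]
    congr 2
    · exact Finset.sum_congr rfl fun i _ => (hfd i x _).symm
    · exact Finset.sum_congr rfl fun i _ => by rw [hgW]; ring
  simp_rw [e]
  have I : ∀ i, Integrable fun x => (fderiv ℝ (fun x => ⟪b i, F x⟫_ℝ) x (b i)
      - ⟪b i, F x⟫_ℝ * fderiv ℝ W x (b i)) * Real.exp (-W x) := by
    intro i
    simp_rw [sub_mul]
    exact (I2 i).sub (I3 i)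
  refine ⟨integrable_finsetSum _ fun i _ => I i, ?_⟩
  rw [integral_finsetSum _ fun i _ => I i]
  refine Finset.sum_eq_zero fun i _ => ?_
  exact integral_fderiv_sub_mul_exp_neg (b i) hW
    (fun x => ((innerSL ℝ (b i)).differentiableAt.comp x (hFd x))) (I1 i) (I2 i) (I3 i)

theorem integral_wdiv_eq_zero_of_hasCompactSupport {W : E → ℝ} {F : E → E} (hW : ContDiff ℝ 1 W)
    (hF : ContDiff ℝ 1 F) (hc : HasCompactSupport F) :
    Integrable (fun x => wdiv (gradient W) F x * Real.exp (-W x)) ∧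
    ∫ x, wdiv (gradient W) F x * Real.exp (-W x) = 0 := by
  have cF := hF.continuous
  have cdF := hF.continuous_fderiv one_ne_zero
  have cdW := continuous_gradient hW
  have cW := hW.continuous
  refine integral_wdiv_eq_zero hW hF ?_ ?_ ?_
  · exact Continuous.integrable_of_hasCompactSupport (by fun_prop) (hc.norm.mul_right)
  · exact Continuous.integrable_of_hasCompactSupport (by fun_prop) ((hc.fderiv ℝ).norm.mul_right)
  · exact Continuous.integrable_of_hasCompactSupport (by fun_prop)
      ((hc.norm.mul_left).mul_right)

end FiniteDimensional

/-! ### Bochner inequality for C¹ potentials and compactly supported fields -/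

section Bochner

variable {E : Type*} [NormedAddCommGroup E] [InnerProductSpace ℝ E] [FiniteDimensional ℝ E]
  [MeasurableSpace E] [BorelSpace E]

/-- A continuous monotone-type vector field is approximated, uniformly on compact sets, by smooth
ones. -/
theorem exists_contDiff_approx_of_monotone {B : E → E} (hB : Continuous B) {A : E → ℝ}
    (hA : ∀ (t : ℝ) v, A (t • v) = t ^ 2 * A v)
    (hmono : ∀ x v, A v ≤ ⟪B (x + v) - B x, v⟫_ℝ) {K : Set E} (hK : IsCompact K) {ε : ℝ}
    (hε : 0 < ε) :
    ∃ β : E → E, ContDiff ℝ 1 β ∧ (∀ x ∈ K, ‖β x - B x‖ ≤ ε) ∧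
      ∀ x v, A v ≤ ⟪fderiv ℝ β x v, v⟫_ℝ := by
  -- Mollifying at a point of K samples B within distance r ≤ 1, so uniform continuity on the closed
  -- 1-thickening suffices.
  have hK1 : IsCompact (Metric.cthickening 1 K) := hK.cthickening
  obtain ⟨δ, hδ, hδB⟩ := Metric.uniformContinuousOn_iff.1
    (hK1.uniformContinuousOn_of_continuous hB.continuousOn) ε hε
  set r := min δ 1
  have hr : 0 < r := lt_min hδ one_pos
  let φ : ContDiffBump (0 : E) := ⟨r / 2, r, by positivity, by linarith⟩
  have hloc : LocallyIntegrable B (volume : Measure E) := hB.locallyIntegrable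
  set β : E → E := convolution (φ.normed volume) B (ContinuousLinearMap.lsmul ℝ ℝ) volume with hβ
  have hβc : ContDiff ℝ 1 β :=
    φ.hasCompactSupport_normed.contDiff_convolution_left _ φ.contDiff_normed hloc
  have hint : ∀ x, Integrable (fun t => φ.normed volume t • B (x - t)) := fun x =>
    Continuous.integrable_of_hasCompactSupport
      (φ.continuous_normed.smul (hB.comp (continuous_const.sub continuous_id)))
      φ.hasCompactSupport_normed.smul_right
  have hβx : ∀ x, β x = ∫ t, φ.normed volume t • B (x - t) := fun x => rfl
  -- The bound is translation invariant and linear in B, so it survives averaging against a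
  -- nonnegative kernel of mass one.
  have hm : ∀ x v, A v ≤ ⟪β (x + v) - β x, v⟫_ℝ := by
    intro x v
    have hi : Integrable (fun t => φ.normed volume t • B (x + v - t)
        - φ.normed volume t • B (x - t)) := (hint _).sub (hint _)
    rw [hβx, hβx, ← integral_sub (hint _) (hint _), real_inner_comm, ← integral_inner hi]
    have h1 : A v = ∫ t, φ.normed (volume : Measure E) t * A v := by
      rw [integral_mul_const, φ.integral_normed, one_mul]
    rw [h1]
    refine integral_mono (φ.integrable_normed.mul_const _)
      (hi.const_inner v) fun t => ?_
    change _ ≤ ⟪v, _ - _⟫_ℝ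
    rw [← smul_sub, inner_smul_right, real_inner_comm]
    refine mul_le_mul_of_nonneg_left ?_ (φ.nonneg_normed t)
    have := hmono (x - t) v
    rwa [show x - t + v = x + v - t by abel] at this
  refine ⟨β, hβc, fun x hx => ?_, fun x v => ?_⟩
  · rw [← dist_eq_norm]
    refine φ.dist_normed_convolution_le hB.aestronglyMeasurable fun y hy => (hδB _ ?_ _ ?_ ?_).le
    · exact Metric.mem_cthickening_of_dist_le y x 1 K hx
        ((Metric.mem_ball.1 hy).le.trans (min_le_right _ _))
    · exact Metric.self_subset_cthickening K hx
    · exact (Metric.mem_ball.1 hy).trans_le (min_le_left _ _)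
  · have hd : HasDerivAt (fun t : ℝ => ⟪β (x + t • v), v⟫_ℝ) ⟪fderiv ℝ β x v, v⟫_ℝ 0 := by
      have h0 : HasDerivAt (fun t : ℝ => β (x + t • v)) (fderiv ℝ β x v) 0 :=
        (hβc.differentiable one_ne_zero x).hasFDerivAt.hasLineDerivAt v
      simpa using h0.inner ℝ (hasDerivAt_const 0 v)
    have ht := hd.tendsto_slope_zero_right
    -- Apply the increment bound to tv: by homogeneity A(tv) = t²A(v), so one factor t cancels and
    -- the other makes the difference quotient.
    refine ge_of_tendsto ht ?_
    filter_upwards [self_mem_nhdsWithin] with t ht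
    have htp : 0 < t := ht
    have := hm x (t • v)
    rw [hA, inner_smul_right, inner_sub_left] at this
    simp only [zero_add, zero_smul, add_zero, smul_eq_mul]
    rw [inv_mul_eq_div, le_div_iff₀ htp]
    nlinarith

/-- The integrated Bochner inequality for compactly supported vector fields. -/
theorem integral_bochner_le_of_hasCompactSupport {W : E → ℝ} (hW : ContDiff ℝ 1 W) {A : E → ℝ}
    (hA : ∀ (t : ℝ) v, A (t • v) = t ^ 2 * A v) (hAc : Continuous A)
    (hmono : ∀ x v, A v ≤ ⟪gradient W (x + v) - gradient W x, v⟫_ℝ)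
    {h : E → E} (hh : ContDiff ℝ 2 h) (hc : HasCompactSupport h) :
    ∫ x, (opTrace E (fderiv ℝ h x ∘L fderiv ℝ h x) + A (h x)) * Real.exp (-W x) ≤
      ∫ x, wdiv (gradient W) h x ^ 2 * Real.exp (-W x) := by
  have hd : Differentiable ℝ h := hh.differentiable two_ne_zero
  have hh' : ContDiff ℝ 1 (fderiv ℝ h) := hh.fderiv_right (by norm_num)
  have ch := hh.continuous
  have cdh := hh'.continuous
  have cdW := continuous_gradient hW
  have cW := hW.continuous
  have cc : Continuous (fun x => fderiv ℝ h x ∘L fderiv ℝ h x) := cdh.clm_comp cdh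
  have cδ : Continuous (wdiv (gradient W) h) := by unfold wdiv; fun_prop
  have ctr : ContDiff ℝ 1 (fun x => opTrace E (fderiv ℝ h x)) := (opTrace E).contDiff.comp hh'
  have hA0 : A 0 = 0 := by simpa using hA 0 0
  have hz : ∀ x, x ∉ tsupport h → h x = 0 ∧ fderiv ℝ h x = 0 := fun x hx =>
    ⟨image_eq_zero_of_notMem_tsupport hx,
      image_eq_zero_of_notMem_tsupport (fun hx' => hx (tsupport_fderiv_subset ℝ hx'))⟩
  have hint : ∀ u : E → ℝ, Continuous u → (∀ x, h x = 0 ∧ fderiv ℝ h x = 0 → u x = 0) →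
      Integrable (fun x => u x * Real.exp (-W x)) := fun u hu hu0 =>
    Continuous.integrable_of_hasCompactSupport (by fun_prop)
      (HasCompactSupport.intro hc fun x hx => by rw [hu0 x (hz x hx), zero_mul])
  set k : E → E := fun x => fderiv ℝ h x (h x) with hk
  have kc : ContDiff ℝ 1 k := hh'.clm_apply (hh.of_le (by norm_num))
  have ck : Continuous k := kc.continuous
  have hkc : HasCompactSupport k := HasCompactSupport.intro hc fun x hx => by
    simp [hk, (hz x hx).1]
  -- The difference of the fields (tr Dh)h and Dh(h) has zero weighted integral of divergence. The
  -- second derivatives of h cancel, and ∇W is not differentiated.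
  have S1 : ∫ x, (opTrace E (fderiv ℝ h x) * wdiv (gradient W) h x
      - opTrace E (fderiv ℝ h x ∘L fderiv ℝ h x) + ⟪gradient W x, k x⟫_ℝ) * Real.exp (-W x)
        = 0 := by
    obtain ⟨i1, e1⟩ := integral_wdiv_eq_zero_of_hasCompactSupport hW
      (F := fun x => opTrace E (fderiv ℝ h x) • h x) (ctr.smul (hh.of_le (by norm_num)))
      hc.smul_left
    obtain ⟨i2, e2⟩ := integral_wdiv_eq_zero_of_hasCompactSupport hW kc hkc
    rw [← sub_self (0 : ℝ)]
    nth_rw 1 [← e1]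
    rw [← e2, ← integral_sub i1 i2]
    refine integral_congr_ae (Eventually.of_forall fun x => ?_)
    change _ = wdiv (gradient W) (fun x => opTrace E (fderiv ℝ h x) • h x) x * Real.exp (-W x)
      - wdiv (gradient W) k x * Real.exp (-W x)
    rw [wdiv_smul (ctr.differentiable one_ne_zero x) (hd x)]
    have : wdiv (gradient W) k x = opTrace E (fderiv ℝ k x) - ⟪gradient W x, k x⟫_ℝ := rfl
    rw [this, opTrace_fderiv_fderiv_apply_self hh]
    ring
  -- Divergence theorem for ⟨β, h⟩h. With β = ∇W the term ⟨Dβ h, h⟩ would be the Hessian term; here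
  -- a smooth β stands in for ∇W.
  have S2 : ∀ β : E → E, ContDiff ℝ 1 β → (∀ x v, A v ≤ ⟪fderiv ℝ β x v, v⟫_ℝ) →
      ∫ x, (A (h x) + ⟪β x, k x⟫_ℝ + ⟪β x, h x⟫_ℝ * wdiv (gradient W) h x) * Real.exp (-W x)
        ≤ 0 := by
    intro β hβ hβA
    have cβ := hβ.continuous
    have hβh : ContDiff ℝ 1 (fun x => ⟪β x, h x⟫_ℝ) := hβ.inner ℝ (hh.of_le (by norm_num))
    obtain ⟨i1, e1⟩ := integral_wdiv_eq_zero_of_hasCompactSupport hW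
      (F := fun x => ⟪β x, h x⟫_ℝ • h x) (hβh.smul (hh.of_le (by norm_num))) hc.smul_left
    rw [← e1]
    refine integral_mono (hint _ (by fun_prop) ?_) i1 fun x => ?_
    · rintro x ⟨h1, h2⟩
      simp [hk, h1, hA0]
    · refine mul_le_mul_of_nonneg_right ?_ (Real.exp_pos _).le
      rw [wdiv_smul (hβh.differentiable one_ne_zero x) (hd x),
        fderiv_inner_apply ℝ (hβ.differentiable one_ne_zero x) (hd x)]
      have := hβA x (h x)
      simp only [hk]
      linarith
  -- Replace β by ∇W. On the support of h they differ by at most ε, which costs at most ε times the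
  -- fixed integral M.
  have S3 : ∫ x, (A (h x) + ⟪gradient W x, k x⟫_ℝ
      + ⟪gradient W x, h x⟫_ℝ * wdiv (gradient W) h x) * Real.exp (-W x) ≤ 0 := by
    have iM := hint (fun x => ‖k x‖ + ‖h x‖ * |wdiv (gradient W) h x|) (by fun_prop)
      (by rintro x ⟨h1, h2⟩; simp [hk, h1])
    set M := ∫ x, (‖k x‖ + ‖h x‖ * |wdiv (gradient W) h x|) * Real.exp (-W x)
    have hb : ∀ ε > 0, ∫ x, (A (h x) + ⟪gradient W x, k x⟫_ℝ
      + ⟪gradient W x, h x⟫_ℝ * wdiv (gradient W) h x) * Real.exp (-W x) ≤ ε * M := by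
      intro ε hε
      obtain ⟨β, hβ, hβK, hβA⟩ := exists_contDiff_approx_of_monotone cdW hA hmono hc hε
      have cβ := hβ.continuous
      have i1 := hint (fun x => A (h x) + ⟪β x, k x⟫_ℝ + ⟪β x, h x⟫_ℝ * wdiv (gradient W) h x)
        (by fun_prop) (by rintro x ⟨h1, h2⟩; simp [hk, h1, hA0])
      refine le_trans ?_ (add_le_of_nonpos_left (S2 β hβ hβA))
      rw [← integral_const_mul, ← integral_add i1 (iM.const_mul ε)]
      refine integral_mono (hint _ (by fun_prop) ?_) (i1.add (iM.const_mul ε)) fun x => ?_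
      · rintro x ⟨h1, h2⟩
        simp [hk, h1, hA0]
      · change _ ≤ _ * _ + ε * (_ * _)
        rw [← mul_assoc, ← add_mul]
        refine mul_le_mul_of_nonneg_right ?_ (Real.exp_pos _).le
        by_cases hx : x ∈ tsupport h
        · have hn : ‖gradient W x - β x‖ ≤ ε := by rw [norm_sub_rev]; exact hβK x hx
          have a1 : ⟪gradient W x - β x, k x⟫_ℝ ≤ ε * ‖k x‖ :=
            (real_inner_le_norm _ _).trans (by gcongr)
          have a2 : ⟪gradient W x - β x, h x⟫_ℝ * wdiv (gradient W) h x
              ≤ ε * ‖h x‖ * |wdiv (gradient W) h x| := by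
            refine (le_abs_self _).trans ?_
            rw [abs_mul]
            gcongr
            exact (abs_real_inner_le_norm _ _).trans (by gcongr)
          rw [inner_sub_left] at a1 a2
          linarith
        · simp [hk, (hz x hx).1]
    refine le_of_forall_pos_le_add fun ε hε => ?_
    have hM : 0 ≤ M := integral_nonneg fun x => by positivity
    refine (hb (ε / (M + 1)) (by positivity)).trans ?_
    rw [zero_add, div_mul_eq_mul_div, div_le_iff₀ (by positivity)]
    nlinarith
  have i1 := hint (fun x => opTrace E (fderiv ℝ h x ∘L fderiv ℝ h x) + A (h x)) (by fun_prop)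
    (by rintro x ⟨h1, h2⟩; simp [h1, h2, hA0])
  have i2 := hint (fun x => wdiv (gradient W) h x ^ 2) (by fun_prop)
    (by rintro x ⟨h1, h2⟩; simp [h1, h2, wdiv])
  have i3 := hint (fun x => opTrace E (fderiv ℝ h x) * wdiv (gradient W) h x
      - opTrace E (fderiv ℝ h x ∘L fderiv ℝ h x) + ⟪gradient W x, k x⟫_ℝ) (by fun_prop)
    (by rintro x ⟨h1, h2⟩; simp [h1, h2, hk])
  have i4 := hint (fun x => A (h x) + ⟪gradient W x, k x⟫_ℝ
      + ⟪gradient W x, h x⟫_ℝ * wdiv (gradient W) h x) (by fun_prop)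
    (by rintro x ⟨h1, h2⟩; simp [h1, hk, hA0])
  -- Subtracting S3 from S1 cancels ⟨∇W, Dh(h)⟩, and (tr Dh)δh - ⟨∇W, h⟩δh = (δh)².
  have := integral_sub i3 i4
  have e2 : ∫ x, (wdiv (gradient W) h x ^ 2 * Real.exp (-W x) -
      (opTrace E (fderiv ℝ h x ∘L fderiv ℝ h x) + A (h x)) * Real.exp (-W x)) = _ :=
    (integral_congr_ae (Eventually.of_forall fun x => by simp only [wdiv]; ring)).trans this
  rw [integral_sub i2 i1] at e2
  linarith

end Bochner

/-! ### Removing compact support; the resolvent estimate in finite dimension -/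

section Cutoff

variable {E : Type*} [NormedAddCommGroup E] [InnerProductSpace ℝ E] [FiniteDimensional ℝ E]

/-- Dilations of a single bump by factors at least one: the gradients stay uniformly bounded, which
suffices for domination, and near any given point the cutoff is eventually identically one. -/
theorem exists_cutoff_seq : ∃ (χ : ℕ → E → ℝ) (M : ℝ), ∀ n, ContDiff ℝ 2 (χ n) ∧
    HasCompactSupport (χ n) ∧ (∀ x, |χ n x| ≤ 1) ∧ (∀ x, ‖fderiv ℝ (χ n) x‖ ≤ M) ∧
    ∀ x ∈ Metric.ball (0 : E) (n + 1), χ n x = 1 := by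
  let f : ContDiffBump (0 : E) := ⟨1, 2, one_pos, one_lt_two⟩
  have hf : ContDiff ℝ 2 f := f.contDiff
  obtain ⟨M, hM⟩ := (f.hasCompactSupport.fderiv ℝ).exists_bound_of_continuous
    (hf.continuous_fderiv two_ne_zero)
  have hM0 : 0 ≤ M := (norm_nonneg _).trans (hM 0)
  refine ⟨fun n x => f (((n : ℝ) + 1)⁻¹ • x), M, fun n => ?_⟩
  have hn : (0 : ℝ) < n + 1 := by positivity
  refine ⟨hf.comp (contDiff_const_smul _), ?_, fun x => ?_, fun x => ?_, fun x hx => ?_⟩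
  · exact f.hasCompactSupport.comp_homeomorph (Homeomorph.smulOfNeZero _ (inv_ne_zero hn.ne'))
  · rw [abs_of_nonneg f.nonneg]; exact f.le_one
  · have h1 := ((hf.differentiable two_ne_zero _).hasFDerivAt.comp x
      ((hasFDerivAt_id x).const_smul ((n : ℝ) + 1)⁻¹))
    rw [show fderiv ℝ (fun x => f (((n : ℝ) + 1)⁻¹ • x)) x = _ from h1.fderiv]
    refine (ContinuousLinearMap.opNorm_comp_le _ _).trans ?_
    have h2 : ‖((n : ℝ) + 1)⁻¹ • ContinuousLinearMap.id ℝ E‖ ≤ 1 := by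
      rw [norm_smul, Real.norm_of_nonneg (by positivity)]
      exact mul_le_one₀ (inv_le_one_of_one_le₀ (by linarith [n.cast_nonneg (α := ℝ)]))
        (norm_nonneg _) ContinuousLinearMap.norm_id_le
    calc _ ≤ M * 1 := mul_le_mul (hM _) h2 (norm_nonneg _) hM0
      _ = M := mul_one M
  · refine f.one_of_mem_closedBall ?_
    rw [mem_closedBall_zero_iff, norm_smul, Real.norm_of_nonneg (by positivity)]
    rw [mem_ball_zero_iff] at hx
    change _ ≤ (1 : ℝ)
    rw [inv_mul_le_iff₀ hn]
    linarith

theorem abs_wdiv_le (B h : E → E) (x : E) :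
    |wdiv B h x| ≤ ‖opTrace E‖ * ‖fderiv ℝ h x‖ + ‖B x‖ * ‖h x‖ :=
  (abs_sub _ _).trans (add_le_add ((opTrace E).le_opNorm _) (abs_real_inner_le_norm _ _))

variable [MeasurableSpace E] [BorelSpace E]

/-- The integrated Bochner inequality for bounded vector fields with bounded derivative. -/
theorem integral_bochner_le {W : E → ℝ} (hW : ContDiff ℝ 1 W)
    (hW0 : Integrable fun x => Real.exp (-W x))
    (hW1 : Integrable fun x => ‖gradient W x‖ ^ 2 * Real.exp (-W x)) {A : E → ℝ}
    (hA : ∀ (t : ℝ) v, A (t • v) = t ^ 2 * A v) (hAc : Continuous A)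
    (hmono : ∀ x v, A v ≤ ⟪gradient W (x + v) - gradient W x, v⟫_ℝ)
    {h : E → E} (hh : ContDiff ℝ 2 h) {M : ℝ} (hM : ∀ x, ‖h x‖ ≤ M)
    (hM' : ∀ x, ‖fderiv ℝ h x‖ ≤ M) :
    ∫ x, (opTrace E (fderiv ℝ h x ∘L fderiv ℝ h x) + A (h x)) * Real.exp (-W x) ≤
      ∫ x, wdiv (gradient W) h x ^ 2 * Real.exp (-W x) := by
  obtain ⟨χ, M₁, hχ⟩ := exists_cutoff_seq (E := E)
  have hM0 : 0 ≤ M := (norm_nonneg _).trans (hM 0)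
  have hM1 : 0 ≤ M₁ := (norm_nonneg _).trans ((hχ 0).2.2.2.1 0)
  have hd : Differentiable ℝ h := hh.differentiable two_ne_zero
  set H : ℕ → E → E := fun n x => χ n x • h x with hH
  have hHc : ∀ n, ContDiff ℝ 2 (H n) := fun n => (hχ n).1.smul hh
  have hHM : ∀ n x, ‖H n x‖ ≤ M := fun n x => by
    rw [hH, norm_smul]
    calc _ ≤ 1 * M := mul_le_mul ((hχ n).2.2.1 x) (hM x) (norm_nonneg _) zero_le_one
      _ = M := one_mul M
  have hHM' : ∀ n x, ‖fderiv ℝ (H n) x‖ ≤ M + M₁ * M := fun n x => by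
    rw [hH, fderiv_fun_smul ((hχ n).1.differentiable two_ne_zero x) (hd x)]
    refine (norm_add_le _ _).trans (add_le_add ?_ ?_)
    · rw [norm_smul]
      calc _ ≤ 1 * M := mul_le_mul ((hχ n).2.2.1 x) (hM' x) (norm_nonneg _) zero_le_one
        _ = M := one_mul M
    · rw [ContinuousLinearMap.norm_smulRight_apply]
      exact mul_le_mul ((hχ n).2.2.2.1 x) (hM x) (norm_nonneg _) hM1
  -- Pointwise the sequences are eventually constant, so dominated convergence needs only the
  -- uniform bounds on `H n` and its derivative.
  have hev : ∀ x, ∀ᶠ n in atTop, H n x = h x ∧ fderiv ℝ (H n) x = fderiv ℝ h x := by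
    intro x
    obtain ⟨n₀, hn₀⟩ := exists_nat_gt ‖x‖
    filter_upwards [eventually_ge_atTop n₀] with n hn
    have hx : x ∈ Metric.ball (0 : E) (n + 1) := by
      rw [mem_ball_zero_iff]
      have : (n₀ : ℝ) ≤ n := by exact_mod_cast hn
      linarith
    have he : H n =ᶠ[𝓝 x] h := by
      filter_upwards [Metric.isOpen_ball.mem_nhds hx] with y hy
      simp [hH, (hχ n).2.2.2.2 y hy]
    exact ⟨he.eq_of_nhds, he.fderiv_eq⟩
  have cdW := continuous_gradient hW
  have cW := hW.continuous
  obtain ⟨a, ha⟩ := (isCompact_closedBall (0 : E) M).exists_bound_of_continuousOn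
    hAc.continuousOn
  set M₂ := M + M₁ * M
  have lim1 := tendsto_integral_of_dominated_convergence (μ := (volume : Measure E))
    (F := fun n x => (opTrace E (fderiv ℝ (H n) x ∘L fderiv ℝ (H n) x) + A (H n x))
      * Real.exp (-W x))
    (f := fun x => (opTrace E (fderiv ℝ h x ∘L fderiv ℝ h x) + A (h x)) * Real.exp (-W x))
    (fun x => (‖opTrace E‖ * (M₂ * M₂) + a) * Real.exp (-W x))
    (fun n => by
      have c1 := (hHc n).continuous
      have c2 := (hHc n).continuous_fderiv two_ne_zero
      have c3 := c2.clm_comp c2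
      fun_prop)
    (hW0.const_mul _)
    (fun n => Eventually.of_forall fun x => by
      rw [norm_mul, Real.norm_of_nonneg (Real.exp_pos _).le]
      gcongr
      refine (norm_add_le _ _).trans (add_le_add ?_ (ha _ (by simpa using hHM n x)))
      refine ((opTrace E).le_opNorm _).trans ?_
      gcongr
      refine (ContinuousLinearMap.opNorm_comp_le _ _).trans ?_
      exact mul_le_mul (hHM' n x) (hHM' n x) (norm_nonneg _) (by positivity))
    (Eventually.of_forall fun x => tendsto_const_nhds.congr' <| by
      filter_upwards [hev x] with n hn
      rw [hn.1, hn.2])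
  have lim2 := tendsto_integral_of_dominated_convergence (μ := (volume : Measure E))
    (F := fun n x => wdiv (gradient W) (H n) x ^ 2 * Real.exp (-W x))
    (f := fun x => wdiv (gradient W) h x ^ 2 * Real.exp (-W x))
    (fun x => 2 * (‖opTrace E‖ * M₂) ^ 2 * Real.exp (-W x)
      + 2 * M ^ 2 * (‖gradient W x‖ ^ 2 * Real.exp (-W x)))
    (fun n => by
      have c1 := (hHc n).continuous
      have c2 := (hHc n).continuous_fderiv two_ne_zero
      unfold wdiv
      fun_prop)
    ((hW0.const_mul _).add (hW1.const_mul _))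
    (fun n => Eventually.of_forall fun x => by
      rw [norm_mul, Real.norm_of_nonneg (Real.exp_pos _).le, ← mul_assoc, ← add_mul]
      gcongr
      rw [Real.norm_of_nonneg (sq_nonneg _), ← sq_abs]
      have h1 : |wdiv (gradient W) (H n) x| ≤ ‖opTrace E‖ * M₂ + ‖gradient W x‖ * M := by
        refine (abs_wdiv_le _ _ _).trans ?_
        gcongr
        · exact hHM' n x
        · exact hHM n x
      refine (pow_le_pow_left₀ (abs_nonneg _) h1 2).trans ?_
      nlinarith [sq_nonneg (‖opTrace E‖ * M₂ - ‖gradient W x‖ * M)])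
    (Eventually.of_forall fun x => tendsto_const_nhds.congr' <| by
      filter_upwards [hev x] with n hn
      rw [wdiv, wdiv, hn.1, hn.2])
  exact le_of_tendsto_of_tendsto' lim1 lim2 fun n =>
    integral_bochner_le_of_hasCompactSupport hW hA hAc hmono (hHc n) (hχ n).2.1.smul_right

/-- The resolvent estimate on a finite dimensional space. -/
theorem integral_resolvent_le {W : E → ℝ} (hW : ContDiff ℝ 1 W)
    (hW0 : Integrable fun x => Real.exp (-W x))
    (hW1 : Integrable fun x => ‖gradient W x‖ ^ 2 * Real.exp (-W x)) {S q : E → ℝ} {c : ℝ}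
    (hc : 0 ≤ c) (hS : ∀ (t : ℝ) v, S (t • v) = t ^ 2 * S v) (hSc : Continuous S)
    (hq : ∀ (t : ℝ) v, q (t • v) = t ^ 2 * q v) (hqc : Continuous q) (hq0 : ∀ v, 0 ≤ q v)
    (hmono : ∀ x v, S v - c * q v ≤ ⟪gradient W (x + v) - gradient W x, v⟫_ℝ)
    {φ : E → ℝ} (hφ : ContDiff ℝ 1 φ) {h : E → E} (hh : ContDiff ℝ 2 h)
    (hqh : ∀ x, q (h x) = ⟪gradient φ x, h x⟫_ℝ) {M : ℝ} (hφM : ∀ x, |φ x| ≤ M)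
    (hφM' : ∀ x, ‖fderiv ℝ φ x‖ ≤ M) (hM : ∀ x, ‖h x‖ ≤ M)
    (hM' : ∀ x, ‖fderiv ℝ h x‖ ≤ M) :
    ∫ x, (opTrace E (fderiv ℝ h x ∘L fderiv ℝ h x) + S (h x)) * Real.exp (-W x) ≤
      (1 + c / 4) * ∫ x, (φ x - wdiv (gradient W) h x) ^ 2 * Real.exp (-W x) := by
  have hM0 : 0 ≤ M := (norm_nonneg _).trans (hM 0)
  have hd : Differentiable ℝ h := hh.differentiable two_ne_zero
  have hφd : Differentiable ℝ φ := hφ.differentiable one_ne_zero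
  have ch := hh.continuous
  have cdh := hh.continuous_fderiv two_ne_zero
  have cc := cdh.clm_comp cdh
  have cφ := hφ.continuous
  have cdφ := hφ.continuous_fderiv one_ne_zero
  have cgφ := continuous_gradient hφ
  have cdW := continuous_gradient hW
  have cW := hW.continuous
  have cδ : Continuous (wdiv (gradient W) h) := by unfold wdiv; fun_prop
  have bdd : ∀ (u : E → ℝ) (K : ℝ), Continuous u → (∀ x, |u x| ≤ K) →
      Integrable fun x => u x * Real.exp (-W x) := fun u K hu hK =>
    hW0.bdd_mul hu.aestronglyMeasurable (Eventually.of_forall hK)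
  have lin : Integrable fun x => ‖gradient W x‖ * Real.exp (-W x) := by
    refine ((hW0.add hW1)).mono' (by fun_prop) (Eventually.of_forall fun x => ?_)
    simp only [norm_mul, norm_norm, Real.norm_of_nonneg (Real.exp_pos _).le, Pi.add_apply]
    nlinarith [Real.exp_pos (-W x), sq_nonneg (‖gradient W x‖ - 1),
      mul_nonneg (sq_nonneg (‖gradient W x‖ - 1)) (Real.exp_pos (-W x)).le,
      mul_nonneg (norm_nonneg (gradient W x)) (Real.exp_pos (-W x)).le]
  set δ := wdiv (gradient W) h with hδ
  have hδle : ∀ x, |δ x| ≤ ‖opTrace E‖ * M + ‖gradient W x‖ * M := fun x => by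
    refine (abs_wdiv_le _ _ _).trans ?_
    gcongr
    · exact hM' x
    · exact hM x
  have iδ2 : Integrable fun x => δ x ^ 2 * Real.exp (-W x) := by
    refine ((hW0.const_mul (2 * (‖opTrace E‖ * M) ^ 2)).add (hW1.const_mul (2 * M ^ 2))).mono'
      (by fun_prop) (Eventually.of_forall fun x => ?_)
    simp only [Pi.add_apply]
    rw [norm_mul, Real.norm_of_nonneg (Real.exp_pos _).le, ← mul_assoc, ← add_mul]
    gcongr
    rw [Real.norm_of_nonneg (sq_nonneg _), ← sq_abs]
    refine (pow_le_pow_left₀ (abs_nonneg _) (hδle x) 2).trans ?_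
    nlinarith [sq_nonneg (‖opTrace E‖ * M - ‖gradient W x‖ * M)]
  have iφδ : Integrable fun x => φ x * δ x * Real.exp (-W x) := by
    refine ((hW0.const_mul (M * (‖opTrace E‖ * M))).add (lin.const_mul (M * M))).mono'
      (by fun_prop) (Eventually.of_forall fun x => ?_)
    simp only [Pi.add_apply]
    rw [norm_mul, Real.norm_of_nonneg (Real.exp_pos _).le, ← mul_assoc (M * M), ← add_mul,
      norm_mul]
    gcongr
    exact (mul_le_mul (hφM x) (hδle x) (abs_nonneg _) hM0).trans (le_of_eq (by ring))
  have iφ2 : Integrable fun x => φ x ^ 2 * Real.exp (-W x) :=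
    bdd _ (M ^ 2) (by fun_prop) fun x => by
      rw [abs_pow]; exact pow_le_pow_left₀ (abs_nonneg _) (hφM x) 2
  have iq : Integrable fun x => q (h x) * Real.exp (-W x) := by
    refine bdd _ (M * M) (by fun_prop) fun x => ?_
    rw [hqh]
    refine (abs_real_inner_le_norm _ _).trans (mul_le_mul ?_ (hM x) (norm_nonneg _) hM0)
    rw [← (InnerProductSpace.toDual ℝ E).norm_map, toDual_gradient]
    exact hφM' x
  have iS : Integrable fun x =>
      (opTrace E (fderiv ℝ h x ∘L fderiv ℝ h x) + (S (h x) - c * q (h x)))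
        * Real.exp (-W x) := by
    obtain ⟨a, ha⟩ := (isCompact_closedBall (0 : E) M).exists_bound_of_continuousOn
      (hSc.sub (hqc.const_mul c) : Continuous fun v => S v - c * q v).continuousOn
    refine bdd _ (‖opTrace E‖ * (M * M) + a) (by fun_prop) fun x => ?_
    refine (norm_add_le _ _).trans (add_le_add ?_ (ha _ (by simpa using hM x)))
    refine ((opTrace E).le_opNorm _).trans ?_
    gcongr
    refine (ContinuousLinearMap.opNorm_comp_le _ _).trans ?_
    exact mul_le_mul (hM' x) (hM' x) (norm_nonneg _) hM0
  -- S is the favourable part of the Hessian bound, and -c q the defect allowed by semiconvexity.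
  have B := integral_bochner_le hW hW0 hW1 (A := fun v => S v - c * q v)
    (fun t v => by simp only [hS, hq]; ring) (by fun_prop) hmono hh hM hM'
  have hF : ∀ x, wdiv (gradient W) (fun y => φ y • h y) x * Real.exp (-W x)
      = φ x * δ x * Real.exp (-W x) + q (h x) * Real.exp (-W x) := fun x => by
    rw [wdiv_smul (hφd x) (hd x), hqh, inner_gradient_left]; ring
  -- Integration by parts for the generator: ∫ φ δh = -∫ ⟨∇φ, h⟩ = -∫ q(h).
  have Z := (integral_wdiv_eq_zero hW (F := fun y => φ y • h y)
    (hφ.smul (hh.of_le (by norm_num)))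
    (bdd _ (M * M) (by fun_prop) fun x => by
      rw [abs_norm, norm_smul]
      exact mul_le_mul (hφM x) (hM x) (norm_nonneg _) hM0)
    (bdd _ (M * M + M * M) ((hφ.smul (hh.of_le (by norm_num))).continuous_fderiv one_ne_zero).norm
      fun x => by
        rw [abs_norm, fderiv_fun_smul (hφd x) (hd x)]
        refine (norm_add_le _ _).trans (add_le_add ?_ ?_)
        · rw [norm_smul]
          exact mul_le_mul (hφM x) (hM' x) (norm_nonneg _) hM0
        · rw [ContinuousLinearMap.norm_smulRight_apply]
          exact mul_le_mul (hφM' x) (hM x) (norm_nonneg _) hM0)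
    (by
      refine (lin.const_mul (M * M)).mono' (by fun_prop) (Eventually.of_forall fun x => ?_)
      rw [norm_mul, norm_mul, norm_norm, norm_norm, Real.norm_of_nonneg (Real.exp_pos _).le,
        norm_smul, mul_comm ‖gradient W x‖, mul_assoc]
      gcongr
      · exact hφM x
      · exact hM x)).2
  simp_rw [hF] at Z
  rw [integral_add iφδ iq] at Z
  have e1 : ∫ x, (φ x - δ x) ^ 2 * Real.exp (-W x) = (∫ x, φ x ^ 2 * Real.exp (-W x))
      - 2 * (∫ x, φ x * δ x * Real.exp (-W x)) + ∫ x, δ x ^ 2 * Real.exp (-W x) := by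
    rw [← integral_const_mul, ← integral_sub iφ2 (iφδ.const_mul 2), ← integral_add ?_ iδ2]
    · exact integral_congr_ae (Eventually.of_forall fun x => by simp only []; ring)
    · exact iφ2.sub (iφδ.const_mul 2)
  have e2 : ∫ x, (opTrace E (fderiv ℝ h x ∘L fderiv ℝ h x) + S (h x)) * Real.exp (-W x) =
      (∫ x, (opTrace E (fderiv ℝ h x ∘L fderiv ℝ h x) + (S (h x) - c * q (h x)))
        * Real.exp (-W x)) + c * ∫ x, q (h x) * Real.exp (-W x) := by
    rw [← integral_const_mul, ← integral_add iS (iq.const_mul c)]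
    exact integral_congr_ae (Eventually.of_forall fun x => by simp only []; ring)
  -- The source of c/4: the integral of (φ - δ)² exceeds that of (φ + δ)² by -4∫ φδ = 4∫ q(h), hence
  -- 4∫ q(h) ≤ ∫ (φ - δ)².
  have e3 : 0 ≤ ∫ x, (φ x + δ x) ^ 2 * Real.exp (-W x) := integral_nonneg fun x => by positivity
  have e4 : ∫ x, (φ x + δ x) ^ 2 * Real.exp (-W x) = (∫ x, φ x ^ 2 * Real.exp (-W x))
      + 2 * (∫ x, φ x * δ x * Real.exp (-W x)) + ∫ x, δ x ^ 2 * Real.exp (-W x) := by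
    rw [← integral_const_mul, ← integral_add iφ2 (iφδ.const_mul 2), ← integral_add ?_ iδ2]
    · exact integral_congr_ae (Eventually.of_forall fun x => by simp only []; ring)
    · exact iφ2.add (iφδ.const_mul 2)
  have hQ : 0 ≤ ∫ x, q (h x) * Real.exp (-W x) :=
    integral_nonneg fun x => mul_nonneg (hq0 _) (Real.exp_pos _).le
  have hP : 0 ≤ ∫ x, φ x ^ 2 * Real.exp (-W x) := integral_nonneg fun x => by positivity
  rw [e2, e1]
  have h4 : c * ∫ x, q (h x) * Real.exp (-W x) ≤ c * (((∫ x, φ x ^ 2 * Real.exp (-W x))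
      - 2 * (∫ x, φ x * δ x * Real.exp (-W x)) + ∫ x, δ x ^ 2 * Real.exp (-W x)) / 4) :=
    mul_le_mul_of_nonneg_left (by linarith) hc
  linarith

end Cutoff

/-! ### Finite coordinates, embeddings and fibres of a Hilbert space -/

section Coordinates

variable {U : Type*} [NormedAddCommGroup U] [InnerProductSpace ℝ U]

/-- Separability is implicit in the countable basis. It is needed for measurability on products and
for uniqueness of measures with a given characteristic function. -/
theorem HilbertBasis.secondCountableTopology (d : HilbertBasis ℕ ℝ U) :
    SecondCountableTopology U := by
  have h1 : TopologicalSpace.IsSeparable (Set.range d) := (Set.countable_range d).isSeparable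
  have h2 := (h1.span (R := ℝ)).closure
  have h3 : closure (Submodule.span ℝ (Set.range d) : Set U) = Set.univ := by
    have := d.dense_span
    rw [← Submodule.topologicalClosure_coe, this]; rfl
  rw [h3] at h2
  have := TopologicalSpace.isSeparable_univ_iff.1 h2
  exact UniformSpace.secondCountable_of_separable U

/-- The coordinate map as a continuous linear map. -/
noncomputable def coordL (d : HilbertBasis ℕ ℝ U) (N : ℕ) : U →L[ℝ] EuclideanSpace ℝ (Fin N) :=
  (EuclideanSpace.equiv (Fin N) ℝ).symm.toContinuousLinearMap.comp
    (ContinuousLinearMap.pi fun i : Fin N => innerSL ℝ (d i))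

theorem coordL_apply (d : HilbertBasis ℕ ℝ U) (N : ℕ) (u : U) (i : Fin N) :
    coordL d N u i = ⟪d i, u⟫_ℝ := by
  simp [coordL]

theorem coordMap_eq_coordL (d : HilbertBasis ℕ ℝ U) (N : ℕ) (u : U) :
    coordMap d N u = coordL d N u := by
  ext i
  simp [coordMap, coordL_apply, real_inner_comm]

/-- The embedding `x ↦ ∑ i, x i • d i`. -/
noncomputable def embedL (d : HilbertBasis ℕ ℝ U) (N : ℕ) : EuclideanSpace ℝ (Fin N) →L[ℝ] U :=
  ∑ i : Fin N, (EuclideanSpace.proj i : EuclideanSpace ℝ (Fin N) →L[ℝ] ℝ).smulRight (d i)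

theorem embedL_apply (d : HilbertBasis ℕ ℝ U) (N : ℕ) (x : EuclideanSpace ℝ (Fin N)) :
    embedL d N x = ∑ i, x i • d i := by
  simp [embedL]

theorem inner_basis_embedL (d : HilbertBasis ℕ ℝ U) (N : ℕ) (x : EuclideanSpace ℝ (Fin N))
    (k : ℕ) : ⟪d k, embedL d N x⟫_ℝ = if h : k < N then x ⟨k, h⟩ else 0 := by
  have hd : ∀ i : Fin N, ⟪d k, d i⟫_ℝ = if k = i then 1 else 0 := fun i =>
    orthonormal_iff_ite.1 d.orthonormal k i
  rw [embedL_apply, inner_sum]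
  simp_rw [inner_smul_right, hd]
  split_ifs with h
  · rw [Finset.sum_eq_single ⟨k, h⟩]
    · simp
    · intro i _ hi
      rw [if_neg, mul_zero]
      rintro rfl
      exact hi rfl
    · simp
  · refine Finset.sum_eq_zero fun i _ => ?_
    rw [if_neg, mul_zero]
    rintro rfl
    exact h i.2

theorem coordL_embedL (d : HilbertBasis ℕ ℝ U) (N : ℕ) (x : EuclideanSpace ℝ (Fin N)) :
    coordL d N (embedL d N x) = x := by
  ext i
  rw [coordL_apply, inner_basis_embedL, dif_pos i.2]

theorem inner_embedL (d : HilbertBasis ℕ ℝ U) (N : ℕ) (x : EuclideanSpace ℝ (Fin N)) (u : U) :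
    ⟪embedL d N x, u⟫_ℝ = ⟪x, coordL d N u⟫_ℝ := by
  rw [embedL_apply, sum_inner, PiLp.inner_apply]
  refine Finset.sum_congr rfl fun i _ => ?_
  rw [inner_smul_left, coordL_apply]
  simp [mul_comm]

theorem inner_coordL (d : HilbertBasis ℕ ℝ U) (N : ℕ) (u : U) (x : EuclideanSpace ℝ (Fin N)) :
    ⟪coordL d N u, x⟫_ℝ = ⟪u, embedL d N x⟫_ℝ := by
  rw [real_inner_comm, ← inner_embedL, real_inner_comm]

theorem embedL_coordL_of_mem (d : HilbertBasis ℕ ℝ U) {N : ℕ} {u : U} (hu : u ∈ finSpan d N) :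
    embedL d N (coordL d N u) = u := by
  refine (d.repr.injective (lp.ext (funext fun k => ?_)))
  rw [d.repr_apply_apply, inner_basis_embedL]
  split_ifs with h
  · rw [coordL_apply, d.repr_apply_apply]
  · exact (repr_eq_zero_of_mem_finSpan d N hu (not_lt.1 h)).symm

theorem embedL_mem_finSpan (d : HilbertBasis ℕ ℝ U) (N : ℕ) (x : EuclideanSpace ℝ (Fin N)) :
    embedL d N x ∈ finSpan d N := by
  rw [embedL_apply]
  exact Submodule.sum_mem _ fun i _ => Submodule.smul_mem _ _ (Submodule.subset_span ⟨i, rfl⟩)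

/-- The point with first coordinates `x` whose remaining coordinates are those of `y`. -/
noncomputable def fiberPt (d : HilbertBasis ℕ ℝ U) (N : ℕ) (x : EuclideanSpace ℝ (Fin N))
    (y : U) : U :=
  embedL d N x + (y - embedL d N (coordL d N y))

theorem coordL_fiberPt (d : HilbertBasis ℕ ℝ U) (N : ℕ) (x : EuclideanSpace ℝ (Fin N)) (y : U) :
    coordL d N (fiberPt d N x y) = x := by
  simp [fiberPt, coordL_embedL]

theorem fiberPt_add (d : HilbertBasis ℕ ℝ U) (N : ℕ) (x v : EuclideanSpace ℝ (Fin N)) (y : U) :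
    fiberPt d N (x + v) y = fiberPt d N x y + embedL d N v := by
  simp only [fiberPt, map_add]; abel

theorem continuous_fiberPt (d : HilbertBasis ℕ ℝ U) (N : ℕ) :
    Continuous fun z : EuclideanSpace ℝ (Fin N) × U => fiberPt d N z.1 z.2 := by
  unfold fiberPt; fun_prop

theorem hasFDerivAt_fiberPt (d : HilbertBasis ℕ ℝ U) (N : ℕ) (x : EuclideanSpace ℝ (Fin N))
    (y : U) : HasFDerivAt (fun x => fiberPt d N x y) (embedL d N) x :=
  (embedL d N).hasFDerivAt.add_const _

theorem contDiff_fiberPt (d : HilbertBasis ℕ ℝ U) (N : ℕ) (y : U) {n : WithTop ℕ∞} :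
    ContDiff ℝ n (fun x => fiberPt d N x y) :=
  (embedL d N).contDiff.add contDiff_const

theorem IsCovarianceOp.inner_basis {Q : U →L[ℝ] U} {d : HilbertBasis ℕ ℝ U} {lam : ℕ → ℝ}
    (hQ : IsCovarianceOp Q d lam) (t : U) (k : ℕ) : ⟪Q t, d k⟫_ℝ = lam k * ⟪d k, t⟫_ℝ := by
  have h1 := ((d.hasSum_repr t).mapL Q).mapL (innerSL ℝ (d k))
  have h2 : ∀ j, innerSL ℝ (d k) (Q (d.repr t j • d j))
      = if j = k then lam k * ⟪d k, t⟫_ℝ else 0 := by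
    intro j
    rw [map_smul, hQ.eigen, map_smul, map_smul, innerSL_apply_apply,
      orthonormal_iff_ite.1 d.orthonormal k j, d.repr_apply_apply]
    by_cases h : j = k
    · subst h; simp; ring
    · simp [h, Ne.symm h]
  simp_rw [h2] at h1
  rw [real_inner_comm]
  exact h1.unique (hasSum_ite_eq k _)

theorem IsCovarianceOp.hasSum {Q : U →L[ℝ] U} {d : HilbertBasis ℕ ℝ U} {lam : ℕ → ℝ}
    (hQ : IsCovarianceOp Q d lam) (t : U) :
    HasSum (fun k => lam k * ⟪d k, t⟫_ℝ ^ 2) ⟪Q t, t⟫_ℝ := by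
  have := d.hasSum_inner_mul_inner (Q t) t
  simp_rw [hQ.inner_basis] at this
  convert! this using 2
  ring

/-- Since Q is diagonal, its quadratic form has no cross terms between head and tail; this makes the
Gaussian characteristic function factor. -/
theorem IsCovarianceOp.inner_split {Q : U →L[ℝ] U} {d : HilbertBasis ℕ ℝ U} {lam : ℕ → ℝ}
    (hQ : IsCovarianceOp Q d lam) (N : ℕ) (t : U) :
    ⟪Q t, t⟫_ℝ = ∑ i : Fin N, lam i * coordL d N t i ^ 2 +
      ⟪Q (t - embedL d N (coordL d N t)), t - embedL d N (coordL d N t)⟫_ℝ := by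
  have h1 := (hQ.hasSum t).sub (hQ.hasSum (t - embedL d N (coordL d N t)))
  have h2 : ∀ k, lam k * ⟪d k, t⟫_ℝ ^ 2 - lam k * ⟪d k, t - embedL d N (coordL d N t)⟫_ℝ ^ 2 =
      if k < N then lam k * ⟪d k, t⟫_ℝ ^ 2 else 0 := by
    intro k
    rw [inner_sub_right, inner_basis_embedL]
    split_ifs with h
    · rw [coordL_apply]; simp
    · simp
  simp_rw [h2] at h1
  have h3 : HasSum (fun k => if k < N then lam k * ⟪d k, t⟫_ℝ ^ 2 else 0)
      (∑ k ∈ Finset.range N, if k < N then lam k * ⟪d k, t⟫_ℝ ^ 2 else 0) :=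
    hasSum_sum_of_ne_finset_zero fun k hk => by
      rw [if_neg]; simpa using hk
  have h4 := h1.unique h3
  rw [Finset.sum_congr rfl fun k hk => if_pos (Finset.mem_range.1 hk), Finset.sum_range] at h4
  simp_rw [coordL_apply]
  linarith

end Coordinates

/-! ### Finite-dimensional Gaussians and disintegration of the Gaussian measure -/

section Gaussian

/-- Half of the quadratic form of the inverse covariance of a finite dimensional Gaussian. -/
noncomputable def gaussExponent (lam : ℕ → ℝ) (N : ℕ) (x : EuclideanSpace ℝ (Fin N)) : ℝ :=
  ∑ i, x i ^ 2 / (2 * lam i)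

/-- The normalising constant of a finite dimensional Gaussian. -/
noncomputable def gaussConst (lam : ℕ → ℝ) (N : ℕ) : ℝ :=
  ∏ i : Fin N, (√(2 * Real.pi * lam i))⁻¹

/-- The centred Gaussian measure on `ℝ ^ N` with diagonal covariance. -/
noncomputable def gaussMeasure (lam : ℕ → ℝ) (N : ℕ) : Measure (EuclideanSpace ℝ (Fin N)) :=
  volume.withDensity fun x =>
    ENNReal.ofReal (gaussConst lam N * Real.exp (-gaussExponent lam N x))

variable {lam : ℕ → ℝ}

theorem gaussConst_pos (hlam : ∀ k, 0 < lam k) (N : ℕ) : 0 < gaussConst lam N :=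
  Finset.prod_pos fun i _ => inv_pos.2 (Real.sqrt_pos.2 (by have := hlam i; positivity))

theorem contDiff_gaussExponent (lam : ℕ → ℝ) (N : ℕ) {n : WithTop ℕ∞} :
    ContDiff ℝ n (gaussExponent lam N) := by
  unfold gaussExponent
  fun_prop

theorem gaussDensity_eq_prod (hlam : ∀ k, 0 < lam k) (N : ℕ) (x : EuclideanSpace ℝ (Fin N)) :
    gaussConst lam N * Real.exp (-gaussExponent lam N x) =
      ∏ i : Fin N, ProbabilityTheory.gaussianPDFReal 0 (lam i).toNNReal (x i) := by
  rw [gaussConst, gaussExponent, ← Finset.sum_neg_distrib, Real.exp_sum,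
    ← Finset.prod_mul_distrib]
  refine Finset.prod_congr rfl fun i _ => ?_
  rw [ProbabilityTheory.gaussianPDFReal_def, Real.coe_toNNReal _ (hlam i).le]
  simp only []
  rw [sub_zero, neg_div]

theorem integrable_gaussDensity (hlam : ∀ k, 0 < lam k) (N : ℕ) :
    Integrable fun x => gaussConst lam N * Real.exp (-gaussExponent lam N x) := by
  simp_rw [gaussDensity_eq_prod hlam]
  rw [← (EuclideanSpace.volume_preserving_symm_measurableEquiv_toLp (Fin N)).symm.integrable_comp_emb
    (MeasurableEquiv.measurableEmbedding _)]
  exact Integrable.fintype_prod fun i => ProbabilityTheory.integrable_gaussianPDFReal 0 _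

theorem isFiniteMeasure_gaussMeasure (hlam : ∀ k, 0 < lam k) (N : ℕ) :
    IsFiniteMeasure (gaussMeasure lam N) :=
  isFiniteMeasure_withDensity_ofReal (integrable_gaussDensity hlam N).2

theorem measurable_gaussDensity (lam : ℕ → ℝ) (N : ℕ) :
    Measurable fun x => ENNReal.ofReal (gaussConst lam N * Real.exp (-gaussExponent lam N x)) := by
  have := (contDiff_gaussExponent lam N (n := 1)).continuous
  fun_prop

theorem gaussDensity_nonneg (hlam : ∀ k, 0 < lam k) (N : ℕ) (x : EuclideanSpace ℝ (Fin N)) :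
    0 ≤ gaussConst lam N * Real.exp (-gaussExponent lam N x) :=
  mul_nonneg (gaussConst_pos hlam N).le (Real.exp_pos _).le

theorem integral_gaussMeasure (hlam : ∀ k, 0 < lam k) (N : ℕ) {G : Type*} [NormedAddCommGroup G]
    [NormedSpace ℝ G] (F : EuclideanSpace ℝ (Fin N) → G) :
    ∫ x, F x ∂gaussMeasure lam N =
      ∫ x, (gaussConst lam N * Real.exp (-gaussExponent lam N x)) • F x := by
  rw [gaussMeasure, integral_withDensity_eq_integral_toReal_smul (measurable_gaussDensity lam N)
    (Eventually.of_forall fun x => ENNReal.ofReal_lt_top)]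
  simp_rw [ENNReal.toReal_ofReal (gaussDensity_nonneg hlam N _)]

theorem integrable_gaussMeasure_iff (hlam : ∀ k, 0 < lam k) (N : ℕ)
    {F : EuclideanSpace ℝ (Fin N) → ℝ} :
    Integrable F (gaussMeasure lam N) ↔
      Integrable fun x => F x * Real.exp (-gaussExponent lam N x) := by
  rw [gaussMeasure, integrable_withDensity_iff_integrable_smul' (measurable_gaussDensity lam N)
    (Eventually.of_forall fun x => ENNReal.ofReal_lt_top)]
  simp_rw [ENNReal.toReal_ofReal (gaussDensity_nonneg hlam N _), smul_eq_mul, mul_assoc]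
  rw [integrable_const_mul_iff (isUnit_iff_ne_zero.2 (gaussConst_pos hlam N).ne')]
  simp_rw [mul_comm]

theorem charFun_gaussMeasure (hlam : ∀ k, 0 < lam k) (N : ℕ) (t : EuclideanSpace ℝ (Fin N)) :
    charFun (gaussMeasure lam N) t =
      Complex.exp (-(1 / 2 : ℂ) * ((∑ i : Fin N, lam i * t i ^ 2 : ℝ) : ℂ)) := by
  rw [charFun_apply, integral_gaussMeasure hlam]
  simp_rw [gaussDensity_eq_prod hlam]
  rw [← (EuclideanSpace.volume_preserving_symm_measurableEquiv_toLp (Fin N)).symm.integral_comp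
    (MeasurableEquiv.measurableEmbedding _)]
  have h1 : ∀ x : Fin N → ℝ,
      (∏ i : Fin N, ProbabilityTheory.gaussianPDFReal 0 (lam i).toNNReal
        (((MeasurableEquiv.toLp 2 (Fin N → ℝ)).symm.symm x) i)) •
        Complex.exp ((⟪(MeasurableEquiv.toLp 2 (Fin N → ℝ)).symm.symm x, t⟫_ℝ : ℝ) * Complex.I) =
      ∏ i : Fin N, (ProbabilityTheory.gaussianPDFReal 0 (lam i).toNNReal (x i) •
        Complex.exp (t i * x i * Complex.I)) := by
    intro x
    rw [PiLp.inner_apply]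
    simp [Complex.exp_sum, Finset.sum_mul, Finset.prod_mul_distrib]
  simp_rw [h1]
  rw [integral_fintype_prod_volume_eq_prod (f := fun (i : Fin N) (y : ℝ) =>
    ProbabilityTheory.gaussianPDFReal 0 (lam i).toNNReal y •
        Complex.exp (t i * y * Complex.I))]
  have h2 : ∀ i : Fin N, ∫ y : ℝ, ProbabilityTheory.gaussianPDFReal 0 (lam i).toNNReal y •
        Complex.exp (t i * y * Complex.I) = Complex.exp (-(1 / 2 : ℂ) * (lam i * t i ^ 2 : ℝ)) := by
    intro i
    rw [← ProbabilityTheory.integral_gaussianReal_eq_integral_smul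
      (Real.toNNReal_pos.2 (hlam i)).ne', ← charFun_apply_real,
      ProbabilityTheory.charFun_gaussianReal]
    congr 1
    rw [Real.coe_toNNReal _ (hlam i).le]
    push_cast
    ring
  simp_rw [h2]
  rw [← Complex.exp_sum, ← Finset.mul_sum, Complex.ofReal_sum]

variable {U : Type*} [NormedAddCommGroup U] [InnerProductSpace ℝ U] [CompleteSpace U]
  [MeasurableSpace U] [BorelSpace U]

/-- Disintegration of a Gaussian measure along the span of the first `N` basis vectors. -/
theorem measurePreserving_fiberPt {Q : U →L[ℝ] U} {d : HilbertBasis ℕ ℝ U}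
    (hQ : IsCovarianceOp Q d lam) {μ : Measure U} (hμ : IsCenteredGaussian μ Q) (N : ℕ) :
    MeasurePreserving (fun z : EuclideanSpace ℝ (Fin N) × U => fiberPt d N z.1 z.2)
      ((gaussMeasure lam N).prod μ) μ := by
  have := d.secondCountableTopology
  have := hμ.1
  have := isFiniteMeasure_gaussMeasure hQ.pos N
  have hm := (continuous_fiberPt d N).measurable
  refine ⟨hm, ?_⟩
  have : IsFiniteMeasure (((gaussMeasure lam N).prod μ).map
    (fun z : EuclideanSpace ℝ (Fin N) × U => fiberPt d N z.1 z.2)) :=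
    Measure.isFiniteMeasure_map _ _
  -- The first N coordinates of `fiberPt` come from x alone and the others from y alone, so the
  -- exponential factors. The head of t sees the finite Gaussian, its tail sees μ, and the two
  -- exponents add up to that of μ.
  refine Measure.ext_of_charFun (funext fun t => ?_)
  rw [charFun_apply, integral_map hm.aemeasurable (by fun_prop)]
  have h1 : ∀ z : EuclideanSpace ℝ (Fin N) × U,
      Complex.exp ((⟪fiberPt d N z.1 z.2, t⟫_ℝ : ℝ) * Complex.I) =
        Complex.exp ((⟪z.1, coordL d N t⟫_ℝ : ℝ) * Complex.I) *
        Complex.exp ((⟪z.2, t - embedL d N (coordL d N t)⟫_ℝ : ℝ) * Complex.I) := by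
    intro z
    rw [← Complex.exp_add, ← add_mul, ← Complex.ofReal_add]
    congr 3
    rw [fiberPt, inner_add_left, inner_embedL, inner_sub_left, inner_embedL, inner_sub_right,
      real_inner_comm (embedL d N _), inner_embedL]
    linarith [real_inner_comm (coordL d N t) (coordL d N z.2)]
  simp_rw [h1]
  rw [integral_prod_mul (fun x => Complex.exp ((⟪x, coordL d N t⟫_ℝ : ℝ) * Complex.I))
    (fun y => Complex.exp ((⟪y, t - embedL d N (coordL d N t)⟫_ℝ : ℝ) * Complex.I)),
    ← charFun_apply, ← charFun_apply, charFun_gaussMeasure hQ.pos, hμ.2, hμ.2,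
    hQ.inner_split N t, ← Complex.exp_add, ← mul_add, ← Complex.ofReal_add]

/-- Fubini for the disintegration. The outer variable still ranges over U under the full measure μ;
this is harmless because the fibre point ignores its first N coordinates. -/
theorem integral_fiber {Q : U →L[ℝ] U} {d : HilbertBasis ℕ ℝ U}
    (hQ : IsCovarianceOp Q d lam) {μ : Measure U} (hμ : IsCenteredGaussian μ Q) (N : ℕ)
    {F : U → ℝ} (hF : Integrable F μ) :
    (∀ᵐ y ∂μ, Integrable fun x => F (fiberPt d N x y) * Real.exp (-gaussExponent lam N x)) ∧
    Integrable (fun y => ∫ x, F (fiberPt d N x y) * Real.exp (-gaussExponent lam N x)) μ ∧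
    ∫ u, F u ∂μ = gaussConst lam N *
      ∫ y, (∫ x, F (fiberPt d N x y) * Real.exp (-gaussExponent lam N x)) ∂μ := by
  have := d.secondCountableTopology
  have := hμ.1
  have := isFiniteMeasure_gaussMeasure hQ.pos N
  have hT := measurePreserving_fiberPt hQ hμ N
  have hFT : Integrable (fun z : EuclideanSpace ℝ (Fin N) × U => F (fiberPt d N z.1 z.2))
      ((gaussMeasure lam N).prod μ) := hT.integrable_comp_of_integrable hF
  have e : ∀ y, ∫ x, F (fiberPt d N x y) ∂gaussMeasure lam N = gaussConst lam N *
      ∫ x, F (fiberPt d N x y) * Real.exp (-gaussExponent lam N x) := by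
    intro y
    rw [integral_gaussMeasure hQ.pos, ← integral_const_mul]
    simp_rw [smul_eq_mul]
    exact integral_congr_ae (Eventually.of_forall fun x => by simp only []; ring)
  have hκ := (gaussConst_pos hQ.pos N).ne'
  refine ⟨?_, ?_, ?_⟩
  · filter_upwards [hFT.prod_left_ae] with y hy
    exact (integrable_gaussMeasure_iff hQ.pos N).1 hy
  · have := hFT.integral_prod_right
    simp_rw [e] at this
    exact (integrable_const_mul_iff (isUnit_iff_ne_zero.2 hκ) _).1 this
  · nth_rw 1 [← hT.map_eq]
    rw [integral_map hT.measurable.aemeasurable (by rw [hT.map_eq]; exact hF.1),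
      integral_prod_symm _ hFT]
    simp_rw [e]
    rw [integral_const_mul]

end Gaussian

/-! ### The inverse covariance matrix as gradient of the Gaussian exponent -/

section InvCov

/-- The inverse of the diagonal covariance matrix of `gaussMeasure`. -/
noncomputable def invCovL (lam : ℕ → ℝ) (N : ℕ) :
    EuclideanSpace ℝ (Fin N) →L[ℝ] EuclideanSpace ℝ (Fin N) :=
  (EuclideanSpace.equiv (Fin N) ℝ).symm.toContinuousLinearMap.comp
    (ContinuousLinearMap.pi fun i : Fin N => (lam i)⁻¹ • EuclideanSpace.proj i)

theorem invCovL_apply (lam : ℕ → ℝ) (N : ℕ) (x : EuclideanSpace ℝ (Fin N)) (i : Fin N) :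
    invCovL lam N x i = x i / lam i := by
  simp [invCovL, div_eq_inv_mul]

theorem inner_invCovL (lam : ℕ → ℝ) (N : ℕ) (x y : EuclideanSpace ℝ (Fin N)) :
    ⟪invCovL lam N x, y⟫_ℝ = ∑ i, x i * y i / lam i := by
  rw [PiLp.inner_apply]
  refine Finset.sum_congr rfl fun i _ => ?_
  rw [invCovL_apply]
  simp
  ring

theorem hasFDerivAt_gaussExponent (lam : ℕ → ℝ) (N : ℕ) (x : EuclideanSpace ℝ (Fin N)) :
    HasFDerivAt (gaussExponent lam N) (innerSL ℝ (invCovL lam N x)) x := by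
  have h1 : gaussExponent lam N = fun x => (1 / 2 : ℝ) * ⟪invCovL lam N x, x⟫_ℝ := by
    funext x
    rw [inner_invCovL, gaussExponent, Finset.mul_sum]
    refine Finset.sum_congr rfl fun i _ => ?_
    rw [mul_comm 2 (lam i), ← div_div]; ring
  rw [h1]
  have h2 := (((invCovL lam N).hasFDerivAt (x := x)).inner ℝ (hasFDerivAt_id x)).const_mul
    (1 / 2 : ℝ)
  convert! h2 using 1
  ext v
  have h3 : ⟪invCovL lam N v, x⟫_ℝ = ⟪invCovL lam N x, v⟫_ℝ := by
    rw [inner_invCovL, inner_invCovL]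
    exact Finset.sum_congr rfl fun i _ => by ring
  simp [h3]
  ring

end InvCov

/-! ### Gaussian integration by parts and the resolvent estimate for regular potentials -/

section GaussianCalculus

variable {U : Type*} [NormedAddCommGroup U] [InnerProductSpace ℝ U] [MeasurableSpace U]
  [BorelSpace U] {lam : ℕ → ℝ} {Q : U →L[ℝ] U} {d : HilbertBasis ℕ ℝ U}
  {μ : Measure U}

/-- Restricting the characteristic function to multiples of `d k` identifies the law of the
coordinate as a one-dimensional Gaussian, which has a second moment. -/
theorem IsCenteredGaussian.memLp_coord (hQ : IsCovarianceOp Q d lam)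
    (hμ : IsCenteredGaussian μ Q) (k : ℕ) : MemLp (fun u => ⟪d k, u⟫_ℝ) 2 μ := by
  have := d.secondCountableTopology
  have := hμ.1
  have hm : Measurable fun u : U => ⟪d k, u⟫_ℝ := by fun_prop
  have hmap : μ.map (fun u => ⟪d k, u⟫_ℝ) = ProbabilityTheory.gaussianReal 0 (lam k).toNNReal := by
    have : IsFiniteMeasure (μ.map (fun u => ⟪d k, u⟫_ℝ)) := Measure.isFiniteMeasure_map _ _
    refine Measure.ext_of_charFun (funext fun t => ?_)
    rw [ProbabilityTheory.charFun_gaussianReal, charFun_apply_real,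
      integral_map hm.aemeasurable (by fun_prop)]
    have h := hμ.2 (t • d k)
    rw [charFun_apply] at h
    have h1 : ∀ u : U, Complex.exp ((⟪u, t • d k⟫_ℝ : ℝ) * Complex.I) =
        Complex.exp (t * (⟪d k, u⟫_ℝ : ℝ) * Complex.I) := fun u => by
      rw [inner_smul_right, real_inner_comm, Complex.ofReal_mul]
    simp_rw [h1] at h
    rw [h, map_smul, hQ.eigen, inner_smul_left, inner_smul_right, inner_smul_left,
      real_inner_self_eq_norm_sq, d.orthonormal.1 k, Real.coe_toNNReal _ (hQ.pos k).le]
    congr 1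
    simp
    ring
  have h := ProbabilityTheory.memLp_id_gaussianReal (μ := 0) (v := (lam k).toNNReal) 2
  rw [← hmap] at h
  exact (memLp_map_measure_iff (by fun_prop) hm.aemeasurable).1 h

variable [CompleteSpace U]

/-- Gaussian integration by parts along a basis vector. -/
theorem IsCenteredGaussian.integral_fderiv (hQ : IsCovarianceOp Q d lam)
    (hμ : IsCenteredGaussian μ Q) (k : ℕ) {F : U → ℝ} (hF : Differentiable ℝ F)
    (h1 : Integrable F μ) (h2 : Integrable (fun u => fderiv ℝ F u (d k)) μ)
    (h3 : Integrable (fun u => F u * ⟪d k, u⟫_ℝ) μ) :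
    ∫ u, (fderiv ℝ F u (d k) - F u * ⟪d k, u⟫_ℝ / lam k) ∂μ = 0 := by
  -- Indices start at 0, so the first k + 1 basis vectors include `d k`, and the fibres contain the
  -- direction of differentiation.
  have hk : k < k + 1 := Nat.lt_succ_self k
  set v : EuclideanSpace ℝ (Fin (k + 1)) := EuclideanSpace.single ⟨k, hk⟩ 1
  have hv : embedL d (k + 1) v = d k := by
    rw [embedL_apply, Finset.sum_eq_single ⟨k, hk⟩]
    · simp [v]
    · intro i _ hi; simp [v, hi]
    · simp
  obtain ⟨a1, -, -⟩ := integral_fiber hQ hμ (k + 1) h1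
  obtain ⟨a2, -, -⟩ := integral_fiber hQ hμ (k + 1) h2
  obtain ⟨a3, -, -⟩ := integral_fiber hQ hμ (k + 1) h3
  have hI : Integrable (fun u => fderiv ℝ F u (d k) - F u * ⟪d k, u⟫_ℝ / lam k) μ :=
    h2.sub (h3.div_const (lam k))
  rw [(integral_fiber hQ hμ (k + 1) hI).2.2]
  refine mul_eq_zero_of_right _ (integral_eq_zero_of_ae ?_)
  filter_upwards [a1, a2, a3] with y b1 b2 b3
  have hd : ∀ x, HasFDerivAt (fun x => F (fiberPt d (k + 1) x y))
      ((fderiv ℝ F (fiberPt d (k + 1) x y)).comp (embedL d (k + 1))) x := fun x =>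
    (hF _).hasFDerivAt.comp x (hasFDerivAt_fiberPt d (k + 1) x y)
  have e1 : ∀ x, fderiv ℝ (fun x => F (fiberPt d (k + 1) x y)) x v =
      fderiv ℝ F (fiberPt d (k + 1) x y) (d k) := fun x => by
    rw [(hd x).fderiv, ContinuousLinearMap.comp_apply, hv]
  have e2 : ∀ x, fderiv ℝ (gaussExponent lam (k + 1)) x v =
      ⟪d k, fiberPt d (k + 1) x y⟫_ℝ / lam k := fun x => by
    rw [(hasFDerivAt_gaussExponent lam (k + 1) x).fderiv, innerSL_apply_apply]
    have : ⟪d k, fiberPt d (k + 1) x y⟫_ℝ = x ⟨k, hk⟩ := by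
      conv_rhs => rw [← coordL_fiberPt d (k + 1) x y, coordL_apply]
    rw [this, EuclideanSpace.inner_single_right, invCovL_apply]
    simp
  have key := integral_fderiv_sub_mul_exp_neg v (contDiff_gaussExponent lam (k + 1))
    (a := fun x => F (fiberPt d (k + 1) x y)) (fun x => (hd x).differentiableAt) b1
    (by simp_rw [e1]; exact b2)
    (by
      simp_rw [e2]
      refine (b3.div_const (lam k)).congr (Eventually.of_forall fun x => ?_)
      simp only []; ring)
  simp_rw [e1, e2] at key
  simp only [Pi.zero_apply]
  rw [← key]
  exact integral_congr_ae (Eventually.of_forall fun x => by simp only []; ring)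

/-- The resolvent estimate for cylinder functions and regular potentials. -/
theorem IsCenteredGaussian.integral_resolvent_le (hQ : IsCovarianceOp Q d lam)
    (hμ : IsCenteredGaussian μ Q) (N : ℕ) {Θ : U → ℝ} (hΘ : ContDiff ℝ 1 Θ)
    (hΘ0 : Integrable (fun u => Real.exp (-Θ u)) μ)
    (hx : Integrable (fun u => ‖coordL d N u‖ ^ 2 * Real.exp (-Θ u)) μ)
    (hΘ1 : Integrable (fun u => ‖coordL d N (gradient Θ u)‖ ^ 2 * Real.exp (-Θ u)) μ)
    {q : EuclideanSpace ℝ (Fin N) → ℝ} {c : ℝ} (hc : 0 ≤ c)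
    (hq : ∀ (t : ℝ) v, q (t • v) = t ^ 2 * q v) (hqc : Continuous q) (hq0 : ∀ v, 0 ≤ q v)
    (hmono : ∀ u v, -(c * q v) ≤
      ⟪gradient Θ (u + embedL d N v) - gradient Θ u, embedL d N v⟫_ℝ)
    {φ : EuclideanSpace ℝ (Fin N) → ℝ} (hφ : ContDiff ℝ 1 φ)
    {h : EuclideanSpace ℝ (Fin N) → EuclideanSpace ℝ (Fin N)} (hh : ContDiff ℝ 2 h)
    (hqh : ∀ x, q (h x) = ⟪gradient φ x, h x⟫_ℝ) {M : ℝ} (hφM : ∀ x, |φ x| ≤ M)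
    (hφM' : ∀ x, ‖fderiv ℝ φ x‖ ≤ M) (hM : ∀ x, ‖h x‖ ≤ M)
    (hM' : ∀ x, ‖fderiv ℝ h x‖ ≤ M) :
    ∫ u, (opTrace _ (fderiv ℝ h (coordL d N u) ∘L fderiv ℝ h (coordL d N u)) +
        ⟪invCovL lam N (h (coordL d N u)), h (coordL d N u)⟫_ℝ) * Real.exp (-Θ u) ∂μ ≤
      (1 + c / 4) * ∫ u, (φ (coordL d N u) - (opTrace _ (fderiv ℝ h (coordL d N u)) -
        ⟪invCovL lam N (coordL d N u) + coordL d N (gradient Θ u), h (coordL d N u)⟫_ℝ)) ^ 2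
          * Real.exp (-Θ u) ∂μ := by
  have := d.secondCountableTopology
  have hM0 : 0 ≤ M := (norm_nonneg _).trans (hM 0)
  have ch := hh.continuous
  have cdh := hh.continuous_fderiv two_ne_zero
  have cc := cdh.clm_comp cdh
  have cφ := hφ.continuous
  have cgΘ := continuous_gradient hΘ
  have cΘ := hΘ.continuous
  have iL : Integrable (fun u => (opTrace _ (fderiv ℝ h (coordL d N u) ∘L
      fderiv ℝ h (coordL d N u)) + ⟪invCovL lam N (h (coordL d N u)), h (coordL d N u)⟫_ℝ)
      * Real.exp (-Θ u)) μ := by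
    refine hΘ0.bdd_mul (c := ‖opTrace (EuclideanSpace ℝ (Fin N))‖ * (M * M)
      + ‖invCovL lam N‖ * M * M) ?_ (Eventually.of_forall fun u => ?_)
    · have : Continuous fun u => opTrace _ (fderiv ℝ h (coordL d N u) ∘L
          fderiv ℝ h (coordL d N u)) :=
        (opTrace _).continuous.comp (cc.comp (coordL d N).continuous)
      exact Continuous.aestronglyMeasurable (by fun_prop)
    · refine (norm_add_le _ _).trans (add_le_add ?_ ?_)
      · refine ((opTrace (EuclideanSpace ℝ (Fin N))).le_opNorm _).trans ?_
        gcongr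
        refine (ContinuousLinearMap.opNorm_comp_le _ _).trans ?_
        exact mul_le_mul (hM' _) (hM' _) (norm_nonneg _) hM0
      · refine (norm_inner_le_norm _ _).trans ?_
        gcongr
        · exact ((invCovL lam N).le_opNorm _).trans (by gcongr; exact hM _)
        · exact hM _
  have iR : Integrable (fun u => (φ (coordL d N u) - (opTrace _ (fderiv ℝ h (coordL d N u)) -
        ⟪invCovL lam N (coordL d N u) + coordL d N (gradient Θ u), h (coordL d N u)⟫_ℝ)) ^ 2
          * Real.exp (-Θ u)) μ := by
    set T := ‖opTrace (EuclideanSpace ℝ (Fin N))‖ * M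
    set Λ := ‖invCovL lam N‖
    refine (((hΘ0.const_mul (3 * (M + T) ^ 2)).add (hx.const_mul (3 * (Λ * M) ^ 2))).add
      (hΘ1.const_mul (3 * M ^ 2))).mono' ?_ (Eventually.of_forall fun u => ?_)
    · exact Continuous.aestronglyMeasurable (by fun_prop)
    · simp only [Pi.add_apply]
      rw [norm_mul, Real.norm_of_nonneg (Real.exp_pos _).le, ← mul_assoc, ← mul_assoc,
        ← add_mul, ← add_mul]
      gcongr
      rw [Real.norm_of_nonneg (sq_nonneg _), ← sq_abs]
      set a := ‖coordL d N u‖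
      set b := ‖coordL d N (gradient Θ u)‖
      have h1 : |φ (coordL d N u) - (opTrace _ (fderiv ℝ h (coordL d N u)) -
          ⟪invCovL lam N (coordL d N u) + coordL d N (gradient Θ u), h (coordL d N u)⟫_ℝ)|
          ≤ (M + T) + Λ * M * a + M * b := by
        refine (abs_sub _ _).trans ?_
        have i1 : |opTrace _ (fderiv ℝ h (coordL d N u))| ≤ T :=
          ((opTrace (EuclideanSpace ℝ (Fin N))).le_opNorm _).trans
            (mul_le_mul_of_nonneg_left (hM' _) (norm_nonneg _))
        have i2 : |⟪invCovL lam N (coordL d N u) + coordL d N (gradient Θ u),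
            h (coordL d N u)⟫_ℝ| ≤ (Λ * a + b) * M := by
          refine (abs_real_inner_le_norm _ _).trans ?_
          gcongr
          · exact (norm_add_le _ _).trans (by gcongr; exact (invCovL lam N).le_opNorm _)
          · exact hM _
        have i3 := abs_sub (opTrace _ (fderiv ℝ h (coordL d N u)))
          ⟪invCovL lam N (coordL d N u) + coordL d N (gradient Θ u), h (coordL d N u)⟫_ℝ
        have i4 := hφM (coordL d N u)
        linarith
      refine (pow_le_pow_left₀ (abs_nonneg _) h1 2).trans ?_
      nlinarith [sq_nonneg (M + T - Λ * M * a), sq_nonneg (M + T - M * b),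
        sq_nonneg (Λ * M * a - M * b)]
  obtain ⟨-, oL, eL⟩ := integral_fiber hQ hμ N iL
  obtain ⟨-, oR, eR⟩ := integral_fiber hQ hμ N iR
  rw [eL, eR, mul_left_comm]
  refine mul_le_mul_of_nonneg_left ?_ (gaussConst_pos hQ.pos N).le
  rw [← integral_const_mul]
  refine integral_mono_ae oL (oR.const_mul _) ?_
  filter_upwards [(integral_fiber hQ hμ N hΘ0).1, (integral_fiber hQ hμ N hx).1,
    (integral_fiber hQ hμ N hΘ1).1] with y y0 yx y1
  -- On the fibre over y the density is e^{-W}, up to the Gaussian normalising constant. The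
  -- integrability needed by the finite-dimensional estimate holds for almost every y, by Fubini.
  set W : EuclideanSpace ℝ (Fin N) → ℝ :=
    fun x => gaussExponent lam N x + Θ (fiberPt d N x y) with hWdef
  have hW : ContDiff ℝ 1 W := (contDiff_gaussExponent lam N).add (hΘ.comp (contDiff_fiberPt d N y))
  have hexp : ∀ x, Real.exp (-W x) =
      Real.exp (-Θ (fiberPt d N x y)) * Real.exp (-gaussExponent lam N x) := fun x => by
    rw [← Real.exp_add, hWdef]; congr 1; ring
  have hgrad : ∀ x, gradient W x =
      invCovL lam N x + coordL d N (gradient Θ (fiberPt d N x y)) := fun x => by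
    have h1 := (hasFDerivAt_gaussExponent lam N x).add
      ((hΘ.differentiable one_ne_zero _).hasFDerivAt.comp x (hasFDerivAt_fiberPt d N x y))
    refine ext_inner_right ℝ fun v => ?_
    rw [inner_gradient_left, show fderiv ℝ W x = _ from h1.fderiv, inner_add_left,
      inner_coordL, inner_gradient_left]
    simp
  have cgW := continuous_gradient hW
  have cW := hW.continuous
  have key := _root_.integral_resolvent_le (W := W) hW (by simp_rw [hexp]; exact y0)
    (by
      refine ((yx.const_mul (2 * ‖invCovL lam N‖ ^ 2)).add (y1.const_mul 2)).mono'
        (Continuous.aestronglyMeasurable (by fun_prop)) (Eventually.of_forall fun x => ?_)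
      simp only [Pi.add_apply, coordL_fiberPt]
      rw [norm_mul, Real.norm_of_nonneg (Real.exp_pos _).le, Real.norm_of_nonneg (sq_nonneg _),
        hexp]
      have h1 := norm_add_le (invCovL lam N x) (coordL d N (gradient Θ (fiberPt d N x y)))
      have h2 := (invCovL lam N).le_opNorm x
      have h3 : ‖gradient W x‖ ^ 2 ≤ 2 * ‖invCovL lam N‖ ^ 2 * ‖x‖ ^ 2
          + 2 * ‖coordL d N (gradient Θ (fiberPt d N x y))‖ ^ 2 := by
        rw [hgrad]
        refine (pow_le_pow_left₀ (norm_nonneg _) (h1.trans (add_le_add_left h2 _)) 2).trans ?_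
        nlinarith [sq_nonneg (‖invCovL lam N‖ * ‖x‖
          - ‖coordL d N (gradient Θ (fiberPt d N x y))‖)]
      exact (mul_le_mul_of_nonneg_right h3 (mul_pos (Real.exp_pos _) (Real.exp_pos _)).le).trans
        (le_of_eq (by ring)))
    (S := fun v => ⟪invCovL lam N v, v⟫_ℝ) hc
    (fun t v => by simp only [map_smul, inner_smul_left, inner_smul_right]; simp; ring)
    (by fun_prop) hq hqc hq0
    -- The Gaussian part of ∇W is linear, so its increment contributes exactly S(v); only the
    -- increment of ∇Θ needs the hypothesis.
    (fun x v => by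
      rw [hgrad, hgrad, fiberPt_add, map_add, add_sub_add_comm, add_sub_cancel_left,
        inner_add_left, ← map_sub, inner_coordL]
      linarith [hmono (fiberPt d N x y) v])
    hφ hh hqh hφM hφM' hM hM'
  simp_rw [coordL_fiberPt]
  simp_rw [hexp, wdiv, hgrad, ← mul_assoc] at key
  exact key

end GaussianCalculus

/-! ### Powers of the covariance in coordinates -/

section CovPow

variable {E : Type*} [NormedAddCommGroup E] [InnerProductSpace ℝ E]

theorem inner_covPow_ev (d : HilbertBasis ℕ ℝ E) (lam : ℕ → ℝ) (s : ℝ) {x : E}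
    (hx : x ∈ (covPow d lam s).domain) (k : ℕ) :
    ⟪d k, (covPow d lam s).ev x⟫_ℝ = lam k ^ s * ⟪d k, x⟫_ℝ := by
  rw [LinearPMap.ev, dif_pos hx, ← d.repr_apply_apply, ← d.repr_apply_apply]
  change d.repr (d.repr.symm _) k = _
  rw [LinearIsometryEquiv.apply_symm_apply]

theorem IsCovarianceOp.mem_covPow_domain {d : HilbertBasis ℕ ℝ E} {lam : ℕ → ℝ} {Q : E →L[ℝ] E}
    (hQ : IsCovarianceOp Q d lam) {θ : ℝ} (hθ : 0 ≤ θ) (x : E) :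
    x ∈ (covPow d lam θ).domain := by
  have h1 : Memℓp (fun k => lam 0 ^ θ * d.repr x k) 2 := (lp.memℓp (d.repr x)).const_mul _
  change Memℓp (fun k => lam k ^ θ * d.repr x k) 2
  refine memℓp_gen ?_
  have h2 := h1.summable (by norm_num)
  refine Summable.of_nonneg_of_le (fun k => by positivity) (fun k => ?_) h2
  refine Real.rpow_le_rpow (norm_nonneg _) ?_ (by norm_num)
  rw [norm_mul, norm_mul]
  refine mul_le_mul_of_nonneg_right ?_ (norm_nonneg _)
  rw [Real.norm_of_nonneg (Real.rpow_nonneg (hQ.pos _).le _),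
    Real.norm_of_nonneg (Real.rpow_nonneg (hQ.pos _).le _)]
  exact Real.rpow_le_rpow (hQ.pos _).le (hQ.antitone (Nat.zero_le k)) hθ

theorem IsCovarianceOp.inner_covPow_ev {d : HilbertBasis ℕ ℝ E} {lam : ℕ → ℝ} {Q : E →L[ℝ] E}
    (hQ : IsCovarianceOp Q d lam) {θ : ℝ} (hθ : 0 ≤ θ) (x : E) (k : ℕ) :
    ⟪(covPow d lam θ).ev x, d k⟫_ℝ = lam k ^ θ * ⟪x, d k⟫_ℝ := by
  rw [real_inner_comm, _root_.inner_covPow_ev d lam θ (hQ.mem_covPow_domain hθ x),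
    real_inner_comm]

end CovPow

/-! ### Weak derivatives in Gaussian space and additivity of the Sobolev gradient -/

section WeakGradient

/-- Bounded `C¹` functions with bounded derivative. -/
def IsBddC1 {U : Type*} [NormedAddCommGroup U] [InnerProductSpace ℝ U] (F : U → ℝ) : Prop :=
  ContDiff ℝ 1 F ∧ ∃ B : ℝ, ∀ u, |F u| ≤ B ∧ ‖fderiv ℝ F u‖ ≤ B

variable {U : Type*} [NormedAddCommGroup U] [InnerProductSpace ℝ U]

theorem IsCylinder.isBddC1 {d : HilbertBasis ℕ ℝ U} {f : U → ℝ} (hf : IsCylinder d 1 f) :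
    IsBddC1 f := by
  obtain ⟨n, φ, hφ, hb, rfl⟩ := hf
  obtain ⟨B₀, h0⟩ := hb 0 (by simp)
  obtain ⟨B₁, h1⟩ := hb 1 (by simp)
  have hφ' : ContDiff ℝ 1 φ := hφ
  simp_rw [coordMap_eq_coordL]
  have hB1 : 0 ≤ B₁ := (norm_nonneg _).trans (h1 0)
  refine ⟨hφ'.comp (coordL d n).contDiff, max B₀ (B₁ * ‖coordL d n‖), fun u => ⟨?_, ?_⟩⟩
  · refine le_trans ?_ (le_max_left _ _)
    simpa using h0 (coordL d n u)
  · refine le_trans ?_ (le_max_right _ _)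
    have := ((hφ'.differentiable one_ne_zero _).hasFDerivAt.comp u (coordL d n).hasFDerivAt)
    rw [show fderiv ℝ (fun u => φ (coordL d n u)) u = _ from this.fderiv]
    refine (ContinuousLinearMap.opNorm_comp_le _ _).trans ?_
    gcongr
    have := h1 (coordL d n u)
    rwa [norm_iteratedFDeriv_one] at this

theorem IsBddC1.mul {F χ : U → ℝ} (hF : IsBddC1 F) (hχ : IsBddC1 χ) :
    IsBddC1 (fun u => F u * χ u) := by
  obtain ⟨hF1, B, hB⟩ := hF
  obtain ⟨hχ1, C, hC⟩ := hχ
  have hB0 : 0 ≤ B := (abs_nonneg _).trans (hB 0).1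
  refine ⟨hF1.mul hχ1, max (B * C) (B * C + C * B), fun u => ⟨?_, ?_⟩⟩
  · refine le_trans ?_ (le_max_left _ _)
    rw [abs_mul]
    exact mul_le_mul (hB u).1 (hC u).1 (abs_nonneg _) hB0
  · refine le_trans ?_ (le_max_right _ _)
    rw [fderiv_fun_mul (hF1.differentiable one_ne_zero u) (hχ1.differentiable one_ne_zero u)]
    refine (norm_add_le _ _).trans (add_le_add ?_ ?_)
    · rw [norm_smul]
      exact mul_le_mul (hB u).1 (hC u).2 (norm_nonneg _) hB0
    · rw [norm_smul]
      exact mul_le_mul (hC u).1 (hB u).2 (norm_nonneg _) ((abs_nonneg _).trans (hC u).1)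

theorem isBddC1_cos (t : U) : IsBddC1 (fun u => Real.cos ⟪u, t⟫_ℝ) := by
  refine ⟨Real.contDiff_cos.comp (contDiff_id.inner ℝ contDiff_const), max 1 ‖t‖,
    fun u => ⟨(Real.abs_cos_le_one _).trans (le_max_left _ _), le_trans ?_ (le_max_right _ _)⟩⟩
  have h := ((innerSL ℝ t).hasFDerivAt (x := u)).cos
  simp only [innerSL_apply_apply] at h
  simp_rw [real_inner_comm t]
  rw [h.fderiv, norm_smul, innerSL_apply_norm, norm_neg]
  exact mul_le_of_le_one_left (norm_nonneg _) (Real.abs_sin_le_one _)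

theorem isBddC1_sin (t : U) : IsBddC1 (fun u => Real.sin ⟪u, t⟫_ℝ) := by
  refine ⟨Real.contDiff_sin.comp (contDiff_id.inner ℝ contDiff_const), max 1 ‖t‖,
    fun u => ⟨(Real.abs_sin_le_one _).trans (le_max_left _ _), le_trans ?_ (le_max_right _ _)⟩⟩
  have h := ((innerSL ℝ t).hasFDerivAt (x := u)).sin
  simp only [innerSL_apply_apply] at h
  simp_rw [real_inner_comm t]
  rw [h.fderiv, norm_smul, innerSL_apply_norm]
  exact mul_le_of_le_one_left (norm_nonneg _) (Real.abs_cos_le_one _)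

theorem tendsto_integral_mul_of_eLpNorm {X : Type*} [MeasurableSpace X] {μ : Measure X}
    {a : ℕ → X → ℝ} {a' b : X → ℝ} (ha : ∀ j, MemLp (a j) 2 μ) (ha' : MemLp a' 2 μ)
    (hb : MemLp b 2 μ) (h : Tendsto (fun j => eLpNorm (fun x => a j x - a' x) 2 μ) atTop (𝓝 0)) :
    Tendsto (fun j => ∫ x, a j x * b x ∂μ) atTop (𝓝 (∫ x, a' x * b x ∂μ)) := by
  refine tendsto_integral_of_L1' _ (ha'.integrable_mul hb).1
    (Eventually.of_forall fun j => (ha j).integrable_mul hb) ?_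
  have h0 : Tendsto (fun j => eLpNorm (fun x => a j x - a' x) 2 μ * eLpNorm b 2 μ) atTop
      (𝓝 0) := by
    have := ENNReal.Tendsto.mul_const h (Or.inr hb.2.ne)
    rwa [zero_mul] at this
  refine tendsto_of_tendsto_of_tendsto_of_le_of_le tendsto_const_nhds h0 (fun _ => zero_le)
    fun j => ?_
  have h1 := eLpNorm_smul_le_mul_eLpNorm (p := 2) (q := 2) (r := 1) (μ := μ)
    hb.1 ((ha j).sub ha').1
  refine le_trans (le_of_eq ?_) h1
  congr 1
  funext x
  simp [sub_mul]

variable [MeasurableSpace U] [BorelSpace U]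

/-- An integrable function is determined by its Fourier transform. -/
theorem ae_eq_zero_of_integral_cos_sin [CompleteSpace U] [SecondCountableTopology U]
    {μ : Measure U} {H : U → ℝ} (hH : Integrable H μ)
    (hc : ∀ t : U, ∫ u, H u * Real.cos ⟪u, t⟫_ℝ ∂μ = 0)
    (hs : ∀ t : U, ∫ u, H u * Real.sin ⟪u, t⟫_ℝ ∂μ = 0) : H =ᵐ[μ] 0 := by
  have key : ∀ {K : U → ℝ}, Integrable K μ → ∀ t,
      charFun (μ.withDensity fun u => ENNReal.ofReal (K u)) t =
        ∫ u, (max (K u) 0 : ℝ) • Complex.exp ((⟪u, t⟫_ℝ : ℝ) * Complex.I) ∂μ := by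
    intro K hK t
    rw [charFun_apply, integral_withDensity_eq_integral_toReal_smul₀
      hK.1.aemeasurable.ennreal_ofReal (Eventually.of_forall fun x => ENNReal.ofReal_lt_top)]
    simp_rw [ENNReal.toReal_ofReal']
  have hexp : ∀ {K : U → ℝ}, Integrable K μ → ∀ t : U,
      Integrable (fun u => K u • Complex.exp ((⟪u, t⟫_ℝ : ℝ) * Complex.I)) μ := by
    intro K hK t
    refine hK.norm.mono' (hK.1.smul (Continuous.aestronglyMeasurable (by fun_prop)))
      (Eventually.of_forall fun u => ?_)
    rw [norm_smul, Complex.norm_exp_ofReal_mul_I, mul_one]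
  have f1 := isFiniteMeasure_withDensity_ofReal hH.2
  have f2 := isFiniteMeasure_withDensity_ofReal hH.neg.2
  -- The positive and negative parts of H define finite measures whose characteristic functions
  -- differ by the vanishing integrals of H against cosine and sine, hence they coincide.
  have hm : (μ.withDensity fun u => ENNReal.ofReal (H u)) =
      μ.withDensity fun u => ENNReal.ofReal ((-H) u) := by
    refine Measure.ext_of_charFun (funext fun t => ?_)
    rw [key hH, key hH.neg, ← sub_eq_zero, ← integral_sub (hexp hH.pos_part t)
      (hexp hH.neg.pos_part t)]
    have e : ∀ u, (max (H u) 0 : ℝ) • Complex.exp ((⟪u, t⟫_ℝ : ℝ) * Complex.I)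
        - (max ((-H) u) 0 : ℝ) • Complex.exp ((⟪u, t⟫_ℝ : ℝ) * Complex.I) =
        ((H u * Real.cos ⟪u, t⟫_ℝ : ℝ) : ℂ)
          + ((H u * Real.sin ⟪u, t⟫_ℝ : ℝ) : ℂ) * Complex.I := by
      intro u
      rw [← sub_smul, Pi.neg_apply, max_zero_sub_max_neg_zero_eq_self,
        Complex.exp_mul_I, Complex.real_smul]
      push_cast
      ring
    simp_rw [e]
    have i1 : Integrable (fun u => H u * Real.cos ⟪u, t⟫_ℝ) μ :=
      hH.mul_bdd (c := 1) (by fun_prop) (Eventually.of_forall fun u => Real.abs_cos_le_one _)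
    have i2 : Integrable (fun u => H u * Real.sin ⟪u, t⟫_ℝ) μ :=
      hH.mul_bdd (c := 1) (by fun_prop) (Eventually.of_forall fun u => Real.abs_sin_le_one _)
    rw [integral_add i1.ofReal (i2.ofReal.mul_const _), integral_mul_const,
      integral_complex_ofReal, integral_complex_ofReal, hc, hs]
    simp
  have h := (withDensity_eq_iff hH.1.aemeasurable.ennreal_ofReal
    hH.neg.1.aemeasurable.ennreal_ofReal hH.lintegral_lt_top.ne).1 hm
  filter_upwards [h] with u hu
  have h1 := congrArg ENNReal.toReal hu
  rw [ENNReal.toReal_ofReal', ENNReal.toReal_ofReal'] at h1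
  have h2 := max_zero_sub_max_neg_zero_eq_self (H u)
  simp only [Pi.neg_apply] at h1
  simp only [Pi.zero_apply]
  linarith [max_comm (H u) 0, max_comm (-H u) 0]

theorem IsBddC1.memLp [SecondCountableTopology U] {μ : Measure U} [IsFiniteMeasure μ] {F : U → ℝ}
    (hF : IsBddC1 F) (p : ℝ≥0∞) : MemLp F p μ := by
  obtain ⟨hF1, B, hB⟩ := hF
  exact MemLp.of_bound hF1.continuous.aestronglyMeasurable B
    (Eventually.of_forall fun u => (hB u).1)

theorem IsBddC1.memLp_fderiv [SecondCountableTopology U] {μ : Measure U} [IsFiniteMeasure μ]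
    {F : U → ℝ} (hF : IsBddC1 F) (v : U) (p : ℝ≥0∞) : MemLp (fun u => fderiv ℝ F u v) p μ := by
  obtain ⟨hF1, B, hB⟩ := hF
  have := hF1.continuous_fderiv one_ne_zero
  refine MemLp.of_bound (Continuous.aestronglyMeasurable (by fun_prop)) (B * ‖v‖)
    (Eventually.of_forall fun u => ((fderiv ℝ F u).le_opNorm v).trans ?_)
  gcongr
  exact (hB u).2

variable {lam : ℕ → ℝ} {Q : U →L[ℝ] U} {d : HilbertBasis ℕ ℝ U} {μ : Measure U}

/-- The image of `χ` under the adjoint of the derivative along `d k` in the Gaussian `L²` space. -/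
noncomputable def gaussAdjoint (d : HilbertBasis ℕ ℝ U) (lam : ℕ → ℝ) (k : ℕ) (χ : U → ℝ)
    (u : U) : ℝ :=
  χ u * ⟪d k, u⟫_ℝ / lam k - fderiv ℝ χ u (d k)

theorem memLp_gaussAdjoint (hQ : IsCovarianceOp Q d lam) (hμ : IsCenteredGaussian μ Q) (k : ℕ)
    {χ : U → ℝ} (hχ : IsBddC1 χ) : MemLp (gaussAdjoint d lam k χ) 2 μ := by
  have := d.secondCountableTopology
  have := hμ.1
  refine MemLp.sub ?_ (hχ.memLp_fderiv _ _)
  obtain ⟨hχ1, B, hB⟩ := hχ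
  have h1 := (hμ.memLp_coord hQ k).const_mul (B / lam k)
  have hc := hχ1.continuous
  refine h1.of_le (Continuous.aestronglyMeasurable (by fun_prop)) (Eventually.of_forall fun u => ?_)
  rw [mul_div_right_comm, norm_mul, norm_mul, norm_div, norm_div]
  gcongr
  exact (hB u).1.trans (le_abs_self _)

variable [CompleteSpace U]

/-- Apply Gaussian integration by parts to the product Fχ and expand with the product rule. -/
theorem IsCenteredGaussian.integral_fderiv_mul (hQ : IsCovarianceOp Q d lam)
    (hμ : IsCenteredGaussian μ Q) (k : ℕ) {F χ : U → ℝ} (hF : IsBddC1 F) (hχ : IsBddC1 χ) :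
    ∫ u, fderiv ℝ F u (d k) * χ u ∂μ = ∫ u, F u * gaussAdjoint d lam k χ u ∂μ := by
  have := d.secondCountableTopology
  have := hμ.1
  have hFχ := hF.mul hχ
  have key := hμ.integral_fderiv hQ k (hFχ.1.differentiable one_ne_zero)
    ((hFχ.memLp 2).integrable one_le_two) ((hFχ.memLp_fderiv (d k) 2).integrable one_le_two)
    ((hFχ.memLp 2).integrable_mul (hμ.memLp_coord hQ k))
  have i1 : Integrable (fun u => fderiv ℝ F u (d k) * χ u) μ :=
    (hF.memLp_fderiv (d k) 2).integrable_mul (hχ.memLp 2)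
  have i2 : Integrable (fun u => F u * gaussAdjoint d lam k χ u) μ :=
    (hF.memLp 2).integrable_mul (memLp_gaussAdjoint hQ hμ k hχ)
  rw [← sub_eq_zero, ← integral_sub i1 i2, ← key]
  refine integral_congr_ae (Eventually.of_forall fun u => ?_)
  simp only []
  rw [fderiv_fun_mul (hF.1.differentiable one_ne_zero u) (hχ.1.differentiable one_ne_zero u)]
  simp [gaussAdjoint]
  ring

/-- The components of the Sobolev gradient are weak derivatives. -/
theorem HasSobolevGrad.integral_mul (hQ : IsCovarianceOp Q d lam) (hμ : IsCenteredGaussian μ Q)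
    {θ : ℝ} (hθ : 0 ≤ θ) {Φ : U → EReal} {G : U → U} (hΦ : HasSobolevGrad d lam θ μ Φ G) (k : ℕ)
    {χ : U → ℝ} (hχ : IsBddC1 χ) :
    ∫ u, ⟪G u, d k⟫_ℝ * χ u ∂μ =
      lam k ^ θ * ∫ u, (Φ u).toReal * gaussAdjoint d lam k χ u ∂μ := by
  have := d.secondCountableTopology
  have := hμ.1
  obtain ⟨-, hΦ2, hG2, f, hf, hf1, hf2⟩ := hΦ
  have hb : ∀ j, IsBddC1 (f j) := fun j => (hf j).isBddC1
  have hg : ∀ j u, ⟪(covPow d lam θ).ev (gradient (f j) u), d k⟫_ℝ =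
      lam k ^ θ * fderiv ℝ (f j) u (d k) := fun j u => by
    rw [hQ.inner_covPow_ev hθ, inner_gradient_left]
  have l1 := tendsto_integral_mul_of_eLpNorm (fun j => (hb j).memLp 2) hΦ2
    (memLp_gaussAdjoint hQ hμ k hχ) hf1
  have l2 := tendsto_integral_mul_of_eLpNorm
    (a := fun j u => ⟪(covPow d lam θ).ev (gradient (f j) u), d k⟫_ℝ)
    (a' := fun u => ⟪G u, d k⟫_ℝ) (b := χ) (μ := μ)
    (fun j => by simp_rw [hg]; exact ((hb j).memLp_fderiv _ _).const_mul _)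
    (hG2.inner_const (d k)) (hχ.memLp 2)
    (by
      refine tendsto_of_tendsto_of_tendsto_of_le_of_le tendsto_const_nhds hf2 (fun _ => zero_le)
        fun j => eLpNorm_mono fun u => ?_
      rw [← inner_sub_left]
      refine (norm_inner_le_norm _ _).trans ?_
      rw [d.orthonormal.1 k, mul_one])
  -- Both sides are L² limits of the identity for the approximating cylinder functions, where it is
  -- integration by parts.
  refine tendsto_nhds_unique l2 ?_
  refine (l1.const_mul (lam k ^ θ)).congr fun j => ?_
  rw [← hμ.integral_fderiv_mul hQ k (hb j) hχ, ← integral_const_mul]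
  exact integral_congr_ae (Eventually.of_forall fun u => by simp only [hg]; ring)

/-- The Sobolev gradient is additive, for a bounded `C¹` summand with bounded derivative. -/
theorem HasSobolevGrad.inner_eq_add (hQ : IsCovarianceOp Q d lam) (hμ : IsCenteredGaussian μ Q)
    {θ : ℝ} (hθ : 0 ≤ θ) {Φ Φ₁ : U → EReal} {G G₁ : U → U} (hΦ : HasSobolevGrad d lam θ μ Φ G)
    (hΦ₁ : HasSobolevGrad d lam θ μ Φ₁ G₁) {Φ₂ : U → ℝ} (hΦ₂ : IsBddC1 Φ₂)
    (hsum : ∀ u, Φ u = Φ₁ u + ((Φ₂ u : ℝ) : EReal)) (k : ℕ) :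
    ∀ᵐ u ∂μ, ⟪G u, d k⟫_ℝ = ⟪G₁ u, d k⟫_ℝ + lam k ^ θ * fderiv ℝ Φ₂ u (d k) := by
  have := d.secondCountableTopology
  have := hμ.1
  have m0 : MemLp (fun u => ⟪G u, d k⟫_ℝ) 2 μ := hΦ.2.2.1.inner_const (d k)
  have m1 : MemLp (fun u => ⟪G₁ u, d k⟫_ℝ) 2 μ := hΦ₁.2.2.1.inner_const (d k)
  have m2 : MemLp (fun u => fderiv ℝ Φ₂ u (d k)) 2 μ := hΦ₂.memLp_fderiv (d k) 2
  set H : U → ℝ := fun u => ⟪G u, d k⟫_ℝ - ⟪G₁ u, d k⟫_ℝ - lam k ^ θ * fderiv ℝ Φ₂ u (d k)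
    with hH
  have hHi : Integrable H μ := ((m0.sub m1).sub (m2.const_mul _)).integrable one_le_two
  have hreal : ∀ᵐ u ∂μ, (Φ u).toReal = (Φ₁ u).toReal + Φ₂ u := by
    filter_upwards [hΦ₁.1] with u hu
    rw [hsum, EReal.toReal_add hu.1 hu.2 (EReal.coe_ne_top _) (EReal.coe_ne_bot _),
      EReal.toReal_coe]
  -- Moving every derivative onto the test function leaves Φ - Φ₁ - Φ₂ integrated against the
  -- adjoint, and this difference vanishes almost everywhere.
  have key : ∀ χ : U → ℝ, IsBddC1 χ → ∫ u, H u * χ u ∂μ = 0 := by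
    intro χ hχ
    have hA := memLp_gaussAdjoint hQ hμ k hχ
    have c2 : MemLp χ 2 μ := hχ.memLp 2
    have e : ∀ u, H u * χ u = ⟪G u, d k⟫_ℝ * χ u - ⟪G₁ u, d k⟫_ℝ * χ u -
        lam k ^ θ * (fderiv ℝ Φ₂ u (d k) * χ u) := fun u => by rw [hH]; ring
    have i0 : Integrable (fun u => ⟪G u, d k⟫_ℝ * χ u) μ := m0.integrable_mul c2
    have i1 : Integrable (fun u => ⟪G₁ u, d k⟫_ℝ * χ u) μ := m1.integrable_mul c2
    have i2 : Integrable (fun u => fderiv ℝ Φ₂ u (d k) * χ u) μ := m2.integrable_mul c2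
    have i01 : Integrable (fun u => ⟪G u, d k⟫_ℝ * χ u - ⟪G₁ u, d k⟫_ℝ * χ u) μ := i0.sub i1
    have j0 : Integrable (fun u => (Φ u).toReal * gaussAdjoint d lam k χ u) μ :=
      hΦ.2.1.integrable_mul hA
    have j1 : Integrable (fun u => (Φ₁ u).toReal * gaussAdjoint d lam k χ u) μ :=
      hΦ₁.2.1.integrable_mul hA
    have j2 : Integrable (fun u => Φ₂ u * gaussAdjoint d lam k χ u) μ :=
      (hΦ₂.memLp 2).integrable_mul hA
    have j01 : Integrable (fun u => (Φ u).toReal * gaussAdjoint d lam k χ u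
        - (Φ₁ u).toReal * gaussAdjoint d lam k χ u) μ := j0.sub j1
    simp_rw [e]
    rw [integral_sub i01 (i2.const_mul _), integral_sub i0 i1, integral_const_mul,
      hΦ.integral_mul hQ hμ hθ k hχ, hΦ₁.integral_mul hQ hμ hθ k hχ,
      hμ.integral_fderiv_mul hQ k hΦ₂ hχ, ← mul_sub, ← mul_sub,
      ← integral_sub j0 j1, ← integral_sub j01 j2]
    refine mul_eq_zero_of_right _ (integral_eq_zero_of_ae ?_)
    filter_upwards [hreal] with u hu
    simp only [Pi.zero_apply]
    rw [hu]; ring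
  have hz := ae_eq_zero_of_integral_cos_sin hHi (fun t => key _ (isBddC1_cos t))
    (fun t => key _ (isBddC1_sin t))
  filter_upwards [hz] with u hu
  simp only [hH, Pi.zero_apply] at hu
  linarith

end WeakGradient

/-! ### Matrix form of the operators acting on cylinder functions -/

section CoordinateFormulas

/-- Diagonal powers of a finite dimensional covariance matrix. -/
noncomputable def diagPowL (lam : ℕ → ℝ) (s : ℝ) (N : ℕ) :
    EuclideanSpace ℝ (Fin N) →L[ℝ] EuclideanSpace ℝ (Fin N) :=
  (EuclideanSpace.equiv (Fin N) ℝ).symm.toContinuousLinearMap.comp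
    (ContinuousLinearMap.pi fun i : Fin N => (lam i ^ s) • EuclideanSpace.proj i)

theorem diagPowL_apply (lam : ℕ → ℝ) (s : ℝ) (N : ℕ) (x : EuclideanSpace ℝ (Fin N)) (i : Fin N) :
    diagPowL lam s N x i = lam i ^ s * x i := by
  simp [diagPowL]

theorem diagPowL_neg_one (lam : ℕ → ℝ) (N : ℕ) : diagPowL lam (-1) N = invCovL lam N := by
  ext x i
  rw [diagPowL_apply, invCovL_apply, Real.rpow_neg_one, div_eq_inv_mul]

theorem norm_diagPowL_neg_half_sq {lam : ℕ → ℝ} (hlam : ∀ k, 0 < lam k) (N : ℕ)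
    (x : EuclideanSpace ℝ (Fin N)) :
    ‖diagPowL lam (-(1 / 2)) N x‖ ^ 2 = ⟪invCovL lam N x, x⟫_ℝ := by
  rw [EuclideanSpace.norm_sq_eq, inner_invCovL]
  refine Finset.sum_congr rfl fun i _ => ?_
  have h1 : (lam i ^ (-(1 / 2) : ℝ)) ^ 2 = (lam i)⁻¹ := by
    rw [← Real.rpow_natCast, ← Real.rpow_mul (hlam i).le, ← Real.rpow_neg_one]
    norm_num
  rw [diagPowL_apply, Real.norm_eq_abs, sq_abs, mul_pow, h1]
  ring

section Space

variable {E : Type*} [NormedAddCommGroup E] [InnerProductSpace ℝ E] (d : HilbertBasis ℕ ℝ E)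

theorem norm_embedL (N : ℕ) (x : EuclideanSpace ℝ (Fin N)) : ‖embedL d N x‖ = ‖x‖ := by
  have h : ‖embedL d N x‖ ^ 2 = ‖x‖ ^ 2 := by
    rw [← real_inner_self_eq_norm_sq, inner_embedL, coordL_embedL, real_inner_self_eq_norm_sq]
  exact (sq_eq_sq₀ (norm_nonneg _) (norm_nonneg _)).1 h

theorem covPow_ev_embedL (lam : ℕ → ℝ) (s : ℝ) (N : ℕ) (x : EuclideanSpace ℝ (Fin N)) :
    (covPow d lam s).ev (embedL d N x) = embedL d N (diagPowL lam s N x) := by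
  have hx := finSpan_le_covPow_domain d lam s N (embedL_mem_finSpan d N x)
  refine d.repr.injective (lp.ext (funext fun k => ?_))
  rw [d.repr_apply_apply, d.repr_apply_apply, inner_covPow_ev d lam s hx, inner_basis_embedL,
    inner_basis_embedL]
  split_ifs with h
  · rw [diagPowL_apply]
  · rw [mul_zero]

theorem coordL_basis (N : ℕ) (i : Fin N) : coordL d N (d i) = EuclideanSpace.single i 1 := by
  ext j
  rw [coordL_apply, orthonormal_iff_ite.1 d.orthonormal, PiLp.single_apply]
  simp [Fin.ext_iff]

theorem coordL_basis_eq_zero (N : ℕ) {k : ℕ} (hk : N ≤ k) : coordL d N (d k) = 0 := by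
  ext j
  rw [coordL_apply, orthonormal_iff_ite.1 d.orthonormal, if_neg (by have := j.2; omega)]
  rfl

theorem traceIn_embedL (N : ℕ)
    (A : EuclideanSpace ℝ (Fin N) →L[ℝ] EuclideanSpace ℝ (Fin N)) :
    traceIn d (fun v => embedL d N (A (coordL d N v))) = opTrace _ A := by
  rw [traceIn, tsum_eq_sum (s := Finset.range N), Finset.sum_range,
    opTrace_eq_sum (EuclideanSpace.basisFun (Fin N) ℝ)]
  · refine Finset.sum_congr rfl fun i _ => ?_
    rw [inner_embedL, coordL_basis, real_inner_comm, EuclideanSpace.basisFun_apply]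
  · intro k hk
    rw [coordL_basis_eq_zero d N (by simpa using hk)]
    simp

variable {d} in
/-- A smooth cylinder function depends smoothly on the first `N` coordinates, for all large `N`. -/
theorem IsCylinder.exists_coordL {f : E → ℝ} (hf : IsCylinder d ⊤ f) :
    ∃ n, ∀ N, n ≤ N → ∃ φ : EuclideanSpace ℝ (Fin N) → ℝ, ContDiff ℝ 3 φ ∧
      (∃ M, ∀ x, |φ x| ≤ M ∧ ‖fderiv ℝ φ x‖ ≤ M ∧ ‖fderiv ℝ (fderiv ℝ φ) x‖ ≤ M) ∧
      f = fun u => φ (coordL d N u) := by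
  obtain ⟨n, φ₀, hφ₀, hb, rfl⟩ := hf
  refine ⟨n, fun N hN => ?_⟩
  -- Keeps the first n of N coordinates. It lets φ₀ be viewed as a function of any larger number of
  -- coordinates, in particular of a block dimension.
  set π := (coordL d n) ∘L (embedL d N) with hπ
  have h3 : ContDiff ℝ 3 φ₀ :=
    hφ₀.of_le (m := ((3 : ℕ∞) : WithTop ℕ∞)) (WithTop.coe_le_coe.2 le_top)
  have hφ : ContDiff ℝ 3 (φ₀ ∘ π) := h3.comp π.contDiff
  have hbd : ∀ j : ℕ, (j : ℕ∞) ≤ 3 → ∃ B : ℝ, ∀ x, ‖iteratedFDeriv ℝ j (φ₀ ∘ π) x‖ ≤ B := by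
    intro j hj
    obtain ⟨B, hB⟩ := hb j le_top
    refine ⟨B * ∏ _i : Fin j, ‖π‖, fun x => ?_⟩
    rw [π.iteratedFDeriv_comp_right h3 x (by exact_mod_cast hj)]
    refine (ContinuousMultilinearMap.norm_compContinuousLinearMap_le _ _).trans ?_
    exact mul_le_mul_of_nonneg_right (hB _) (Finset.prod_nonneg fun _ _ => norm_nonneg _)
  obtain ⟨B₀, h0⟩ := hbd 0 (by simp)
  obtain ⟨B₁, h1⟩ := hbd 1 (by norm_num)
  obtain ⟨B₂, h2⟩ := hbd 2 (by norm_num)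
  refine ⟨φ₀ ∘ π, hφ, ⟨max B₀ (max B₁ B₂), fun x => ⟨?_, ?_, ?_⟩⟩, ?_⟩
  · refine le_trans ?_ (le_max_left _ _)
    simpa using h0 x
  · refine le_trans ?_ ((le_max_left _ _).trans (le_max_right _ _))
    rw [← norm_iteratedFDeriv_one]; exact h1 x
  · refine le_trans ?_ ((le_max_right _ _).trans (le_max_right _ _))
    rw [← norm_iteratedFDeriv_one, norm_iteratedFDeriv_fderiv]; exact h2 x
  · funext u
    simp only [Function.comp_apply]
    congr 1
    ext i
    rw [coordMap_eq_coordL, coordL_apply, hπ, ContinuousLinearMap.comp_apply, coordL_apply,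
      inner_basis_embedL, dif_pos (i.2.trans_le hN), coordL_apply]

end Space

variable {U : Type*} [NormedAddCommGroup U] [InnerProductSpace ℝ U] [CompleteSpace U]
  (d : HilbertBasis ℕ ℝ U)

theorem gradient_comp_coordL (N : ℕ) {φ : EuclideanSpace ℝ (Fin N) → ℝ}
    (hφ : Differentiable ℝ φ) (u : U) :
    gradient (fun u => φ (coordL d N u)) u = embedL d N (gradient φ (coordL d N u)) := by
  refine ext_inner_right ℝ fun v => ?_
  have := (hφ (coordL d N u)).hasFDerivAt.comp u (coordL d N).hasFDerivAt
  rw [inner_gradient_left, show fderiv ℝ (fun u => φ (coordL d N u)) u = _ from this.fderiv,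
    inner_embedL, inner_gradient_left]
  rfl

theorem contDiff_gradient {E : Type*} [NormedAddCommGroup E] [InnerProductSpace ℝ E]
    [CompleteSpace E] {φ : E → ℝ} {m n : WithTop ℕ∞} (hφ : ContDiff ℝ n φ) (hmn : m + 1 ≤ n) :
    ContDiff ℝ m (gradient φ) :=
  (InnerProductSpace.toDual ℝ E).symm.contDiff.comp (hφ.fderiv_right hmn)

/-- By Riesz duality, pairing D(∇φ)v with w gives D²φ(v, w). Taking w to be D(∇φ)v itself and
cancelling one factor ‖w‖ gives the bound. -/
theorem norm_fderiv_gradient_le {E : Type*} [NormedAddCommGroup E] [InnerProductSpace ℝ E]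
    [CompleteSpace E] {φ : E → ℝ} (hφ : ContDiff ℝ 2 φ) (x : E) :
    ‖fderiv ℝ (gradient φ) x‖ ≤ ‖fderiv ℝ (fderiv ℝ φ) x‖ := by
  refine ContinuousLinearMap.opNorm_le_bound _ (ContinuousLinearMap.opNorm_nonneg _) fun v => ?_
  set w := fderiv ℝ (gradient φ) x v with hw
  have h1 := (innerSL ℝ w).hasFDerivAt.comp x (((contDiff_gradient hφ (m := 1)
    (by norm_num)).differentiable one_ne_zero x).hasFDerivAt)
  have h2 := ((hφ.fderiv_right (m := 1) (by norm_num)).differentiable one_ne_zero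
    x).hasFDerivAt.clm_apply (hasFDerivAt_const w x)
  have h3 : (innerSL ℝ w ∘ gradient φ) = fun y => fderiv ℝ φ y w := by
    funext y
    rw [Function.comp_apply, innerSL_apply_apply, real_inner_comm, inner_gradient_left]
  rw [h3] at h1
  have h4 := congrArg (fun L => L v) (h1.unique h2)
  simp only [ContinuousLinearMap.comp_apply, innerSL_apply_apply, ← hw,
    real_inner_self_eq_norm_sq] at h4
  have h5 : ‖w‖ ^ 2 ≤ ‖fderiv ℝ (fderiv ℝ φ) x‖ * ‖v‖ * ‖w‖ := by
    rw [h4]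
    refine (le_abs_self _).trans ?_
    simpa using ContinuousLinearMap.le_opNorm₂ (fderiv ℝ (fderiv ℝ φ) x) v w
  by_cases hw0 : ‖w‖ = 0
  · rw [hw0]; positivity
  · have hp : 0 < ‖w‖ := lt_of_le_of_ne (norm_nonneg _) (Ne.symm hw0)
    rw [sq] at h5
    exact le_of_mul_le_mul_right h5 hp

theorem hess_comp_coordL (N : ℕ) {φ : EuclideanSpace ℝ (Fin N) → ℝ} (hφ : ContDiff ℝ 2 φ)
    (u v : U) : hess (fun u => φ (coordL d N u)) u v =
      embedL d N (fderiv ℝ (gradient φ) (coordL d N u) (coordL d N v)) := by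
  have h1 : gradient (fun u => φ (coordL d N u)) =
      fun u => embedL d N (gradient φ (coordL d N u)) :=
    funext fun u => gradient_comp_coordL d N (hφ.differentiable two_ne_zero) u
  have h2 : Differentiable ℝ (gradient φ) :=
    (contDiff_gradient hφ (m := 1) (by norm_num)).differentiable one_ne_zero
  have h3 := (embedL d N).hasFDerivAt.comp u
    ((h2 (coordL d N u)).hasFDerivAt.comp u (coordL d N).hasFDerivAt)
  rw [hess, h1]
  exact congrArg (fun L => L v) h3.fderiv

variable {V : Type*} [NormedAddCommGroup V] [InnerProductSpace ℝ V] [CompleteSpace V]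

/-- The matrix of `K₂₁ Q₂⁻¹ K₁₂` on the span of the first `N` basis vectors. -/
noncomputable def blockC (e : HilbertBasis ℕ ℝ V) (lam₂ : ℕ → ℝ) (K : U →L[ℝ] V) (N : ℕ) :
    EuclideanSpace ℝ (Fin N) →L[ℝ] EuclideanSpace ℝ (Fin N) :=
  coordL d N ∘L K.adjoint ∘L embedL e N ∘L invCovL lam₂ N ∘L coordL e N ∘L K ∘L embedL d N

variable {d} {e : HilbertBasis ℕ ℝ V} {lam₂ : ℕ → ℝ} {K : U →L[ℝ] V} {N : ℕ}

/-- Block invariance keeps each factor of K₂₁ Q₂⁻¹ K₁₂ inside a finite span, so the projections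
built into the matrix lose nothing and no domain question arises. -/
theorem opC_ev_embedL (h1 : ∀ u ∈ finSpan d N, K u ∈ finSpan e N)
    (h2 : ∀ v ∈ finSpan e N, K.adjoint v ∈ finSpan d N) (x : EuclideanSpace ℝ (Fin N)) :
    (opC e lam₂ K).ev (embedL d N x) = embedL d N (blockC d e lam₂ K N x) := by
  have hk := h1 _ (embedL_mem_finSpan d N x)
  have hdom : K (embedL d N x) ∈ (covPow e lam₂ (-1)).domain :=
    finSpan_le_covPow_domain e lam₂ _ _ hk
  have hdom' : embedL d N x ∈ (opC e lam₂ K).domain := hdom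
  have h3 : covPow e lam₂ (-1) ⟨K (embedL d N x), hdom⟩ =
      embedL e N (invCovL lam₂ N (coordL e N (K (embedL d N x)))) := by
    have := covPow_ev_embedL e lam₂ (-1) N (coordL e N (K (embedL d N x)))
    rwa [embedL_coordL_of_mem e hk, LinearPMap.ev, dif_pos hdom, diagPowL_neg_one] at this
  rw [LinearPMap.ev, dif_pos hdom']
  change K.adjoint (covPow e lam₂ (-1) ⟨K (embedL d N x), hdom⟩) = _
  rw [h3]
  exact (embedL_coordL_of_mem d (h2 _ (embedL_mem_finSpan e N _))).symm

theorem inner_blockC (x : EuclideanSpace ℝ (Fin N)) :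
    ⟪blockC d e lam₂ K N x, x⟫_ℝ =
      ⟪invCovL lam₂ N (coordL e N (K (embedL d N x))), coordL e N (K (embedL d N x))⟫_ℝ := by
  rw [blockC, ContinuousLinearMap.comp_apply, inner_coordL, ContinuousLinearMap.comp_apply,
    ContinuousLinearMap.adjoint_inner_left, ContinuousLinearMap.comp_apply, inner_embedL]
  rfl

/-- The form is ∑ (Kx)ᵢ²/λ₂ᵢ. Positivity of K₂₁K₁₂ makes Kx nonzero, and block invariance puts all
of Kx in the first N coordinates, so one of these is nonzero. -/
theorem inner_blockC_pos (hlam : ∀ k, 0 < lam₂ k) (h1 : ∀ u ∈ finSpan d N, K u ∈ finSpan e N)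
    (hpos : ∀ u : U, u ≠ 0 → 0 < ⟪K.adjoint (K u), u⟫_ℝ) {x : EuclideanSpace ℝ (Fin N)}
    (hx : x ≠ 0) : 0 < ⟪blockC d e lam₂ K N x, x⟫_ℝ := by
  have hx' : embedL d N x ≠ 0 := by
    rw [← norm_ne_zero_iff, norm_embedL]; exact norm_ne_zero_iff.2 hx
  have hk := hpos _ hx'
  rw [ContinuousLinearMap.adjoint_inner_left, real_inner_self_eq_norm_sq] at hk
  have hz : coordL e N (K (embedL d N x)) ≠ 0 := by
    intro h
    have := embedL_coordL_of_mem e (h1 _ (embedL_mem_finSpan d N x))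
    rw [h, map_zero] at this
    rw [← this] at hk
    simp at hk
  rw [inner_blockC, inner_invCovL]
  have : ∃ i, coordL e N (K (embedL d N x)) i ≠ 0 := by
    by_contra! hcon
    exact hz (by ext i; simpa using hcon i)
  obtain ⟨i, hi⟩ := this
  refine Finset.sum_pos' (fun j _ => div_nonneg (mul_self_nonneg _) (hlam j).le)
    ⟨i, Finset.mem_univ i, div_pos (mul_self_pos.2 hi) (hlam i)⟩

/-- Coordinate representation of the operators applied to a smooth cylinder function. -/
theorem exists_coordinate_representation (hlam₂ : ∀ k, 0 < lam₂ k) (hK : BlockInvariant d e K)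
    (hpos : ∀ u : U, u ≠ 0 → 0 < ⟪K.adjoint (K u), u⟫_ℝ) {lam₁ : ℕ → ℝ}
    (hlam₁ : ∀ k, 0 < lam₁ k) (θ : ℝ) {f : U → ℝ} (hf : IsCylinder d ⊤ f) :
    ∃ (N : ℕ) (φ : EuclideanSpace ℝ (Fin N) → ℝ)
      (h : EuclideanSpace ℝ (Fin N) → EuclideanSpace ℝ (Fin N))
      (q : EuclideanSpace ℝ (Fin N) → ℝ) (M : ℝ),
      ContDiff ℝ 1 φ ∧ ContDiff ℝ 2 h ∧
      (∀ x, |φ x| ≤ M ∧ ‖fderiv ℝ φ x‖ ≤ M ∧ ‖h x‖ ≤ M ∧ ‖fderiv ℝ h x‖ ≤ M) ∧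
      (∀ (t : ℝ) v, q (t • v) = t ^ 2 * q v) ∧ Continuous q ∧ (∀ v, 0 ≤ q v) ∧
      (∀ x, q (h x) = ⟪gradient φ x, h x⟫_ℝ) ∧
      (∀ v, ∃ x ∈ finSpan d N, (opC e lam₂ K).ev x = embedL d N v ∧
        ⟪(opC e lam₂ K).ev x, x⟫_ℝ = q v) ∧
      (∀ u, f u = φ (coordL d N u)) ∧
      (∀ u, secondOrderTerm d lam₁ (opC e lam₂ K) f u =
        opTrace _ (fderiv ℝ h (coordL d N u) ∘L fderiv ℝ h (coordL d N u)) +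
          ⟪invCovL lam₁ N (h (coordL d N u)), h (coordL d N u)⟫_ℝ) ∧
      ∀ G u, opN d lam₁ (opC e lam₂ K) θ G f u =
        opTrace _ (fderiv ℝ h (coordL d N u)) -
          ⟪invCovL lam₁ N (coordL d N u), h (coordL d N u)⟫_ℝ -
          ⟪coordL d N (G u), diagPowL lam₁ (-θ) N (h (coordL d N u))⟫_ℝ := by
  obtain ⟨n, hn⟩ := hf.exists_coordL
  obtain ⟨N, hN, h1, h2⟩ : ∃ N, n ≤ N ∧ (∀ u ∈ finSpan d N, K u ∈ finSpan e N) ∧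
      ∀ v ∈ finSpan e N, K.adjoint v ∈ finSpan d N := by
    obtain ⟨m, hm, hmK⟩ := hK
    exact ⟨m n, hm.id_le n, hmK n⟩
  obtain ⟨φ, hφ, ⟨M, hM⟩, rfl⟩ := hn N hN
  set C := blockC d e lam₂ K N with hC
  have hCpos : ∀ x, x ≠ 0 → 0 < ⟪C x, x⟫_ℝ := fun x hx => inner_blockC_pos hlam₂ h1 hpos hx
  have hinj : Function.Injective (C : EuclideanSpace ℝ (Fin N) →ₗ[ℝ] EuclideanSpace ℝ (Fin N)) := by
    rw [injective_iff_map_eq_zero]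
    intro x hx
    by_contra hne
    have := hCpos x hne
    rw [show C x = 0 from hx, inner_zero_left] at this
    exact this.false
  -- Positivity makes C injective, hence invertible in finite dimension. Every v in the span is then
  -- some Cx with x in the span, which is the form in which semiconvexity is assumed.
  let Ce := LinearEquiv.ofInjectiveEndo _ hinj
  have hCe : ∀ x, Ce.symm (C x) = x := fun x => Ce.symm_apply_apply x
  have hCe' : ∀ x, C (Ce.symm x) = x := fun x => Ce.apply_symm_apply x
  have hev := opC_ev_embedL (lam₂ := lam₂) h1 h2
  set h : EuclideanSpace ℝ (Fin N) → EuclideanSpace ℝ (Fin N) := fun x => C (gradient φ x)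
    with hh
  have hg : ContDiff ℝ 2 (gradient φ) := contDiff_gradient hφ (by norm_num)
  have hdh : ∀ x, fderiv ℝ h x = C ∘L fderiv ℝ (gradient φ) x := fun x =>
    (C.hasFDerivAt.comp x (hg.differentiable two_ne_zero x).hasFDerivAt).fderiv
  have hφd := hφ.differentiable three_ne_zero
  have hCg : ∀ u, (opC e lam₂ K).ev (gradient (fun u => φ (coordL d N u)) u) =
      embedL d N (h (coordL d N u)) := fun u => by
    rw [gradient_comp_coordL d N hφd, hev]
  have hCh : ∀ u v, (opC e lam₂ K).ev (hess (fun u => φ (coordL d N u)) u v) =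
      embedL d N (fderiv ℝ h (coordL d N u) (coordL d N v)) := fun u v => by
    rw [hess_comp_coordL d N (hφ.of_le (by norm_num)), hev, hdh]; rfl
  have hn1 : ∀ x, ‖gradient φ x‖ ≤ M := fun x => by
    rw [← (InnerProductSpace.toDual ℝ _).norm_map, toDual_gradient]; exact (hM x).2.1
  have hn2 : ∀ x, ‖fderiv ℝ (gradient φ) x‖ ≤ M := fun x =>
    (norm_fderiv_gradient_le (hφ.of_le (by norm_num)) x).trans (hM x).2.2
  have hM0 : 0 ≤ M := (abs_nonneg _).trans (hM 0).1
  -- Here q(v) = ⟨v, C⁻¹v⟩; at v = Cx it equals ⟨Cx, x⟩. The second entry of the maximum bounds h =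
  -- C∇φ and its derivative.
  refine ⟨N, φ, h, fun v => ⟪v, Ce.symm v⟫_ℝ, max M (‖C‖ * M), hφ.of_le (by norm_num),
    C.contDiff.comp hg, fun x => ⟨(hM x).1.trans (le_max_left _ _),
      (hM x).2.1.trans (le_max_left _ _), ?_, ?_⟩, ?_, ?_, ?_, ?_, ?_, fun u => rfl, ?_, ?_⟩
  · refine le_trans ?_ (le_max_right _ _)
    exact (C.le_opNorm _).trans (by gcongr; exact hn1 x)
  · refine le_trans ?_ (le_max_right _ _)
    rw [hdh]
    exact (ContinuousLinearMap.opNorm_comp_le _ _).trans (by gcongr; exact hn2 x)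
  · intro t v
    simp only [map_smul, inner_smul_left, inner_smul_right]
    simp; ring
  · have : Continuous Ce.symm := Ce.symm.toLinearMap.continuous_of_finiteDimensional
    fun_prop
  · intro v
    have : v = C (Ce.symm v) := (hCe' v).symm
    by_cases h0 : Ce.symm v = 0
    · simp [h0]
    · have := hCpos _ h0
      rw [hCe'] at this
      exact this.le
  · intro x
    simp only [hh, hCe]
    rw [real_inner_comm]
  · intro v
    refine ⟨embedL d N (Ce.symm v), embedL_mem_finSpan d N _, ?_, ?_⟩
    · rw [hev, ← hC, hCe']
    · rw [hev, ← hC, hCe', inner_embedL, coordL_embedL]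
  · intro u
    rw [secondOrderTerm, hCg, covPow_ev_embedL, norm_embedL, norm_diagPowL_neg_half_sq hlam₁]
    congr 1
    rw [← traceIn_embedL d N]
    congr 1
    funext v
    rw [hCh u v, hCh, coordL_embedL]
    rfl
  · intro G u
    rw [opN, hCg, covPow_ev_embedL, covPow_ev_embedL, ← inner_coordL, ← inner_coordL,
      diagPowL_neg_one]
    congr 2
    · rw [← traceIn_embedL d N]
      congr 1
      funext v
      exact hCh u v
    · rw [real_inner_comm, inner_invCovL, inner_invCovL]
      exact Finset.sum_congr rfl fun i _ => by ring

end CoordinateFormulas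

/-! ### Iterated limits as convergence along a curried filter -/

section IteratedLimits

instance curry_atTop_neBot : ((atTop : Filter ℕ).curry (atTop : Filter ℕ)).NeBot := by
  refine ⟨fun h => ?_⟩
  have h1 : ∀ᶠ _x in (atTop : Filter ℕ).curry (atTop : Filter ℕ), False := by simp [h]
  rw [eventually_curry_iff] at h1
  obtain ⟨n, hn⟩ := h1.exists
  obtain ⟨m, hm⟩ := hn.exists
  exact hm

/-- The curried filter means "for all large n, for all m large depending on n". An open
neighbourhood of x containing the inner limit also contains the nearby terms. Both limits can then
be handled by one filter when comparing inequalities. -/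
theorem IteratedLim.tendsto_curry {X : Type*} [TopologicalSpace X] {a : ℕ → ℕ → X} {x : X}
    (h : IteratedLim a x) :
    Tendsto (fun p : ℕ × ℕ => a p.1 p.2) ((atTop : Filter ℕ).curry atTop) (𝓝 x) := by
  obtain ⟨b, hb, hx⟩ := h
  intro s hs
  obtain ⟨t, hts, ht, hxt⟩ := mem_nhds_iff.1 hs
  change ∀ᶠ p : ℕ × ℕ in (atTop : Filter ℕ).curry atTop, a p.1 p.2 ∈ s
  rw [eventually_curry_iff]
  filter_upwards [hx (ht.mem_nhds hxt)] with n hn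
  filter_upwards [hb n (ht.mem_nhds hn)] with m hm
  exact hts hm

theorem IteratedLim.map {X Y : Type*} [TopologicalSpace X] [TopologicalSpace Y]
    {a : ℕ → ℕ → X} {x : X} (h : IteratedLim a x) {g : X → Y} (hg : Continuous g) :
    IteratedLim (fun n m => g (a n m)) (g x) := by
  obtain ⟨b, hb, hx⟩ := h
  exact ⟨fun n => g (b n), fun n => (hg.tendsto _).comp (hb n), (hg.tendsto _).comp hx⟩

/-- Dominated convergence for iterated limits. -/
theorem IteratedLim.integral {X : Type*} [MeasurableSpace X] {μ : Measure X}
    {w : ℕ → ℕ → X → ℝ} {w' S : X → ℝ} {K : ℝ} (hw : ∀ n m, AEStronglyMeasurable (w n m) μ)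
    (hK : ∀ n m, ∀ᵐ u ∂μ, |w n m u| ≤ K) (hS : Integrable S μ)
    (h : ∀ᵐ u ∂μ, IteratedLim (fun n m => w n m u) (w' u)) :
    IteratedLim (fun n m => ∫ u, S u * w n m u ∂μ) (∫ u, S u * w' u ∂μ) := by
  -- The inner limits are given separately at each point; `limUnder` makes them into functions,
  -- measurable as almost everywhere limits.
  set v : ℕ → X → ℝ := fun n u => limUnder atTop (fun m => w n m u)
  have hv : ∀ᵐ u ∂μ, (∀ n, Tendsto (fun m => w n m u) atTop (𝓝 (v n u))) ∧
      Tendsto (fun n => v n u) atTop (𝓝 (w' u)) := by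
    filter_upwards [h] with u ⟨b, hb, hx⟩
    have e : ∀ n, v n u = b n := fun n => (hb n).limUnder_eq
    refine ⟨fun n => ?_, ?_⟩
    · rw [e]; exact hb n
    · simp_rw [e]; exact hx
  have hvm : ∀ n, AEStronglyMeasurable (v n) μ := fun n =>
    aestronglyMeasurable_of_tendsto_ae atTop (hw n) (hv.mono fun u hu => hu.1 n)
  have hvK : ∀ n, ∀ᵐ u ∂μ, |v n u| ≤ K := fun n => by
    filter_upwards [hv, ae_all_iff.2 fun m => hK n m] with u hu hk
    exact le_of_tendsto (hu.1 n).abs (Eventually.of_forall hk)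
  have hb : Integrable (fun u => ‖S u‖ * K) μ := hS.norm.mul_const K
  refine ⟨fun n => ∫ u, S u * v n u ∂μ, fun n => ?_, ?_⟩
  · refine tendsto_integral_of_dominated_convergence (fun u => ‖S u‖ * K)
      (fun m => hS.1.mul (hw n m)) hb (fun m => ?_) ?_
    · filter_upwards [hK n m] with u hu
      rw [norm_mul]
      exact mul_le_mul_of_nonneg_left hu (norm_nonneg _)
    · filter_upwards [hv] with u hu
      exact (hu.1 n).const_mul _
  · refine tendsto_integral_of_dominated_convergence (fun u => ‖S u‖ * K)
      (fun n => hS.1.mul (hvm n)) hb (fun n => ?_) ?_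
    · filter_upwards [hvK n] with u hu
      rw [norm_mul]
      exact mul_le_mul_of_nonneg_left hu (norm_nonneg _)
    · filter_upwards [hv] with u hu
      exact hu.2.const_mul _

theorem integral_sq_eq_eLpNorm_sq {X : Type*} [MeasurableSpace X] {μ : Measure X} {a : X → ℝ}
    (ha : MemLp a 2 μ) : ∫ u, a u ^ 2 ∂μ = (eLpNorm a 2 μ).toReal ^ 2 := by
  have h0 : 0 ≤ ∫ u, a u ^ 2 ∂μ := integral_nonneg fun u => sq_nonneg _
  rw [ha.eLpNorm_eq_integral_rpow_norm (by norm_num) (by norm_num)]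
  have e : ∀ u, ‖a u‖ ^ (2 : ℝ≥0∞).toReal = a u ^ 2 := fun u => by
    rw [ENNReal.toReal_ofNat, Real.rpow_ofNat, Real.norm_eq_abs, sq_abs]
  simp_rw [e]
  rw [ENNReal.toReal_ofReal (Real.rpow_nonneg h0 _), ← Real.rpow_natCast, ← Real.rpow_mul h0]
  norm_num

end IteratedLimits

/-! ### Convexity and semiconvexity as bounds on gradient increments -/

section Convexity

variable {U : Type*} [NormedAddCommGroup U] [InnerProductSpace ℝ U] [CompleteSpace U]

/-- Restricted to the line u + tw the function is convex, so its derivative at t = 1 is at least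
that at t = 0. -/
theorem ConvexOn.inner_gradient_sub_nonneg {Ψ : U → ℝ} (hΨ : ConvexOn ℝ Set.univ Ψ)
    (hd : Differentiable ℝ Ψ) (u w : U) : 0 ≤ ⟪gradient Ψ (u + w) - gradient Ψ u, w⟫_ℝ := by
  have hline : ∀ t : ℝ, HasDerivAt (fun t : ℝ => Ψ (u + t • w))
      ⟪gradient Ψ (u + t • w), w⟫_ℝ t := fun t => by
    have h1 : HasDerivAt (fun t : ℝ => u + t • w) w t := by
      simpa using ((hasDerivAt_id t).smul_const w).const_add u
    have := (hd (u + t • w)).hasFDerivAt.comp_hasDerivAt t h1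
    rwa [← inner_gradient_left] at this
  have hconv : ConvexOn ℝ Set.univ (fun t : ℝ => Ψ (u + t • w)) := by
    refine ⟨convex_univ, fun s _ t _ a b ha hb hab => ?_⟩
    have h2 := hΨ.2 (Set.mem_univ (u + s • w)) (Set.mem_univ (u + t • w)) ha hb hab
    convert! h2 using 2
    rw [smul_add, smul_add, add_add_add_comm, ← add_smul, hab, one_smul, smul_eq_mul, smul_eq_mul,
      add_smul, mul_smul, mul_smul]
  have hmono := hconv.monotoneOn_deriv fun t _ => (hline t).differentiableAt
  have h3 := hmono (Set.mem_univ 0) (Set.mem_univ 1) zero_le_one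
  rw [(hline 0).deriv, (hline 1).deriv, zero_smul, add_zero, one_smul] at h3
  rw [inner_sub_left]
  linarith

/-- Mean value theorem for t ↦ ⟨∇Φ₂(u + tw), w⟩ on [0, 1]. -/
theorem inner_gradient_sub_ge {Φ₂ : U → ℝ} (hΦ : ContDiff ℝ 2 Φ₂) {w : U} {κ : ℝ}
    (h : ∀ v, κ ≤ ⟪hess Φ₂ v w, w⟫_ℝ) (u : U) :
    κ ≤ ⟪gradient Φ₂ (u + w) - gradient Φ₂ u, w⟫_ℝ := by
  have hg : Differentiable ℝ (gradient Φ₂) :=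
    (contDiff_gradient hΦ (m := 1) (by norm_num)).differentiable one_ne_zero
  have hline : ∀ t : ℝ, HasDerivAt (fun t : ℝ => ⟪gradient Φ₂ (u + t • w), w⟫_ℝ)
      ⟪hess Φ₂ (u + t • w) w, w⟫_ℝ t := fun t => by
    have h1 : HasDerivAt (fun t : ℝ => u + t • w) w t := by
      simpa using ((hasDerivAt_id t).smul_const w).const_add u
    have h2 := (hg (u + t • w)).hasFDerivAt.comp_hasDerivAt t h1
    have h3 := h2.inner ℝ (hasDerivAt_const t w)
    simp only [inner_zero_right, zero_add] at h3
    exact h3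
  obtain ⟨t, -, ht⟩ := exists_hasDerivAt_eq_slope (fun t : ℝ => ⟪gradient Φ₂ (u + t • w), w⟫_ℝ)
    (fun t => ⟪hess Φ₂ (u + t • w) w, w⟫_ℝ) zero_lt_one
    (fun t _ => (hline t).continuousAt.continuousWithinAt) (fun t _ => hline t)
  simp only [one_smul, zero_smul, add_zero, sub_zero, div_one] at ht
  rw [inner_sub_left, ← ht]
  exact h _

end Convexity

/-! ### Resolvent estimate for a regular convex potential plus Φ₂ -/

section Approximation

variable {U : Type*} [NormedAddCommGroup U] [InnerProductSpace ℝ U]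

theorem norm_coordL_sq (d : HilbertBasis ℕ ℝ U) (N : ℕ) (u : U) :
    ‖coordL d N u‖ ^ 2 = ∑ i : Fin N, ⟪u, d i⟫_ℝ ^ 2 := by
  rw [EuclideanSpace.norm_sq_eq]
  refine Finset.sum_congr rfl fun i _ => ?_
  rw [coordL_apply, Real.norm_eq_abs, sq_abs, real_inner_comm]

variable [MeasurableSpace U] {lam : ℕ → ℝ} {Q : U →L[ℝ] U} {d : HilbertBasis ℕ ℝ U} {μ : Measure U}

theorem integrable_norm_coordL_sq {N : ℕ} {F : U → U}
    (hF : ∀ i : Fin N, MemLp (fun u => ⟪F u, d i⟫_ℝ) 2 μ) :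
    Integrable (fun u => ‖coordL d N (F u)‖ ^ 2) μ := by
  simp_rw [norm_coordL_sq]
  exact integrable_finsetSum _ fun i _ => (hF i).integrable_sq

/-- The lower bound on Ψ and boundedness of Φ₂ make the weight bounded, which gives all required
integrability. Convexity of Ψ contributes nonnegatively to the gradient increment, so the defect -c
q comes from Φ₂ alone. -/
theorem IsCenteredGaussian.integral_resolvent_le_of_convex [BorelSpace U] [CompleteSpace U]
    (hQ : IsCovarianceOp Q d lam) (hμ : IsCenteredGaussian μ Q) (N : ℕ) {Ψ Φ₂ : U → ℝ}
    (hΨ : ContDiff ℝ 1 Ψ) (hconv : ConvexOn ℝ Set.univ Ψ) {b : ℝ} (hb : ∀ᵐ u ∂μ, b ≤ Ψ u)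
    (hΨ2 : ∀ i : Fin N, MemLp (fun u => ⟪gradient Ψ u, d i⟫_ℝ) 2 μ)
    (hΦ₂ : IsBddC1 Φ₂) (hΦ₂' : ContDiff ℝ 2 Φ₂)
    {q : EuclideanSpace ℝ (Fin N) → ℝ} {c : ℝ} (hc : 0 ≤ c)
    (hq : ∀ (t : ℝ) v, q (t • v) = t ^ 2 * q v) (hqc : Continuous q) (hq0 : ∀ v, 0 ≤ q v)
    (hhess : ∀ u v, -(c * q v) ≤ ⟪hess Φ₂ u (embedL d N v), embedL d N v⟫_ℝ)
    {φ : EuclideanSpace ℝ (Fin N) → ℝ} (hφ : ContDiff ℝ 1 φ)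
    {h : EuclideanSpace ℝ (Fin N) → EuclideanSpace ℝ (Fin N)} (hh : ContDiff ℝ 2 h)
    (hqh : ∀ x, q (h x) = ⟪gradient φ x, h x⟫_ℝ) {M : ℝ}
    (hM : ∀ x, |φ x| ≤ M ∧ ‖fderiv ℝ φ x‖ ≤ M ∧ ‖h x‖ ≤ M ∧ ‖fderiv ℝ h x‖ ≤ M) :
    ∫ u, (opTrace _ (fderiv ℝ h (coordL d N u) ∘L fderiv ℝ h (coordL d N u)) +
        ⟪invCovL lam N (h (coordL d N u)), h (coordL d N u)⟫_ℝ)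
          * Real.exp (-(Ψ u + Φ₂ u)) ∂μ ≤
      (1 + c / 4) * ∫ u, (φ (coordL d N u) - (opTrace _ (fderiv ℝ h (coordL d N u)) -
        ⟪invCovL lam N (coordL d N u) + coordL d N (gradient Ψ u + gradient Φ₂ u),
          h (coordL d N u)⟫_ℝ)) ^ 2 * Real.exp (-(Ψ u + Φ₂ u)) ∂μ := by
  have := d.secondCountableTopology
  have := hμ.1
  obtain ⟨-, B, hB⟩ := id hΦ₂
  have hgrad : ∀ u, gradient (fun u => Ψ u + Φ₂ u) u = gradient Ψ u + gradient Φ₂ u := fun u => by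
    refine ext_inner_right ℝ fun v => ?_
    rw [inner_add_left, inner_gradient_left, inner_gradient_left, inner_gradient_left,
      fderiv_fun_add (hΨ.differentiable one_ne_zero u) (hΦ₂.1.differentiable one_ne_zero u)]
    rfl
  have hΘ : ContDiff ℝ 1 (fun u => Ψ u + Φ₂ u) := hΨ.add hΦ₂.1
  have cΘ := hΘ.continuous
  have hm : AEStronglyMeasurable (fun u => Real.exp (-(Ψ u + Φ₂ u))) μ :=
    Continuous.aestronglyMeasurable (by fun_prop)
  have hbd : ∀ᵐ u ∂μ, ‖Real.exp (-(Ψ u + Φ₂ u))‖ ≤ Real.exp (-b + B) := by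
    filter_upwards [hb] with u hu
    rw [Real.norm_of_nonneg (Real.exp_pos _).le]
    have := (abs_le.1 (hB u).1).1
    exact Real.exp_le_exp.2 (by linarith)
  have key := hμ.integral_resolvent_le hQ N hΘ (Integrable.of_bound hm _ hbd)
    ((integrable_norm_coordL_sq (F := fun u => u) fun i => by
      simpa only [real_inner_comm] using hμ.memLp_coord hQ i).mul_bdd hm hbd)
    (by
      simp_rw [hgrad]
      refine (integrable_norm_coordL_sq fun i => ?_).mul_bdd hm hbd
      simp_rw [inner_add_left, inner_gradient_left (f := Φ₂)]
      exact (hΨ2 i).add (hΦ₂.memLp_fderiv _ _))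
    hc hq hqc hq0
    (fun u v => by
      rw [hgrad, hgrad, add_sub_add_comm, inner_add_left]
      have h1 := hconv.inner_gradient_sub_nonneg (hΨ.differentiable one_ne_zero) u (embedL d N v)
      have h2 := inner_gradient_sub_ge hΦ₂' (fun u' => hhess u' v) u
      linarith)
    hφ hh hqh (fun x => (hM x).1) (fun x => (hM x).2.1) (fun x => (hM x).2.2.1)
    (fun x => (hM x).2.2.2)
  simp_rw [hgrad] at key
  exact key

end Approximation

/-! ### Weighted L² perturbation and passage to the iterated limit -/

section Weights

variable {X : Type*} [MeasurableSpace X] {μ : Measure X}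

/-- Young's inequality 2gr ≤ εg² + ε⁻¹r². The weight is kept on g and bounded by K on r, so the
error only has to be small in unweighted L². -/
theorem integral_add_sq_mul_le {g r w : X → ℝ} (hg : MemLp g 2 μ) (hr : MemLp r 2 μ)
    (hw : AEStronglyMeasurable w μ) (hw0 : ∀ u, 0 ≤ w u) {K : ℝ} (hK : ∀ᵐ u ∂μ, |w u| ≤ K)
    {ε : ℝ} (hε : 0 < ε) :
    ∫ u, (g u + r u) ^ 2 * w u ∂μ ≤
      (1 + ε) * ∫ u, g u ^ 2 * w u ∂μ + (1 + ε⁻¹) * (K * ∫ u, r u ^ 2 ∂μ) := by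
  have ig : Integrable (fun u => g u ^ 2 * w u) μ := hg.integrable_sq.mul_bdd hw hK
  have ir := hr.integrable_sq
  have igr : Integrable (fun u => (g u + r u) ^ 2 * w u) μ :=
    (hg.add hr).integrable_sq.mul_bdd hw hK
  rw [← integral_const_mul, ← integral_const_mul, ← integral_const_mul,
    ← integral_add (ig.const_mul _) ((ir.const_mul _).const_mul _)]
  refine integral_mono_ae igr ((ig.const_mul _).add ((ir.const_mul _).const_mul _)) ?_
  filter_upwards [hK] with u hu
  have h1 : (g u + r u) ^ 2 ≤ (1 + ε) * g u ^ 2 + (1 + ε⁻¹) * r u ^ 2 := by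
    have h2 : 2 * (g u * r u) ≤ ε * g u ^ 2 + ε⁻¹ * r u ^ 2 := by
      have h3 : 0 ≤ ε⁻¹ * (ε * g u - r u) ^ 2 := by positivity
      have h4 : ε⁻¹ * (ε * g u - r u) ^ 2 =
          ε * g u ^ 2 - 2 * (g u * r u) + ε⁻¹ * r u ^ 2 := by
        field_simp
        ring
      linarith
    linarith [add_sq (g u) (r u)]
  have h5 := mul_le_mul_of_nonneg_right h1 (hw0 u)
  have h6 : (1 + ε⁻¹) * (r u ^ 2 * w u) ≤ (1 + ε⁻¹) * (K * r u ^ 2) := by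
    rw [mul_comm K]
    gcongr
    exact (le_abs_self _).trans hu
  linarith

/-- Passage to the iterated limit in a weighted inequality whose right hand side is perturbed by
an error vanishing in `L²`. -/
theorem integral_mul_le_of_iteratedLim {w : ℕ → ℕ → X → ℝ} {w' S g : X → ℝ} {K A : ℝ} (hK0 : 0 ≤ K)
    (hA : 0 ≤ A)
    (hw : ∀ n m, AEStronglyMeasurable (w n m) μ) (hw0 : ∀ n m u, 0 ≤ w n m u)
    (hK : ∀ n m, ∀ᵐ u ∂μ, |w n m u| ≤ K) (hS : Integrable S μ) (hg : MemLp g 2 μ)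
    (h : ∀ᵐ u ∂μ, IteratedLim (fun n m => w n m u) (w' u)) {r : ℕ × ℕ → X → ℝ} {δ : ℕ × ℕ → ℝ}
    (hδ : Tendsto δ ((atTop : Filter ℕ).curry atTop) (𝓝 0))
    (hr : ∀ᶠ p in (atTop : Filter ℕ).curry atTop, MemLp (r p) 2 μ ∧ ∫ u, r p u ^ 2 ∂μ ≤ δ p ∧
      ∫ u, S u * w p.1 p.2 u ∂μ ≤ A * ∫ u, (g u + r p u) ^ 2 * w p.1 p.2 u ∂μ) :
    ∫ u, S u * w' u ∂μ ≤ A * ∫ u, g u ^ 2 * w' u ∂μ := by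
  have hlS := (IteratedLim.integral hw hK hS h).tendsto_curry
  have hlg := (IteratedLim.integral hw hK hg.integrable_sq h).tendsto_curry
  -- For fixed ε the error, multiplied by K(1 + ε⁻¹), vanishes in the iterated limit; only
  -- afterwards does ε tend to zero.
  have key : ∀ ε : ℝ, 0 < ε → ∫ u, S u * w' u ∂μ ≤ A * ((1 + ε) * ∫ u, g u ^ 2 * w' u ∂μ) := by
    intro ε hε
    have hl := ((hlg.const_mul (1 + ε)).add ((hδ.const_mul K).const_mul (1 + ε⁻¹))).const_mul A
    rw [mul_zero, mul_zero, add_zero] at hl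
    refine le_of_tendsto_of_tendsto hlS hl ?_
    filter_upwards [hr] with p ⟨h1, h2, h3⟩
    refine h3.trans (mul_le_mul_of_nonneg_left ?_ hA)
    refine (integral_add_sq_mul_le hg h1 (hw _ _) (hw0 _ _) (hK _ _) hε).trans ?_
    gcongr
  have hl : Tendsto (fun ε : ℝ => A * ((1 + ε) * ∫ u, g u ^ 2 * w' u ∂μ)) (𝓝[>] 0)
      (𝓝 (A * ((1 + 0) * ∫ u, g u ^ 2 * w' u ∂μ))) :=
    (Continuous.tendsto (by fun_prop) 0).mono_left nhdsWithin_le_nhds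
  rw [add_zero, one_mul] at hl
  exact ge_of_tendsto hl (eventually_mem_nhdsWithin.mono key)

variable {F : Type*} [NormedAddCommGroup F] [InnerProductSpace ℝ F]

theorem memLp_inner_of_bound {a h : X → F} (ha : MemLp a 2 μ) (hh : AEStronglyMeasurable h μ)
    {M : ℝ} (hM : ∀ u, ‖h u‖ ≤ M) : MemLp (fun u => ⟪a u, h u⟫_ℝ) 2 μ :=
  ha.of_le_mul (c := M) (ha.1.inner hh) (Eventually.of_forall fun u => by
    rw [mul_comm]
    exact (norm_inner_le_norm _ _).trans (mul_le_mul_of_nonneg_left (hM u) (norm_nonneg _)))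

theorem integral_inner_sq_le {a h : X → F} (ha : MemLp a 2 μ) (hh : AEStronglyMeasurable h μ)
    {M : ℝ} (hM : ∀ u, ‖h u‖ ≤ M) : ∫ u, ⟪a u, h u⟫_ℝ ^ 2 ∂μ ≤ M ^ 2 * ∫ u, ‖a u‖ ^ 2 ∂μ := by
  rw [← integral_const_mul]
  refine integral_mono (memLp_inner_of_bound ha hh hM).integrable_sq
    (ha.integrable_norm_pow two_ne_zero |>.const_mul _) fun u => ?_
  simp only []
  rw [← mul_pow, ← sq_abs]
  refine pow_le_pow_left₀ (abs_nonneg _) ?_ 2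
  rw [mul_comm]
  exact (abs_real_inner_le_norm _ _).trans (mul_le_mul_of_nonneg_left (hM u) (norm_nonneg _))

end Weights

/-! ### Boltzmann weights and the Gibbs measure -/

section Gibbs

/-- The Boltzmann weight `exp (-z)`, truncated at `exp (-b)`. -/
noncomputable def boltzmannWeight (b : ℝ) (z : EReal) : ℝ :=
  (min (-z).exp (ENNReal.ofReal (Real.exp (-b)))).toReal

/-- The truncation avoids the value ∞, where `ENNReal.toReal` is discontinuous. Limits in the
extended reals, including inner limits equal to ⊤, therefore pass to real weights; above b the
truncation changes nothing. -/
theorem continuous_boltzmannWeight (b : ℝ) : Continuous (boltzmannWeight b) := by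
  refine ENNReal.continuousOn_toReal.comp_continuous
    ((ENNReal.continuous_exp.comp continuous_neg).min continuous_const) fun z => ?_
  exact ((min_le_right _ _).trans_lt ENNReal.ofReal_lt_top).ne

theorem exp_neg_le_of_le {b : ℝ} {z : EReal} (hz : (b : EReal) ≤ z) :
    (-z).exp ≤ ENNReal.ofReal (Real.exp (-b)) := by
  rw [← EReal.exp_coe, EReal.exp_le_exp_iff, EReal.coe_neg]
  exact EReal.neg_le_neg_iff.2 hz

theorem boltzmannWeight_of_le {b : ℝ} {z : EReal} (hz : (b : EReal) ≤ z) :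
    boltzmannWeight b z = (-z).exp.toReal := by
  rw [boltzmannWeight, min_eq_left (exp_neg_le_of_le hz)]

theorem boltzmannWeight_coe {b r : ℝ} (h : b ≤ r) :
    boltzmannWeight b (r : EReal) = Real.exp (-r) := by
  rw [boltzmannWeight_of_le (EReal.coe_le_coe_iff.2 h), ← EReal.coe_neg, EReal.exp_coe,
    ENNReal.toReal_ofReal (Real.exp_pos _).le]

variable {E : Type*} [MeasurableSpace E] {μ : Measure E} {Φ : E → EReal}

/-- The density is at most e^{-b}, and almost everywhere finiteness of Φ keeps the normalising
integral positive. Domination by a finite multiple of μ transfers integrability from μ to the Gibbs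
measure. -/
theorem gibbsMeasure_le [NeZero μ] (hΦ : Measurable Φ) {b : ℝ} (hb : ∀ u, (b : EReal) ≤ Φ u)
    (hfin : ∀ᵐ u ∂μ, Φ u ≠ ⊤) : ∃ K : ℝ≥0∞, K ≠ ⊤ ∧ gibbsMeasure μ Φ ≤ K • μ := by
  have hm : Measurable fun u => (-Φ u).exp := EReal.measurable_exp.comp hΦ.neg
  have hZ : ∫⁻ u, (-Φ u).exp ∂μ ≠ 0 := by
    rw [Ne, lintegral_eq_zero_iff hm]
    intro h
    obtain ⟨u, h1, h2⟩ := (h.and hfin).exists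
    simp at h1
    exact h2 h1
  refine ⟨(∫⁻ u, (-Φ u).exp ∂μ)⁻¹ * ENNReal.ofReal (Real.exp (-b)),
    ENNReal.mul_ne_top (ENNReal.inv_ne_top.2 hZ) ENNReal.ofReal_ne_top, ?_⟩
  rw [gibbsMeasure, mul_smul]
  gcongr
  rw [← withDensity_const]
  exact withDensity_mono (Eventually.of_forall fun u => exp_neg_le_of_le (hb u))

theorem integral_gibbsMeasure (hΦ : Measurable Φ) {b : ℝ} (hb : ∀ u, (b : EReal) ≤ Φ u)
    (F : E → ℝ) : ∫ u, F u ∂(gibbsMeasure μ Φ) =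
      (∫⁻ u, (-Φ u).exp ∂μ)⁻¹.toReal * ∫ u, F u * (-Φ u).exp.toReal ∂μ := by
  have hm : Measurable fun u => (-Φ u).exp := EReal.measurable_exp.comp hΦ.neg
  rw [gibbsMeasure, integral_smul_measure, integral_withDensity_eq_integral_toReal_smul₀
    hm.aemeasurable (Eventually.of_forall fun u =>
      (exp_neg_le_of_le (hb u)).trans_lt ENNReal.ofReal_lt_top), smul_eq_mul]
  simp_rw [smul_eq_mul, mul_comm (F _)]

end Gibbs

/-! ### Removing the regularisation of Φ₁ -/

section MainEstimate

variable {U : Type*} [NormedAddCommGroup U] [InnerProductSpace ℝ U] [MeasurableSpace U]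
  {lam : ℕ → ℝ} {Q : U →L[ℝ] U} {d : HilbertBasis ℕ ℝ U} {μ : Measure U}

theorem memLp_coordL {N : ℕ} {F : U → U} (hF : ∀ i : Fin N, MemLp (fun u => ⟪F u, d i⟫_ℝ) 2 μ) :
    MemLp (fun u => coordL d N (F u)) 2 μ :=
  MemLp.of_eval_piLp fun i => by
    simpa only [coordL_apply, real_inner_comm] using hF i

theorem integral_norm_coordL_sq {N : ℕ} {F : U → U}
    (hF : ∀ i : Fin N, MemLp (fun u => ⟪F u, d i⟫_ℝ) 2 μ) :
    ∫ u, ‖coordL d N (F u)‖ ^ 2 ∂μ =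
      ∑ i : Fin N, (eLpNorm (fun u => ⟪F u, d i⟫_ℝ) 2 μ).toReal ^ 2 := by
  simp_rw [norm_coordL_sq]
  rw [integral_finsetSum _ fun i _ => (hF i).integrable_sq]
  exact Finset.sum_congr rfl fun i _ => integral_sq_eq_eLpNorm_sq (hF i)

variable [BorelSpace U]

theorem integrable_opTrace_comp_add [IsFiniteMeasure μ] (N : ℕ)
    {h : EuclideanSpace ℝ (Fin N) → EuclideanSpace ℝ (Fin N)} (hh : ContDiff ℝ 1 h) {M : ℝ}
    (hM : ∀ x, ‖h x‖ ≤ M ∧ ‖fderiv ℝ h x‖ ≤ M) :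
    Integrable (fun u => opTrace _ (fderiv ℝ h (coordL d N u) ∘L fderiv ℝ h (coordL d N u)) +
      ⟪invCovL lam N (h (coordL d N u)), h (coordL d N u)⟫_ℝ) μ := by
  have := d.secondCountableTopology
  have hM0 : 0 ≤ M := (norm_nonneg _).trans (hM 0).1
  have c1 := hh.continuous
  have c2 := hh.continuous_fderiv one_ne_zero
  refine Integrable.of_bound (Continuous.aestronglyMeasurable (by fun_prop))
    (‖opTrace (EuclideanSpace ℝ (Fin N))‖ * (M * M) + ‖invCovL lam N‖ * M * M)
    (Eventually.of_forall fun u => (norm_add_le _ _).trans (add_le_add ?_ ?_))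
  · refine (ContinuousLinearMap.le_opNorm _ _).trans ?_
    gcongr
    refine (ContinuousLinearMap.opNorm_comp_le _ _).trans ?_
    gcongr <;> exact (hM _).2
  · refine (norm_inner_le_norm _ _).trans ?_
    gcongr
    · refine (ContinuousLinearMap.le_opNorm _ _).trans ?_
      gcongr
      exact (hM _).1
    · exact (hM _).1

theorem IsCenteredGaussian.memLp_resolvent (hQ : IsCovarianceOp Q d lam)
    (hμ : IsCenteredGaussian μ Q) (N : ℕ) {G : U → U}
    (hG : ∀ i : Fin N, MemLp (fun u => ⟪G u, d i⟫_ℝ) 2 μ) (θ : ℝ)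
    {φ : EuclideanSpace ℝ (Fin N) → ℝ} (hφ : Continuous φ)
    {h : EuclideanSpace ℝ (Fin N) → EuclideanSpace ℝ (Fin N)} (hh : ContDiff ℝ 1 h) {M : ℝ}
    (hM : ∀ x, |φ x| ≤ M ∧ ‖h x‖ ≤ M ∧ ‖fderiv ℝ h x‖ ≤ M) :
    MemLp (fun u => φ (coordL d N u) - (opTrace _ (fderiv ℝ h (coordL d N u)) -
      ⟪invCovL lam N (coordL d N u), h (coordL d N u)⟫_ℝ -
      ⟪coordL d N (G u), diagPowL lam θ N (h (coordL d N u))⟫_ℝ)) 2 μ := by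
  have := d.secondCountableTopology
  have := hμ.1
  have c1 := hh.continuous
  have c2 := hh.continuous_fderiv one_ne_zero
  have h1 : MemLp (fun u => coordL d N u) 2 μ := memLp_coordL (F := fun u => u) fun i => by
    simpa only [real_inner_comm] using hμ.memLp_coord hQ i
  refine MemLp.sub ?_ (MemLp.sub (MemLp.sub ?_ ?_) ?_)
  · exact MemLp.of_bound (Continuous.aestronglyMeasurable (by fun_prop)) M
      (Eventually.of_forall fun u => (hM _).1)
  · refine MemLp.of_bound (Continuous.aestronglyMeasurable (by fun_prop))
      (‖opTrace (EuclideanSpace ℝ (Fin N))‖ * M) (Eventually.of_forall fun u => ?_)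
    refine (ContinuousLinearMap.le_opNorm _ _).trans ?_
    gcongr
    exact (hM _).2.2
  · exact memLp_inner_of_bound ((invCovL lam N).comp_memLp' h1)
      (Continuous.aestronglyMeasurable (by fun_prop)) fun u => (hM _).2.1
  · refine memLp_inner_of_bound (memLp_coordL hG) (M := ‖diagPowL lam θ N‖ * M)
      (Continuous.aestronglyMeasurable (by fun_prop)) fun u => ?_
    refine (ContinuousLinearMap.le_opNorm _ _).trans ?_
    gcongr
    exact (hM _).2.1

/-- The estimate holds for each Ψ + Φ₂ whose gradient error is in L². Relative to the target, g is
perturbed by r = ⟨Q^θ DΨ - G₁, Q^{-θ}h⟩, which involves N components and a bounded field, hence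
tends to zero in L² along the iterated limit. -/
theorem ConvexApprox.integral_resolvent_le [CompleteSpace U] (hQ : IsCovarianceOp Q d lam)
    (hμ : IsCenteredGaussian μ Q) {θ : ℝ} (hθ : 0 ≤ θ) {Φ Φ₁ : U → EReal} {Φ₂ : U → ℝ} {G : U → U}
    (hΦ : HasSobolevGrad d lam θ μ Φ G) (hsum : ∀ u, Φ u = Φ₁ u + ((Φ₂ u : ℝ) : EReal))
    (hΦ₁ : ConvexApprox d lam θ μ Φ₁) (hΦ₂ : IsBddC1 Φ₂) (hΦ₂' : ContDiff ℝ 2 Φ₂) (N : ℕ)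
    {q : EuclideanSpace ℝ (Fin N) → ℝ} {c : ℝ} (hc : 0 ≤ c)
    (hq : ∀ (t : ℝ) v, q (t • v) = t ^ 2 * q v) (hqc : Continuous q) (hq0 : ∀ v, 0 ≤ q v)
    (hhess : ∀ u v, -(c * q v) ≤ ⟪hess Φ₂ u (embedL d N v), embedL d N v⟫_ℝ)
    {φ : EuclideanSpace ℝ (Fin N) → ℝ} (hφ : ContDiff ℝ 1 φ)
    {h : EuclideanSpace ℝ (Fin N) → EuclideanSpace ℝ (Fin N)} (hh : ContDiff ℝ 2 h)
    (hqh : ∀ x, q (h x) = ⟪gradient φ x, h x⟫_ℝ) {M : ℝ}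
    (hM : ∀ x, |φ x| ≤ M ∧ ‖fderiv ℝ φ x‖ ≤ M ∧ ‖h x‖ ≤ M ∧ ‖fderiv ℝ h x‖ ≤ M) :
    ∫ u, (opTrace _ (fderiv ℝ h (coordL d N u) ∘L fderiv ℝ h (coordL d N u)) +
        ⟪invCovL lam N (h (coordL d N u)), h (coordL d N u)⟫_ℝ) * (-Φ u).exp.toReal ∂μ ≤
      (1 + c / 4) * ∫ u, (φ (coordL d N u) - (opTrace _ (fderiv ℝ h (coordL d N u)) -
        ⟪invCovL lam N (coordL d N u), h (coordL d N u)⟫_ℝ -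
        ⟪coordL d N (G u), diagPowL lam (-θ) N (h (coordL d N u))⟫_ℝ)) ^ 2
          * (-Φ u).exp.toReal ∂μ := by
  have := d.secondCountableTopology
  have := hμ.1
  obtain ⟨hbot, G₁, Ψ, hG₁, hconv, hlow, hlim, hlip, hgl⟩ := hΦ₁
  obtain ⟨b, -, hb⟩ := EReal.lt_iff_exists_real_btwn.1 hbot
  obtain ⟨-, B, hB⟩ := id hΦ₂
  have hbΨ : ∀ᵐ u ∂μ, ∀ n m, b ≤ Ψ n m u :=
    hlow.mono fun u hu n m => EReal.coe_le_coe_iff.1 (hb.le.trans (hu n m))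
  have hbΦ₁ : ∀ u, (b : EReal) ≤ Φ₁ u := fun u => hb.le.trans (iInf_le _ u)
  have hΨ1 : ∀ n m, ContDiff ℝ 1 (Ψ n m) := fun n m => by
    obtain ⟨L, hL⟩ := (hlip n m).2
    exact contDiff_one_iff_fderiv.2 ⟨(hlip n m).1, hL.continuous⟩
  have cΨ := fun n m => (hΨ1 n m).continuous
  have cΦ₂ := hΦ₂.1.continuous
  have c1 := hh.continuous
  have hM0 : 0 ≤ M := (abs_nonneg _).trans (hM 0).1
  set a : ℕ × ℕ → U → U := fun p u => (covPow d lam θ).ev (gradient (Ψ p.1 p.2) u) - G₁ u with ha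
  have ha_inner : ∀ p u k, ⟪a p u, d k⟫_ℝ =
      lam k ^ θ * fderiv ℝ (Ψ p.1 p.2) u (d k) - ⟪G₁ u, d k⟫_ℝ := fun p u k => by
    rw [ha, inner_sub_left, hQ.inner_covPow_ev hθ, inner_gradient_left]
  have hG₁2 : ∀ k, MemLp (fun u => ⟪G₁ u, d k⟫_ℝ) 2 μ := fun k => hG₁.2.2.1.inner_const (d k)
  have ham : ∀ p k, AEStronglyMeasurable (fun u => ⟪a p u, d k⟫_ℝ) μ := fun p k => by
    simp_rw [ha_inner]
    have := (hΨ1 p.1 p.2).continuous_fderiv one_ne_zero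
    exact (Continuous.aestronglyMeasurable (by fun_prop)).sub (hG₁2 k).1
  -- The errors are known to have finite L² norm only once they are close to their limit 0, hence
  -- eventually along the curried filter.
  have hfin : ∀ᶠ p in (atTop : Filter ℕ).curry atTop, ∀ i : Fin N,
      MemLp (fun u => ⟪a p u, d i⟫_ℝ) 2 μ := by
    refine eventually_all.2 fun i => ?_
    filter_upwards [(hgl i).tendsto_curry.eventually (gt_mem_nhds ENNReal.zero_lt_top)] with p hp
    exact ⟨ham p i, hp⟩
  set D : ℝ := ‖diagPowL lam (-θ) N‖ * M
  have hD : ∀ u, ‖diagPowL lam (-θ) N (h (coordL d N u))‖ ≤ D := fun u => by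
    refine (ContinuousLinearMap.le_opNorm _ _).trans ?_
    exact mul_le_mul_of_nonneg_left (hM _).2.2.1 (norm_nonneg _)
  have hDm : AEStronglyMeasurable (fun u => diagPowL lam (-θ) N (h (coordL d N u))) μ :=
    Continuous.aestronglyMeasurable (by fun_prop)
  have hδ : Tendsto (fun p => D ^ 2 * ∑ i : Fin N,
      (eLpNorm (fun u => ⟪a p u, d i⟫_ℝ) 2 μ).toReal ^ 2) ((atTop : Filter ℕ).curry atTop)
      (𝓝 0) := by
    have h0 : D ^ 2 * ∑ _i : Fin N, (0 : ℝ≥0∞).toReal ^ 2 = 0 := by simp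
    rw [← h0]
    refine (tendsto_finsetSum _ fun i _ => ?_).const_mul _
    exact ((ENNReal.tendsto_toReal ENNReal.zero_ne_top).comp (hgl i).tendsto_curry).pow 2
  refine integral_mul_le_of_iteratedLim (w := fun n m u => Real.exp (-(Ψ n m u + Φ₂ u)))
    (K := Real.exp (-b + B)) (Real.exp_pos _).le (by positivity)
    (fun n m => Continuous.aestronglyMeasurable (by fun_prop)) (fun n m u => (Real.exp_pos _).le)
    (fun n m => ?_) (integrable_opTrace_comp_add N (hh.of_le one_le_two) fun x => (hM x).2.2)
    (hμ.memLp_resolvent hQ N (fun i => hΦ.2.2.1.inner_const (d i)) _ hφ.continuous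
      (hh.of_le one_le_two) fun x => ⟨(hM x).1, (hM x).2.2⟩) ?_
    (r := fun p u => ⟪coordL d N (a p u), diagPowL lam (-θ) N (h (coordL d N u))⟫_ℝ) hδ ?_
  · filter_upwards [hbΨ] with u hu
    rw [abs_of_pos (Real.exp_pos _)]
    exact Real.exp_le_exp.2 (by linarith [hu n m, (abs_le.1 (hB u).1).1])
  -- Map the iterated limit in the extended reals through the continuous truncated weight; since Ψ
  -- and Φ₁ are at least b, the truncation is inactive.
  · filter_upwards [hlim, hbΨ, hG₁.1] with u hu hbu hfu
    have h1 := (hu.map (continuous_boltzmannWeight b)).map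
      (continuous_mul_const (Real.exp (-Φ₂ u)))
    lift Φ₁ u to ℝ using hfu with s hs
    have hbs : b ≤ s := EReal.coe_le_coe_iff.1 (by rw [hs]; exact hbΦ₁ u)
    simp_rw [boltzmannWeight_coe (hbu _ _), boltzmannWeight_coe hbs, ← Real.exp_add,
      ← neg_add] at h1
    rwa [hsum, ← hs, ← EReal.coe_add, ← EReal.coe_neg, EReal.exp_coe,
      ENNReal.toReal_ofReal (Real.exp_pos _).le]
  · filter_upwards [hfin] with p hp
    refine ⟨memLp_inner_of_bound (memLp_coordL hp) hDm hD, ?_, ?_⟩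
    · rw [← integral_norm_coordL_sq hp]
      exact integral_inner_sq_le (memLp_coordL hp) hDm hD
    -- The i-th component of Q^θ DΨ is that of a + G₁; dividing by λᵢ^θ recovers the partial
    -- derivative.
    · have hΨ2 : ∀ i : Fin N, MemLp (fun u => ⟪gradient (Ψ p.1 p.2) u, d i⟫_ℝ) 2 μ := fun i => by
        refine (((hp i).add (hG₁2 i)).const_mul (lam i ^ θ)⁻¹).ae_eq
          (Eventually.of_forall fun u => ?_)
        have := (Real.rpow_pos_of_pos (hQ.pos i) θ).ne'
        simp only [Pi.add_apply, ha_inner, inner_gradient_left]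
        field_simp
        ring
      refine (hμ.integral_resolvent_le_of_convex hQ N (hΨ1 _ _) (hconv _ _)
        (hbΨ.mono fun u hu => hu p.1 p.2) hΨ2 hΦ₂ hΦ₂' hc hq hqc hq0 hhess hφ hh hqh hM).trans
        (le_of_eq ?_)
      congr 1
      refine integral_congr_ae ?_
      filter_upwards [ae_all_iff.2 fun i : Fin N =>
        hΦ.inner_eq_add hQ hμ hθ hG₁ hΦ₂ hsum i] with u hu
      -- In each coordinate insert λ^{-θ}λ^θ = 1. Since a = Q^θ DΨ - G₁ and G = G₁ + Q^θ DΦ₂, the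
      -- vector Q^θ(DΨ + DΦ₂) is G + a, so the perturbed resolvent is exactly g + r.
      have e : ⟪coordL d N (gradient (Ψ p.1 p.2) u + gradient Φ₂ u), h (coordL d N u)⟫_ℝ =
          ⟪coordL d N (G u) + coordL d N (a p u), diagPowL lam (-θ) N (h (coordL d N u))⟫_ℝ := by
        simp only [PiLp.inner_apply]
        refine Finset.sum_congr rfl fun i _ => ?_
        have h2 : lam i ^ (-θ) * lam i ^ θ = 1 := by
          rw [← Real.rpow_add (hQ.pos i), neg_add_cancel, Real.rpow_zero]
        have h3 : ⟪d i, G u⟫_ℝ + ⟪d i, a p u⟫_ℝ = lam i ^ θ *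
            ⟪d i, gradient (Ψ p.1 p.2) u + gradient Φ₂ u⟫_ℝ := by
          rw [real_inner_comm, real_inner_comm (a p u), hu i, ha_inner, inner_add_right,
            inner_gradient_right, inner_gradient_right]
          simp
          ring
        rw [diagPowL_apply, PiLp.add_apply, coordL_apply, coordL_apply, coordL_apply, h3]
        simp only [RCLike.inner_apply, conj_trivial]
        linear_combination (h (coordL d N u) i *
          ⟪d i, gradient (Ψ p.1 p.2) u + gradient Φ₂ u⟫_ℝ) * -h2
      rw [inner_add_left] at e
      simp only [inner_add_left]
      rw [e]
      ring

end MainEstimate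

/-! ### Assembly of the estimate for the Gibbs measure -/

theorem mainTheorem5
    {U V : Type*}
    [NormedAddCommGroup U] [InnerProductSpace ℝ U] [CompleteSpace U]
    [MeasurableSpace U] [BorelSpace U]
    [NormedAddCommGroup V] [InnerProductSpace ℝ V] [CompleteSpace V]
    (d : HilbertBasis ℕ ℝ U) (e : HilbertBasis ℕ ℝ V) (lam₁ lam₂ : ℕ → ℝ)
    (Q₁ : U →L[ℝ] U) (Q₂ : V →L[ℝ] V)
    (hQ₁ : IsCovarianceOp Q₁ d lam₁) (hQ₂ : IsCovarianceOp Q₂ e lam₂)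
    (μ₁ : Measure U) (hμ₁ : IsCenteredGaussian μ₁ Q₁)
    (K₁₂ : U →L[ℝ] V) (hK : BlockInvariant d e K₁₂)
    (hpos : ∀ u : U, u ≠ 0 → 0 < ⟪K₁₂.adjoint (K₁₂ u), u⟫_ℝ)
    (θ : ℝ) (hθ : 0 ≤ θ)
    (Φ : U → EReal) (hΦmeas : Measurable Φ) (hΦbdd : ∃ b : ℝ, ∀ u, (b : EReal) ≤ Φ u)
    (G : U → U) (hΦ : HasSobolevGrad d lam₁ θ μ₁ Φ G)
    (Φ₁ : U → EReal) (Φ₂ : U → ℝ) (hsum : ∀ u, Φ u = Φ₁ u + ((Φ₂ u : ℝ) : EReal))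
    (hΦ₁ : ConvexApprox d lam₁ θ μ₁ Φ₁)
    (c : ℝ) (hΦ₂ : SemiConvexAlong d (opC e lam₂ K₁₂) (gibbsMeasure μ₁ Φ) Φ₂ c)
    (f : U → ℝ) (hf : IsCylinder d ⊤ f)
    (g : U → ℝ) (hg : ∀ u, g u = f u - opN d lam₁ (opC e lam₂ K₁₂) θ G f u) :
    MemLp g 2 (gibbsMeasure μ₁ Φ) ∧
    Integrable (secondOrderTerm d lam₁ (opC e lam₂ K₁₂) f) (gibbsMeasure μ₁ Φ) ∧
    ∫ u, secondOrderTerm d lam₁ (opC e lam₂ K₁₂) f u ∂(gibbsMeasure μ₁ Φ)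
      ≤ (4 + c / 4) * ∫ u, g u ^ 2 ∂(gibbsMeasure μ₁ Φ) := by
  have := hμ₁.1
  obtain ⟨N, φ, h, q, M, hφ, hh, hM, hq, hqc, hq0, hqh, hqC, hfφ, hS, hN⟩ :=
    exists_coordinate_representation hQ₂.pos hK hpos hQ₁.pos θ hf
  obtain ⟨⟨B₀, hB₀⟩, hΦ₂C, ⟨B₁, hB₁⟩, -, hc, hhess⟩ := hΦ₂
  obtain ⟨b, hb⟩ := hΦbdd
  have hΦ₂' : IsBddC1 Φ₂ := ⟨hΦ₂C.of_le one_le_two, max B₀ B₁, fun u =>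
    ⟨(hB₀ u).trans (le_max_left _ _), (hB₁ u).trans (le_max_right _ _)⟩⟩
  -- Write the embedded v as Cx with x in the span; semiconvexity along C then reads as a bound by
  -- q(v).
  have hhess' : ∀ u v, -(c * q v) ≤ ⟪hess Φ₂ u (embedL d N v), embedL d N v⟫_ℝ := fun u v => by
    obtain ⟨x, hx, hx1, hx2⟩ := hqC v
    have := hhess N u x hx
    rwa [hx2, hx1, neg_mul] at this
  have key := hΦ₁.integral_resolvent_le hQ₁ hμ₁ hθ hΦ hsum hΦ₂' hΦ₂C N hc hq hqc hq0 hhess' hφ hh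
    hqh hM
  have hSi : Integrable (secondOrderTerm d lam₁ (opC e lam₂ K₁₂) f) μ₁ := by
    rw [funext hS]
    exact integrable_opTrace_comp_add N (hh.of_le one_le_two) fun x => (hM x).2.2
  have hgφ : g = fun u => φ (coordL d N u) - (opTrace _ (fderiv ℝ h (coordL d N u)) -
      ⟪invCovL lam₁ N (coordL d N u), h (coordL d N u)⟫_ℝ -
      ⟪coordL d N (G u), diagPowL lam₁ (-θ) N (h (coordL d N u))⟫_ℝ) :=
    funext fun u => by rw [hg, hfφ, hN]
  have hgi : MemLp g 2 μ₁ := by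
    rw [hgφ]
    exact hμ₁.memLp_resolvent hQ₁ N (fun i => hΦ.2.2.1.inner_const (d i)) _ hφ.continuous
      (hh.of_le one_le_two) fun x => ⟨(hM x).1, (hM x).2.2⟩
  obtain ⟨K, hK1, hK2⟩ := gibbsMeasure_le hΦmeas hb (hΦ.1.mono fun u hu => hu.1)
  refine ⟨hgi.of_measure_le_smul hK1 hK2, hSi.of_measure_le_smul hK1 hK2, ?_⟩
  rw [integral_gibbsMeasure hΦmeas hb, integral_gibbsMeasure hΦmeas hb, mul_left_comm]
  -- The normalising factor is common to both sides.
  refine mul_le_mul_of_nonneg_left ?_ ENNReal.toReal_nonneg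
  have h0 : 0 ≤ ∫ u, g u ^ 2 * (-Φ u).exp.toReal ∂μ₁ :=
    integral_nonneg fun u => mul_nonneg (sq_nonneg _) ENNReal.toReal_nonneg
  simp_rw [hS]
  rw [hgφ] at h0 ⊢
  -- The constant 1 + c/4 from the estimate is at most 4 + c/4.
  exact key.trans (mul_le_mul_of_nonneg_right (by linarith) h0)
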